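/- Let $k$ be an algebraically closed field of characteristic $0$, $Y$ a projective variety over $k$, $L$ an ample line bundle on $Y$, $S=\bigoplus_{m\ge 0}H^0(Y,L^{\otimes m})$ its section ring, $C(Y)=\operatorname{Spec}S$ the affine cone and $U=C(Y)\setminus V(S_+)$ the punctured cone, with the action of $\mathbb G_m$ given by the grading of $S$. Write $T_X=\mathcal{H}om(\Omega_X,\mathcal O_X)=\mathcal{D}er_k(\mathcal O_X,\mathcal O_X)$ for the tangent sheaf and $(-)_{(0)}$ for the part of $\mathbb G_m$-weight $0$. All cohomology groups are regarded as $k$-vector spaces. There is exactly one $\mathbb G_m$-invariant $k$-morphism $\pi:U\to Y$ together with which the line bundle $\pi^*L$ has a trivialisation under which, for all $m\ge0$ and $s\in H^0(Y,L^{\otimes m})$, the section $\pi^*s$ becomes the function $s\in S$ on $U$. There is a short exact sequence of sheaves on $Y$ $$0\longrightarrow \mathcal O_Y\xrightarrow{\ e\ }(\pi_*T_U)_{(0)}\xrightarrow{\ p\ }T_Y\longrightarrow 0,$$ where $e(a)=\pi^*(a)\,E$ with $E$ the Euler vector field ($E(s)=ms$ for $s\in S_m$), and $p$ is the differential of $\pi$.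 Let $$H^1(Y,\mathcal O_Y)\xrightarrow{\ \alpha\ }H^1\big(Y,(\pi_*T_U)_{(0)}\big)\xrightarrow{\ \beta\ }H^1(Y,T_Y)\xrightarrow{\ \delta\ }H^2(Y,\mathcal O_Y)$$ be the corresponding fragment of its long exact cohomology sequence. It is exact, and: (a) The canonical map $H^1(Y,(\pi_*T_U)_{(0)})\to H^1(U,T_U)$ is injective with image $H^1(U,T_U)_{(0)}$. Regarding $\alpha$ and $\beta$ as maps into and out of $H^1(U,T_U)_{(0)}$ through the resulting isomorphism $H^1(U,T_U)_{(0)}\cong H^1(Y,(\pi_*T_U)_{(0)})$, the map $\beta$ induces an isomorphism $$H^1(U,T_U)_{(0)}\,/\,\operatorname{im}(\alpha)\;\cong\;\ker\big(\delta:H^1(Y,T_Y)\to H^2(Y,\mathcal O_Y)\big).$$ (b) If $H^1(Y,\mathcal O_Y)=0$ and $H^2(Y,\mathcal O_Y)=0$, then $\beta$ is an isomorphism $H^1(U,T_U)_{(0)}\cong H^1(Y,T_Y)$. (c) If $H^1(Y,\mathcal O_Y)=0$ and $\delta=0$, then $\beta$ is an isomorphism $H^1(U,T_U)_{(0)}\cong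 H^1(Y,T_Y)$. (d) If the Atiyah class of $L$, i.e. the class in $H^1(Y,\Omega_Y)$ of the Čech cocycle $d\log g_{ij}$ with $g_{ij}$ the transition functions of $L$, vanishes, then $\delta=0$; so (c) applies if moreover $H^1(Y,\mathcal O_Y)=0$. -/

import Mathlib

open CategoryTheory TopologicalSpace AlgebraicGeometry Opposite Limits

universe u

noncomputable section

/-! ### Cohomology of sheaves of vector spaces -/

namespace SheafCoh

variable (k : Type u) [Field k]

instance sheafLinear (X : TopCat.{u}) : Linear k (TopCat.Sheaf (ModuleCat.{u} k) X) :=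
  inferInstanceAs (Linear k (ObjectProperty.FullSubcategory _))

attribute [local instance] reflectsLimits_of_reflectsIsomorphisms in
instance pullback_preservesFiniteLimits {X Y : TopCat.{u}} (f : X ⟶ Y) :
    PreservesFiniteLimits (TopCat.Sheaf.pullback (ModuleCat.{u} k) f) :=
  Functor.sheafPullbackConstruction.preservesFiniteLimits _ _ _ _

instance pullback_additive {X Y : TopCat.{u}} (f : X ⟶ Y) :
    (TopCat.Sheaf.pullback (ModuleCat.{u} k) f).Additive :=
  Functor.additive_of_preserves_binary_products _

instance pullback_linear {X Y : TopCat.{u}} (f : X ⟶ Y) :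
    (TopCat.Sheaf.pullback (ModuleCat.{u} k) f).Linear k where
  map_smul {F G} g r := by
    let adj := TopCat.Sheaf.pullbackPushforwardAdjunction (ModuleCat.{u} k) f
    apply (adj.homEquiv _ _).injective
    have h1 := adj.unit.naturality g
    have h2 := adj.unit.naturality (r • g)
    simp only [Functor.id_map, Functor.comp_map] at h1 h2
    rw [adj.homEquiv_unit, adj.homEquiv_unit, ← h2]
    have h3 : (TopCat.Sheaf.pushforward (ModuleCat.{u} k) f).map
        (r • (TopCat.Sheaf.pullback (ModuleCat.{u} k) f).map g) =
        r • (TopCat.Sheaf.pushforward (ModuleCat.{u} k) f).map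
          ((TopCat.Sheaf.pullback (ModuleCat.{u} k) f).map g) := rfl
    rw [h3, Linear.comp_smul, Linear.smul_comp, h1]

variable {k}

/-- The constant sheaf with value `k`. -/
abbrev const (k : Type u) [Field k] (X : TopCat.{u}) : TopCat.Sheaf (ModuleCat.{u} k) X :=
  (constantSheaf (Opens.grothendieckTopology X) (ModuleCat.{u} k)).obj (ModuleCat.of k k)

/-- Sheaf cohomology `Hⁿ(X, F)` of a sheaf of `k`-vector spaces, as a `k`-vector space:
`Extⁿ` from the constant sheaf `k` to `F`, as in `CategoryTheory.Sheaf.H`. -/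
abbrev H {X : TopCat.{u}} (F : TopCat.Sheaf (ModuleCat.{u} k) X) (n : ℕ) : Type u :=
  Abelian.Ext (const k X) F n

/-- The map on cohomology induced by a morphism of sheaves. -/
def H.map {X : TopCat.{u}} {F G : TopCat.Sheaf (ModuleCat.{u} k) X} (φ : F ⟶ G) (n : ℕ) :
    H F n →ₗ[k] H G n :=
  (Abelian.Ext.bilinearCompOfLinear k (const k X) F G n 0 n (add_zero n)).flip (Abelian.Ext.mk₀ φ)

/-- The connecting homomorphism `Hⁿ(X, S₃) → Hⁿ⁺¹(X, S₁)` of a short exact sequence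
`0 → S₁ → S₂ → S₃ → 0` of sheaves. -/
def H.connecting {X : TopCat.{u}} {S : ShortComplex (TopCat.Sheaf (ModuleCat.{u} k) X)}
    (hS : S.ShortExact) (n : ℕ) : H S.X₃ n →ₗ[k] H S.X₁ (n + 1) :=
  (Abelian.Ext.bilinearCompOfLinear k (const k X) S.X₃ S.X₁ n 1 (n + 1) rfl).flip hS.extClass

/-- The canonical morphism `k_X ⟶ f⁻¹ k_Y`, given on global sections by
`k → Γ(Y, k_Y) → Γ(Y, f_* f⁻¹ k_Y) = Γ(X, f⁻¹ k_Y)`. -/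
def constToPullback {X Y : TopCat.{u}} (f : X ⟶ Y) :
    const k X ⟶ (TopCat.Sheaf.pullback (ModuleCat.{u} k) f).obj (const k Y) :=
  ((constantSheafAdj (Opens.grothendieckTopology X) (ModuleCat.{u} k)
      (isTerminalTop (α := Opens X))).homEquiv _ _).symm
    ((constantSheafAdj (Opens.grothendieckTopology Y) (ModuleCat.{u} k)
      (isTerminalTop (α := Opens Y))).unit.app (ModuleCat.of k k) ≫
      ((TopCat.Sheaf.pullbackPushforwardAdjunction (ModuleCat.{u} k) f).unit.app
        (const k Y)).hom.app (op ⊤))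

/-- The map `Hⁿ(Y, G) → Hⁿ(X, F)` induced by a continuous map `f : X ⟶ Y` and a morphism
`φ : G ⟶ f_* F`, namely `Hⁿ(Y, G) → Hⁿ(X, f⁻¹ G) → Hⁿ(X, F)`. -/
def H.pullback {X Y : TopCat.{u}} (f : X ⟶ Y) {G : TopCat.Sheaf (ModuleCat.{u} k) Y}
    {F : TopCat.Sheaf (ModuleCat.{u} k) X}
    (φ : G ⟶ (TopCat.Sheaf.pushforward (ModuleCat.{u} k) f).obj F) (n : ℕ) :
    H G n →ₗ[k] H F n :=
  (H.map (((TopCat.Sheaf.pullbackPushforwardAdjunction (ModuleCat.{u} k) f).homEquiv G F).symm φ)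
      n) ∘ₗ
    (Abelian.Ext.bilinearCompOfLinear k _ _ _ 0 n n (zero_add n)
      (Abelian.Ext.mk₀ (constToPullback f))) ∘ₗ
    (TopCat.Sheaf.pullback (ModuleCat.{u} k) f).mapExtLinearMap k (const k Y) G n

end SheafCoh

/-! ### Structure sheaf and tangent sheaf of a `k`-scheme -/

namespace AlgGeom

lemma le12 {α : Type*} [SemilatticeInf α] (a b c : α) : a ⊓ b ⊓ c ≤ a ⊓ b := inf_le_left

lemma le23 {α : Type*} [SemilatticeInf α] (a b c : α) : a ⊓ b ⊓ c ≤ b ⊓ c :=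
  inf_le_inf_right c inf_le_right

lemma le13 {α : Type*} [SemilatticeInf α] (a b c : α) : a ⊓ b ⊓ c ≤ a ⊓ c :=
  inf_le_inf_right c inf_le_left

/-- Restriction of functions. -/
abbrev res {X : Scheme.{u}} {V W : X.Opens} (h : V ≤ W) : Γ(X, W) →+* Γ(X, V) :=
  (X.presheaf.map (homOfLE h).op).hom

lemma res_res {X : Scheme.{u}} {V W W' : X.Opens} (h : V ≤ W) (h' : W ≤ W') (f : Γ(X, W')) :
    res h (res h' f) = res (h.trans h') f := by
  simp only [res, ← CommRingCat.comp_apply, ← Functor.map_comp, ← op_comp, homOfLE_comp]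

/-- The restriction of a function of `Y` along a morphism `f : X ⟶ Y`. -/
abbrev pull {X Y : Scheme.{u}} (f : X ⟶ Y) (W : Y.Opens) (V : X.Opens) (h : V ≤ f ⁻¹ᵁ W) :
    Γ(Y, W) →+* Γ(X, V) :=
  (f.appLE W V h).hom

lemma res_pull {X Y : Scheme.{u}} (f : X ⟶ Y) (W : Y.Opens) (V V' : X.Opens) (h : V ≤ f ⁻¹ᵁ W)
    (h' : V' ≤ V) (s : Γ(Y, W)) : res h' (pull f W V h s) = pull f W V' (h'.trans h) s := by
  simp only [res, pull, ← CommRingCat.comp_apply, Scheme.Hom.appLE_map]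

lemma pull_res {X Y : Scheme.{u}} (f : X ⟶ Y) (W W' : Y.Opens) (V : X.Opens) (h : V ≤ f ⁻¹ᵁ W)
    (h' : W ≤ W') (s : Γ(Y, W')) :
    pull f W V h (res h' s) = pull f W' V (h.trans (fun _ hx => h' hx)) s := by
  simp only [res, pull, ← CommRingCat.comp_apply, Scheme.Hom.map_appLE]

variable (k : Type u) [Field k]

/-- `Γ(X, W)` is a `k`-algebra when `X` is a `k`-scheme. -/
instance sectionsAlgebra (X : Scheme.{u}) [X.Over (Spec (.of k))] (W : X.Opens) :
    Algebra k Γ(X, W) :=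
  ((pull (X ↘ Spec (.of k)) ⊤ W le_top).comp (Scheme.ΓSpecIso (.of k)).inv.hom).toAlgebra

lemma res_algebraMap (X : Scheme.{u}) [X.Over (Spec (.of k))] {V W : X.Opens} (h : V ≤ W) (c : k) :
    res h (algebraMap k Γ(X, W) c) = algebraMap k Γ(X, V) c :=
  res_pull (X ↘ Spec (.of k)) ⊤ W V le_top h ((Scheme.ΓSpecIso (.of k)).inv.hom c)

lemma res_smul (X : Scheme.{u}) [X.Over (Spec (.of k))] {V W : X.Opens} (h : V ≤ W) (c : k)
    (f : Γ(X, W)) : res h (c • f) = c • res h f := by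
  rw [Algebra.smul_def, Algebra.smul_def, map_mul, res_algebraMap]

lemma pull_algebraMap {X Y : Scheme.{u}} [X.Over (Spec (.of k))] [Y.Over (Spec (.of k))]
    (f : X ⟶ Y) [f.IsOver (Spec (.of k))]
    (W : Y.Opens) (V : X.Opens) (h : V ≤ f ⁻¹ᵁ W) (c : k) :
    pull f W V h (algebraMap k Γ(Y, W) c) = algebraMap k Γ(X, V) c := by
  have : f ≫ Y ↘ Spec (.of k) = X ↘ Spec (.of k) := comp_over f _
  change pull f W V h (pull (Y ↘ Spec (.of k)) ⊤ W le_top _) =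
    pull (X ↘ Spec (.of k)) ⊤ V le_top _
  simp only [pull, ← CommRingCat.comp_apply]
  have e : ∀ (g g' : X ⟶ Spec (.of k)) (_ : g = g') (h1) (h2),
      g.appLE ⊤ V h1 = g'.appLE ⊤ V h2 := by rintro g _ rfl _ _; rfl
  exact congrArg (fun φ : Γ(Spec (.of k), ⊤) ⟶ Γ(X, V) => φ.hom _)
    ((Scheme.Hom.appLE_comp_appLE _ _ _ _ _ _ _).trans (e _ _ this le_top le_top))

/-- Restriction of functions as a `k`-algebra homomorphism. -/
def resAlg (X : Scheme.{u}) [X.Over (Spec (.of k))] {V W : X.Opens} (h : V ≤ W) :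
    Γ(X, W) →ₐ[k] Γ(X, V) :=
  { res h with commutes' := res_algebraMap k X h }

/-- A presheaf of `k`-vector spaces with unique gluing of elements is a sheaf. -/
lemma isSheaf_of_gluing {X : TopCat.{u}} (F : TopCat.Presheaf (ModuleCat.{u} k) X)
    (h : ∀ ⦃ι : Type u⦄ (U : ι → Opens X) (s : ∀ i, F.obj (op (U i))),
      (∀ i j, (F.map ((U i).infLELeft (U j)).op).hom (s i) =
        (F.map ((U i).infLERight (U j)).op).hom (s j)) →
      ∃! t : F.obj (op (iSup U)), ∀ i, (F.map (Opens.leSupr U i).op).hom t = s i) :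
    F.IsSheaf := by
  rw [TopCat.Presheaf.isSheaf_iff_isSheaf_comp (forget (ModuleCat.{u} k))]
  exact TopCat.Presheaf.isSheaf_of_isSheafUniqueGluing_types _ h

/-- The structure sheaf of a `k`-scheme, as a sheaf of `k`-vector spaces. -/
def structureSheaf (X : Scheme.{u}) [X.Over (Spec (.of k))] :
    TopCat.Sheaf (ModuleCat.{u} k) X.toTopCat where
  obj :=
    { obj W := ModuleCat.of k Γ(X, W.unop)
      map {W V} i := ModuleCat.ofHom (resAlg k X i.unop.le).toLinearMap
      map_id W := by
        ext f
        exact congrArg (fun (φ : Γ(X, W.unop) ⟶ Γ(X, W.unop)) => φ.hom f) (X.presheaf.map_id W)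
      map_comp {W V V'} i j := by
        ext f
        exact (res_res j.unop.le i.unop.le f).symm }
  property := by
    apply isSheaf_of_gluing
    intro ι U s hs
    have hs' : TopCat.Presheaf.IsCompatible X.sheaf.obj U (fun i => (s i : Γ(X, U i))) :=
      fun i j => hs i j
    exact X.sheaf.existsUnique_gluing' U (iSup U) (fun i => Opens.leSupr U i) le_rfl
      (fun i => (s i : Γ(X, U i))) hs'

/-- Vector fields on `W ⊆ X`: sections over `W` of the sheaf of `k`-derivations
`𝒪_X → 𝒪_X` (equivalently of `ℋom(Ω_X, 𝒪_X)`), i.e. families of `k`-derivations of the rings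
`Γ(X, V)`, `V ⊆ W` open, compatible with restriction. -/
def vectorFields (X : Scheme.{u}) [X.Over (Spec (.of k))] (W : X.Opens) :
    Submodule k (∀ V : {V : X.Opens // V ≤ W}, Derivation k Γ(X, V.1) Γ(X, V.1)) where
  carrier := {D | ∀ (V V' : {V : X.Opens // V ≤ W}) (h : V'.1 ≤ V.1) (f : Γ(X, V.1)),
    res h (D V f) = D V' (res h f)}
  add_mem' {D D'} hD hD' V V' h f := by
    simp only [Pi.add_apply, Derivation.add_apply, map_add, hD V V' h f, hD' V V' h f]
  zero_mem' V V' h f := by simp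
  smul_mem' c D hD V V' h f := by
    simp only [Pi.smul_apply, Derivation.smul_apply]
    rw [← hD V V' h f, res_smul]

variable {k}

/-- Evaluate a vector field on a function. -/
def VF.ap {X : Scheme.{u}} [X.Over (Spec (.of k))] {W : X.Opens} (D : vectorFields k X W)
    {V : X.Opens} (h : V ≤ W) (f : Γ(X, V)) : Γ(X, V) :=
  D.1 ⟨V, h⟩ f

variable (k)

/-- Restriction of vector fields. -/
def vectorFieldsRes (X : Scheme.{u}) [X.Over (Spec (.of k))] {W W' : X.Opens} (h : W' ≤ W) :
    vectorFields k X W →ₗ[k] vectorFields k X W' where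
  toFun D := ⟨fun V => D.1 ⟨V.1, V.2.trans h⟩, fun V V' hV f =>
    D.2 ⟨V.1, V.2.trans h⟩ ⟨V'.1, V'.2.trans h⟩ hV f⟩
  map_add' _ _ := rfl
  map_smul' _ _ := rfl

section gluing

variable {k} {X : Scheme.{u}} [X.Over (Spec (.of k))] {ι : Type u} {U : ι → X.Opens}

lemma iSup_inf_of_le {V : X.Opens} (hV : V ≤ iSup U) : V ≤ ⨆ i, V ⊓ U i := by
  rw [← inf_iSup_eq]; exact le_inf le_rfl hV

lemma VF.ap_res {W V V' : X.Opens} (D : vectorFields k X W) (h : V ≤ W) (h' : V' ≤ V)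
    (f : Γ(X, V)) : res h' (VF.ap D h f) = VF.ap D (h'.trans h) (res h' f) :=
  D.2 ⟨V, h⟩ ⟨V', h'.trans h⟩ h' f

lemma eq_of_res_eq {V : X.Opens} (hV : V ≤ iSup U) {f g : Γ(X, V)}
    (h : ∀ i, res (inf_le_left : V ⊓ U i ≤ V) f = res (inf_le_left : V ⊓ U i ≤ V) g) : f = g :=
  X.sheaf.eq_of_locally_eq' (fun i => V ⊓ U i) V (fun _ => homOfLE inf_le_left)
    (iSup_inf_of_le hV) f g h

/-- Existence and uniqueness of the glued value `D f`. -/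
lemma VF.existsUnique_value (s : ∀ i, vectorFields k X (U i))
    (hs : ∀ i j (V : X.Opens) (h : V ≤ U i) (h' : V ≤ U j) (f : Γ(X, V)),
      VF.ap (s i) h f = VF.ap (s j) h' f)
    {V : X.Opens} (hV : V ≤ iSup U) (f : Γ(X, V)) :
    ∃! g : Γ(X, V), ∀ i, res (inf_le_left : V ⊓ U i ≤ V) g =
      VF.ap (s i) (inf_le_right : V ⊓ U i ≤ U i) (res inf_le_left f) := by
  refine X.sheaf.existsUnique_gluing' (fun i => V ⊓ U i) V (fun _ => homOfLE inf_le_left)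
    (iSup_inf_of_le hV) (fun i => VF.ap (s i) inf_le_right (res inf_le_left f)) ?_
  intro i j
  change res _ (VF.ap (s i) _ _) = res _ (VF.ap (s j) _ _)
  rw [VF.ap_res, VF.ap_res, res_res, res_res]
  exact hs i j _ _ _ _

/-- Vector fields glue. -/
lemma VF.existsUnique_glue (s : ∀ i, vectorFields k X (U i))
    (hs : ∀ i j (V : X.Opens) (h : V ≤ U i) (h' : V ≤ U j) (f : Γ(X, V)),
      VF.ap (s i) h f = VF.ap (s j) h' f) :
    ∃! D : vectorFields k X (iSup U), ∀ i, vectorFieldsRes k X (le_iSup U i) D = s i := by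
  choose v hv using fun (V : {V : X.Opens // V ≤ iSup U}) (f : Γ(X, V.1)) =>
    (VF.existsUnique_value s hs V.2 f).exists
  let d : ∀ V : {V : X.Opens // V ≤ iSup U}, Derivation k Γ(X, V.1) Γ(X, V.1) := fun V =>
    Derivation.mk'
      { toFun := v V
        map_add' := fun f g => by
          apply eq_of_res_eq V.2
          intro i
          rw [map_add, hv, hv, hv, map_add]
          exact map_add ((s i).1 _) _ _
        map_smul' := fun c f => by
          apply eq_of_res_eq V.2
          intro i
          rw [RingHom.id_apply, res_smul, hv, hv, res_smul]
          exact Derivation.map_smul ((s i).1 ⟨V.1 ⊓ U i, inf_le_right⟩) c _ }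
      (fun f g => by
          apply eq_of_res_eq V.2
          intro i
          change res _ (v V (f * g)) = res _ (f * v V g + g * v V f)
          rw [map_add, map_mul, map_mul, hv, hv, hv, map_mul]
          exact Derivation.leibniz ((s i).1 _) _ _)
  refine ⟨⟨d, ?_⟩, ?_, ?_⟩
  · intro V V' h f
    apply eq_of_res_eq V'.2
    intro i
    change res _ (res h (v V f)) = res _ (v V' (res h f))
    rw [hv, res_res, res_res,
      ← res_res (inf_le_inf_right (U i) h) (inf_le_left : V.1 ⊓ U i ≤ V.1), hv, VF.ap_res, res_res]
  · intro i
    apply Subtype.ext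
    funext V
    ext f
    apply eq_of_res_eq (U := U) (V.2.trans (le_iSup U i))
    intro j
    change res _ (v ⟨V.1, _⟩ f) = res _ (VF.ap (s i) V.2 f)
    exact (hv ⟨V.1, V.2.trans (le_iSup U i)⟩ f j).trans
      ((hs j i _ _ _ _).trans (VF.ap_res _ _ _ _).symm)
  · intro D hD
    apply Subtype.ext
    funext V
    ext f
    apply eq_of_res_eq (U := U) V.2
    intro i
    change res _ (VF.ap D V.2 f) = res _ (v V f)
    rw [hv, VF.ap_res, ← hD i]
    rfl

end gluing

/-- The tangent sheaf `T_X = 𝒟er_k(𝒪_X, 𝒪_X)` of a `k`-scheme, as a sheaf of `k`-vector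
spaces. -/
def tangentSheaf (X : Scheme.{u}) [X.Over (Spec (.of k))] :
    TopCat.Sheaf (ModuleCat.{u} k) X.toTopCat where
  obj :=
    { obj W := ModuleCat.of k (vectorFields k X W.unop)
      map {W V} i := ModuleCat.ofHom (vectorFieldsRes k X i.unop.le)
      map_id W := rfl
      map_comp {W V V'} i j := rfl }
  property := by
    apply isSheaf_of_gluing
    intro ι U s hs
    refine VF.existsUnique_glue (X := X) (U := U) s ?_
    intro i j V h h' f
    have := congrArg (fun D : vectorFields k X (U i ⊓ U j) => VF.ap D (le_inf h h') f) (hs i j)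
    exact this

variable {k}

lemma pull_smul {X Y : Scheme.{u}} [X.Over (Spec (.of k))] [Y.Over (Spec (.of k))]
    (f : X ⟶ Y) [f.IsOver (Spec (.of k))]
    (W : Y.Opens) (V : X.Opens) (h : V ≤ f ⁻¹ᵁ W) (c : k) (s : Γ(Y, W)) :
    pull f W V h (c • s) = c • pull f W V h s := by
  rw [Algebra.smul_def, Algebra.smul_def, map_mul, pull_algebraMap]

lemma pull_pull {X Y Z : Scheme.{u}} (f : X ⟶ Y) (g : Y ⟶ Z) (W : Z.Opens) (V : Y.Opens)
    (V' : X.Opens) (h : V ≤ g ⁻¹ᵁ W) (h' : V' ≤ f ⁻¹ᵁ V) (s : Γ(Z, W)) :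
    pull f V V' h' (pull g W V h s) = pull (f ≫ g) W V' (h'.trans (fun _ hx => h hx)) s :=
  congrArg (fun φ : Γ(Z, W) ⟶ Γ(X, V') => φ.hom s) (Scheme.Hom.appLE_comp_appLE f g W V V' h h')

lemma pull_congr {X Y : Scheme.{u}} {f g : X ⟶ Y} (e : f = g) (W : Y.Opens) (V : X.Opens)
    (h : V ≤ f ⁻¹ᵁ W) (h' : V ≤ g ⁻¹ᵁ W) (s : Γ(Y, W)) : pull f W V h s = pull g W V h' s := by
  subst e; rfl

lemma pull_id {X : Scheme.{u}} (V : X.Opens) (h : V ≤ 𝟙 X ⁻¹ᵁ V) (s : Γ(X, V)) :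
    pull (𝟙 X) V V h s = s := by
  have e : (𝟙 X : X ⟶ X).appLE V V h = 𝟙 _ := by
    rw [Scheme.Hom.appLE, Scheme.Hom.id_app]
    exact (Category.id_comp _).trans (X.presheaf.map_id (op V))
  exact congrArg (fun φ : Γ(X, V) ⟶ Γ(X, V) => φ.hom s) e

lemma preimage_congr {X Y : Scheme.{u}} {f g : X ⟶ Y} (e : f = g) (V : Y.Opens) :
    f ⁻¹ᵁ V = g ⁻¹ᵁ V := by rw [e]

section transport

variable {X : Scheme.{u}} [X.Over (Spec (.of k))] (σ : X ≅ X) [σ.hom.IsOver (Spec (.of k))]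

lemma le_hom_inv (V : X.Opens) : V ≤ σ.hom ⁻¹ᵁ (σ.inv ⁻¹ᵁ V) :=
  (preimage_congr σ.hom_inv_id V).ge

lemma inv_le_of_le {V W : X.Opens} (h : V ≤ σ.hom ⁻¹ᵁ W) : σ.inv ⁻¹ᵁ V ≤ W :=
  (show σ.inv ⁻¹ᵁ V ≤ σ.inv ⁻¹ᵁ (σ.hom ⁻¹ᵁ W) from fun _ hx => h hx).trans
    (preimage_congr σ.inv_hom_id W).le

lemma pull_hom_inv (V : X.Opens) (f : Γ(X, V)) :
    pull σ.hom (σ.inv ⁻¹ᵁ V) V (le_hom_inv σ V) (pull σ.inv V (σ.inv ⁻¹ᵁ V) le_rfl f) = f := by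
  rw [pull_pull, pull_congr σ.hom_inv_id V V _ (show V ≤ 𝟙 X ⁻¹ᵁ V from fun _ hx => hx)]
  exact pull_id V _ f

/-- The value on `f ∈ Γ(X, V)` of the transport of the vector field `D` on `W` along the
automorphism `σ`; it is `σ^# ∘ D ∘ (σ^#)⁻¹`. -/
def transportAp {W : X.Opens} (D : vectorFields k X W) {V : X.Opens} (h : V ≤ σ.hom ⁻¹ᵁ W)
    (f : Γ(X, V)) : Γ(X, V) :=
  pull σ.hom (σ.inv ⁻¹ᵁ V) V (le_hom_inv σ V)
    (VF.ap D (inv_le_of_le σ h) (pull σ.inv V (σ.inv ⁻¹ᵁ V) le_rfl f))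

/-- Transport of vector fields along an automorphism `σ`, as a linear map
`T_X(W) → T_X(σ⁻¹ W)`, `D ↦ σ^# ∘ D ∘ (σ^#)⁻¹`. -/
def transport (W : X.Opens) : vectorFields k X W →ₗ[k] vectorFields k X (σ.hom ⁻¹ᵁ W) where
  toFun D := ⟨fun V => Derivation.mk'
      { toFun := fun f => transportAp σ D V.2 f
        map_add' := fun f g => by
          have := Derivation.map_add (D.1 ⟨_, inv_le_of_le σ V.2⟩)
            (pull σ.inv V.1 (σ.inv ⁻¹ᵁ V.1) le_rfl f) (pull σ.inv V.1 (σ.inv ⁻¹ᵁ V.1) le_rfl g)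
          simp only [transportAp, VF.ap, map_add, this]
        map_smul' := fun c f => by
          have := Derivation.map_smul (D.1 ⟨_, inv_le_of_le σ V.2⟩) c
            (pull σ.inv V.1 (σ.inv ⁻¹ᵁ V.1) le_rfl f)
          simp only [transportAp, VF.ap, pull_smul, this, RingHom.id_apply] }
      (fun f g => by
        have := Derivation.leibniz (D.1 ⟨_, inv_le_of_le σ V.2⟩)
            (pull σ.inv V.1 (σ.inv ⁻¹ᵁ V.1) le_rfl f) (pull σ.inv V.1 (σ.inv ⁻¹ᵁ V.1) le_rfl g)
        change transportAp σ D V.2 (f * g) = f * transportAp σ D V.2 g + g * transportAp σ D V.2 f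
        simp only [transportAp, VF.ap, map_mul, this, smul_eq_mul, map_add, pull_hom_inv]),
    fun V V' h f => by
      change res h (transportAp σ D V.2 f) = transportAp σ D V'.2 (res h f)
      have h' : σ.inv ⁻¹ᵁ V'.1 ≤ σ.inv ⁻¹ᵁ V.1 := fun _ hx => h hx
      rw [transportAp, transportAp, res_pull, pull_res, ← res_pull σ.inv V.1 _ _ le_rfl h',
        ← VF.ap_res, pull_res]⟩
  map_add' D D' := by
    apply Subtype.ext; funext V; ext f
    exact map_add (pull σ.hom (σ.inv ⁻¹ᵁ V.1) V.1 (le_hom_inv σ V.1)) _ _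
  map_smul' c D := by
    apply Subtype.ext; funext V; ext f
    exact pull_smul σ.hom (σ.inv ⁻¹ᵁ V.1) V.1 (le_hom_inv σ V.1) c _

/-- The isomorphism `T_X ⟶ σ_* T_X` given by transport of vector fields along `σ`. -/
def transportHom :
    tangentSheaf k X ⟶
      (TopCat.Sheaf.pushforward (ModuleCat.{u} k) σ.hom.base).obj (tangentSheaf k X) :=
  ObjectProperty.homMk
    { app W := ModuleCat.ofHom (transport σ W.unop)
      naturality _ _ _ := rfl }

/-- The endomorphism of `Hⁿ(X, T_X)` induced by the automorphism `σ` of `X`. -/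
def cohomologyAct (n : ℕ) :
    SheafCoh.H (tangentSheaf k X) n →ₗ[k] SheafCoh.H (tangentSheaf k X) n :=
  SheafCoh.H.pullback σ.hom.base (transportHom σ) n

end transport

section invariants

variable {X Y : Scheme.{u}} [X.Over (Spec (.of k))] {Λ : Type u} (a : Λ → (X ⟶ X))
  [∀ l, (a l).IsOver (Spec (.of k))] (π : X ⟶ Y)

/-- The vector fields on `π⁻¹ V` that are invariant under the given automorphisms `a l` of `X`,
i.e. commute with all `(a l)^#`. -/
def invariantFields (V : Y.Opens) : Submodule k (vectorFields k X (π ⁻¹ᵁ V)) where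
  carrier := {D | ∀ (l : Λ) (W W' : X.Opens) (hW : W ≤ π ⁻¹ᵁ V) (hW' : W' ≤ π ⁻¹ᵁ V)
    (h : W' ≤ a l ⁻¹ᵁ W) (f : Γ(X, W)),
    pull (a l) W W' h (VF.ap D hW f) = VF.ap D hW' (pull (a l) W W' h f)}
  add_mem' {D D'} hD hD' l W W' hW hW' h f := by
    have e := hD l W W' hW hW' h f
    have e' := hD' l W W' hW hW' h f
    change pull (a l) W W' h (VF.ap D hW f + VF.ap D' hW f) = VF.ap D hW' _ + VF.ap D' hW' _
    rw [map_add, e, e']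
  zero_mem' l W W' hW hW' h f := map_zero _
  smul_mem' c D hD l W W' hW hW' h f := by
    have e := hD l W W' hW hW' h f
    change pull (a l) W W' h (c • VF.ap D hW f) = c • VF.ap D hW' _
    rw [pull_smul, e]

/-- Restriction of invariant vector fields. -/
def invariantRes {V V' : Y.Opens} (h : V' ≤ V) :
    invariantFields (k := k) a π V →ₗ[k] invariantFields (k := k) a π V' :=
  (vectorFieldsRes k X (show π ⁻¹ᵁ V' ≤ π ⁻¹ᵁ V from fun _ hx => h hx)).restrict
    (fun _ hD l W W' hW hW' hh f => hD l W W' (hW.trans fun _ hx => h hx)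
      (hW'.trans fun _ hx => h hx) hh f)

/-- Invariant vector fields glue. -/
lemma invariant_existsUnique_glue (hπ : ∀ l, a l ≫ π = π) {ι : Type u} {U : ι → Y.Opens}
    (s : ∀ i, invariantFields (k := k) a π (U i))
    (hs : ∀ i j (V : X.Opens) (h : V ≤ π ⁻¹ᵁ (U i)) (h' : V ≤ π ⁻¹ᵁ (U j)) (f : Γ(X, V)),
      VF.ap (s i).1 h f = VF.ap (s j).1 h' f) :
    ∃! D : invariantFields (k := k) a π (iSup U),
      ∀ i, invariantRes a π (le_iSup U i) D = s i := by
  have e : π ⁻¹ᵁ (iSup U) = ⨆ i, π ⁻¹ᵁ (U i) := by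
    ext x
    simp
  obtain ⟨D, hD, hu⟩ := VF.existsUnique_glue (X := X) (U := fun i => π ⁻¹ᵁ (U i))
    (fun i => (s i).1) hs
  have hDap : ∀ (i) (V : X.Opens) (h : V ≤ π ⁻¹ᵁ (U i)) (h') (f : Γ(X, V)),
      VF.ap D h' f = VF.ap (s i).1 h f := fun i V h h' f =>
    congrArg (fun D : vectorFields k X (π ⁻¹ᵁ (U i)) => VF.ap D h f) (hD i)
  have hinv : ∀ i l, a l ⁻¹ᵁ (π ⁻¹ᵁ (U i)) = π ⁻¹ᵁ (U i) := fun i l =>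
    preimage_congr (hπ l) (U i)
  refine ⟨⟨vectorFieldsRes k X e.le D, ?_⟩, ?_, ?_⟩
  · intro l W W' hW hW' h f
    apply eq_of_res_eq (U := fun i => π ⁻¹ᵁ (U i)) (hW'.trans e.le)
    intro i
    have h1 : W' ⊓ π ⁻¹ᵁ (U i) ≤ a l ⁻¹ᵁ (W ⊓ π ⁻¹ᵁ (U i)) := fun x hx =>
      ⟨h hx.1, (hinv i l).ge hx.2⟩
    change res _ (pull (a l) W W' h (VF.ap D (hW.trans e.le) f)) =
      res _ (VF.ap D (hW'.trans e.le) (pull (a l) W W' h f))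
    rw [res_pull, VF.ap_res, res_pull, ← pull_res (a l) _ W _ h1 inf_le_left,
      ← pull_res (a l) _ W _ h1 inf_le_left, VF.ap_res, hDap i _ inf_le_right,
      hDap i _ inf_le_right]
    exact (s i).2 l _ _ _ _ _ _
  · intro i
    exact Subtype.ext (hD i)
  · intro D' hD'
    apply Subtype.ext
    have := hu (vectorFieldsRes k X e.ge D'.1) (fun i => congrArg Subtype.val (hD' i))
    change D'.1 = vectorFieldsRes k X e.le D
    rw [← this]
    rfl

variable (k) in
/-- The subsheaf of `π_* T_X` of vector fields invariant under the automorphisms `a l`, where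
`π` is an invariant morphism. -/
def invariantSheaf (hπ : ∀ l, a l ≫ π = π) : TopCat.Sheaf (ModuleCat.{u} k) Y.toTopCat where
  obj :=
    { obj V := ModuleCat.of k (invariantFields (k := k) a π V.unop)
      map {V V'} i := ModuleCat.ofHom (invariantRes a π i.unop.le)
      map_id _ := rfl
      map_comp _ _ := rfl }
  property := by
    apply isSheaf_of_gluing
    intro ι U s hs
    refine invariant_existsUnique_glue (k := k) a π hπ (U := U) s ?_
    intro i j V h h' f
    exact congrArg (fun D : invariantFields (k := k) a π (U i ⊓ U j) =>
      VF.ap D.1 (le_inf h h') f) (hs i j)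

variable (k) in
/-- The inclusion of the subsheaf of invariant vector fields in `π_* T_X`. -/
def invariantIncl (hπ : ∀ l, a l ≫ π = π) :
    invariantSheaf k a π hπ ⟶
      (TopCat.Sheaf.pushforward (ModuleCat.{u} k) π.base).obj (tangentSheaf k X) :=
  ObjectProperty.homMk
    { app V := ModuleCat.ofHom (invariantFields (k := k) a π V.unop).subtype
      naturality _ _ _ := rfl }

end invariants


/-! ### Differentials and Čech cohomology -/

variable (k) in
/-- The presheaf `W ↦ Ω_{Γ(X, W)/k}` of Kähler differentials of a `k`-scheme. -/
def differentialsPresheaf (X : Scheme.{u}) [X.Over (Spec (.of k))] :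
    PresheafOfModules (X.presheaf ⋙ forget₂ CommRingCat RingCat) :=
  PresheafOfModules.DifferentialsConstruction.relativeDifferentials'
    (S' := (Functor.const _).obj (CommRingCat.of k)) (R := X.presheaf)
    { app := fun W => CommRingCat.ofHom (algebraMap k Γ(X, W.unop))
      naturality := fun W V i => by
        ext c
        exact (res_algebraMap k X i.unop.le c).symm }

variable (k) in
/-- The sheaf `Ω_X` of Kähler differentials of a `k`-scheme (as a sheaf of abelian groups). -/
def cotangentSheaf (X : Scheme.{u}) [X.Over (Spec (.of k))] :
    TopCat.Sheaf AddCommGrpCat.{u} X.toTopCat :=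
  (presheafToSheaf (Opens.grothendieckTopology X) AddCommGrpCat.{u}).obj
    (differentialsPresheaf k X).presheaf

variable (k) in
/-- `d log g = g⁻¹ dg` in the presheaf of Kähler differentials, for an invertible function `g`. -/
def dlogPre {X : Scheme.{u}} [X.Over (Spec (.of k))] {W : X.Opens} (g : Γ(X, W)ˣ) :
    CommRingCat.KaehlerDifferential (CommRingCat.ofHom (algebraMap k Γ(X, W))) :=
  ((g⁻¹ : Γ(X, W)ˣ) : Γ(X, W)) • CommRingCat.KaehlerDifferential.d (g : Γ(X, W))

lemma dlogPre_mul {X : Scheme.{u}} [X.Over (Spec (.of k))] {W : X.Opens} (g h : Γ(X, W)ˣ) :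
    dlogPre k (g * h) = dlogPre k g + dlogPre k h := by
  have key : ∀ {B : Type u} [CommRing B] {M : Type u} [AddCommGroup M] [Module B M] (d : B → M)
      (hd : ∀ a b, d (a * b) = a • d b + b • d a) (g h : Bˣ),
      (↑(g * h)⁻¹ : B) • d ↑(g * h) = (↑g⁻¹ : B) • d ↑g + (↑h⁻¹ : B) • d ↑h := by
    intro B _ M _ _ d hd g h
    rw [Units.val_mul, hd, smul_add, smul_smul, smul_smul, mul_inv, Units.val_mul, add_comm]
    congr 2
    · rw [mul_assoc, Units.inv_mul, mul_one]
    · rw [mul_comm (↑g⁻¹ : B), mul_assoc, Units.inv_mul, mul_one]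
  exact key (fun b : Γ(X, W) => CommRingCat.KaehlerDifferential.d
    (f := CommRingCat.ofHom (algebraMap k Γ(X, W))) b)
    (fun a b => ModuleCat.Derivation.d_mul _ a b) g h

lemma dlogPre_res {X : Scheme.{u}} [X.Over (Spec (.of k))] {W V : X.Opens} (i : V ≤ W)
    (g : Γ(X, W)ˣ) :
    ((differentialsPresheaf k X).presheaf.map (homOfLE i).op).hom (dlogPre k g) =
      dlogPre k (Units.map (res i : Γ(X, W) →* Γ(X, V)) g) := by
  let φ := (differentialsPresheaf k X).map (homOfLE i).op
  have h1 := LinearMap.map_smul φ.hom ((g⁻¹ : Γ(X, W)ˣ) : Γ(X, W))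
    (CommRingCat.KaehlerDifferential.d (f := CommRingCat.ofHom (algebraMap k Γ(X, W)))
      (g : Γ(X, W)))
  have h2 := PresheafOfModules.DifferentialsConstruction.relativeDifferentials'_map_d
    (S' := (Functor.const _).obj (CommRingCat.of k)) (R := X.presheaf)
    { app := fun W => CommRingCat.ofHom (algebraMap k Γ(X, W.unop))
      naturality := fun W V i => by
        ext c
        exact (res_algebraMap k X i.unop.le c).symm } (homOfLE i).op (g : Γ(X, W))
  exact h1.trans (congrArg (fun x : CommRingCat.KaehlerDifferential
    (CommRingCat.ofHom (algebraMap k Γ(X, V))) => res i ((g⁻¹ : Γ(X, W)ˣ) : Γ(X, W)) • x) h2)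

variable (k) in
/-- `d log g ∈ Γ(W, Ω_X)`, for an invertible function `g` on `W`. -/
def dlog {X : Scheme.{u}} [X.Over (Spec (.of k))] {W : X.Opens} (g : Γ(X, W)ˣ) :
    (cotangentSheaf k X).obj.obj (op W) :=
  ((toSheafify (Opens.grothendieckTopology X) (differentialsPresheaf k X).presheaf).app
    (op W)).hom (dlogPre k g)

lemma dlog_mul {X : Scheme.{u}} [X.Over (Spec (.of k))] {W : X.Opens} (g h : Γ(X, W)ˣ) :
    dlog k (g * h) = dlog k g + dlog k h := by
  rw [dlog, dlogPre_mul]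
  exact map_add _ _ _

lemma dlog_res {X : Scheme.{u}} [X.Over (Spec (.of k))] {W V : X.Opens} (i : V ≤ W)
    (g : Γ(X, W)ˣ) :
    ((cotangentSheaf k X).obj.map (homOfLE i).op).hom (dlog k g) =
      dlog k (Units.map (res i : Γ(X, W) →* Γ(X, V)) g) := by
  rw [dlog, dlog, ← dlogPre_res]
  have := (toSheafify (Opens.grothendieckTopology X)
    (differentialsPresheaf k X).presheaf).naturality (homOfLE i).op
  exact (congrArg (fun φ => φ.hom (dlogPre k g)) this).symm

section Cech

variable {X : TopCat.{u}} (F : TopCat.Sheaf AddCommGrpCat.{u} X) {ι : Type u} (V : ι → Opens X)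

/-- Restriction of sections of a sheaf of abelian groups. -/
abbrev secRes {W W' : Opens X} (h : W' ≤ W) : F.obj.obj (op W) →+ F.obj.obj (op W') :=
  (F.obj.map (homOfLE h).op).hom

/-- Čech `1`-cocycles of the cover `V` with values in `F`:
`c i j + c j l = c i l` on `V i ∩ V j ∩ V l`. -/
def cechCocycles : AddSubgroup (∀ i j, F.obj.obj (op (V i ⊓ V j))) where
  carrier := {c | ∀ i j l,
    secRes F (le12 (V i) (V j) (V l)) (c i j) + secRes F (le23 (V i) (V j) (V l)) (c j l) =
      secRes F (le13 (V i) (V j) (V l)) (c i l)}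
  add_mem' {c c'} hc hc' i j l := by
    simp only [Pi.add_apply, map_add]
    rw [← hc, ← hc']
    abel
  zero_mem' i j l := by simp
  neg_mem' {c} hc i j l := by
    simp only [Pi.neg_apply, map_neg]
    rw [← hc]
    abel

/-- The Čech coboundary `(b i) ↦ (b j - b i)`. -/
def cechCoboundary : (∀ i, F.obj.obj (op (V i))) →+ (∀ i j, F.obj.obj (op (V i ⊓ V j))) where
  toFun b i j := secRes F inf_le_right (b j) - secRes F inf_le_left (b i)
  map_zero' := by funext i j; simp
  map_add' b b' := by
    funext i j
    simp only [Pi.add_apply, map_add]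
    abel

/-- The first Čech cohomology group of the cover `V` with values in `F`. -/
abbrev CechH1 : Type u :=
  cechCocycles F V ⧸ (cechCoboundary F V).range.addSubgroupOf (cechCocycles F V)

end Cech

/-! ### Line bundles and cones -/

/-- The cocycle condition `g i j * g j l = g i l` on `V i ∩ V j ∩ V l`. -/
def IsCocycle {Y : Scheme.{u}} {ι : Type u} (V : ι → Y.Opens) (g : ∀ i j, Γ(Y, V i ⊓ V j)ˣ) :
    Prop :=
  ∀ i j l, res (le12 (V i) (V j) (V l)) (g i j).val * res (le23 (V i) (V j) (V l)) (g j l).val =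
    res (le13 (V i) (V j) (V l)) (g i l).val

/-- A line bundle on a scheme, given by a trivialising open cover and its transition functions.
A section over `W` is a family of functions `s i` on `W ∩ V i` with `s i = g i j * s j`. -/
structure LineBundle (Y : Scheme.{u}) where
  /-- the index type of the cover -/
  ι : Type u
  /-- the trivialising cover -/
  V : ι → Y.Opens
  iSup_V : ⨆ i, V i = ⊤
  /-- the transition functions -/
  g : ∀ i j, Γ(Y, V i ⊓ V j)ˣ
  cocycle : IsCocycle V g

lemma mem_asIdeal_map {R S : Type u} [CommRing R] [CommRing S] (φ : R →+* S)
    (x : Spec (.of S)) (p : R) :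
    p ∈ (Spec.map (CommRingCat.ofHom φ) x).asIdeal ↔ φ p ∈ x.asIdeal := Iff.rfl

/-- The complement of the closed subset `V(I)` of `Spec R`. -/
def complVanishing {R : Type u} [CommRing R] (I : Ideal R) : (Spec (.of R)).Opens :=
  ⟨(PrimeSpectrum.zeroLocus (I : Set R))ᶜ, (PrimeSpectrum.isClosed_zeroLocus _).isOpen_compl⟩

lemma mem_complVanishing {R : Type u} [CommRing R] (I : Ideal R) (x : Spec (.of R)) :
    x ∈ complVanishing I ↔ ¬ ∀ p ∈ I, p ∈ x.asIdeal := Iff.rfl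

lemma map_mem_complVanishing {R : Type u} [CommRing R] (I : Ideal R) (φ ψ : R →+* R)
    (hψ : ∀ p ∈ I, ψ p ∈ I) (h : ∀ p, φ (ψ p) = p) (x : Spec (.of R))
    (hx : x ∈ complVanishing I) : Spec.map (CommRingCat.ofHom φ) x ∈ complVanishing I := by
  rw [mem_complVanishing] at hx ⊢
  refine fun hx' => hx fun p hp => ?_
  have := (mem_asIdeal_map φ x _).mp (hx' _ (hψ p hp))
  rwa [h] at this

namespace LineBundle

variable {Y : Scheme.{u}} (L : LineBundle Y)

variable (k) in
/-- The Atiyah class of `L`: the class of the Čech cocycle `d log (g i j)` in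
`Ȟ¹({V i}, Ω_Y) ⊆ H¹(Y, Ω_Y)`. -/
def atiyahClass [Y.Over (Spec (.of k))] : CechH1 (cotangentSheaf k Y) L.V :=
  QuotientAddGroup.mk ⟨fun i j => dlog k (L.g i j), fun i j l => by
    simp only [secRes]
    rw [dlog_res, dlog_res, dlog_res, ← dlog_mul]
    congr 1
    exact Units.ext (L.cocycle i j l)⟩

variable (k) [Y.Over (Spec (.of k))]

/-- The global sections `Γ(Y, L^m)`, `m ≥ 0`. -/
def sections (m : ℕ) : Submodule k (∀ i, Γ(Y, L.V i)) where
  carrier := {s | ∀ i j, res (inf_le_left : L.V i ⊓ L.V j ≤ L.V i) (s i) =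
    (L.g i j : Γ(Y, L.V i ⊓ L.V j)) ^ m * res (inf_le_right : L.V i ⊓ L.V j ≤ L.V j) (s j)}
  add_mem' {s s'} hs hs' i j := by
    simp only [Pi.add_apply, map_add, mul_add]
    rw [hs, hs']
  zero_mem' i j := by simp
  smul_mem' c s hs i j := by
    simp only [Pi.smul_apply, res_smul]
    rw [hs, mul_smul_comm]

/-- The non-vanishing locus `Y_s` of a section `s` of `L^m`. -/
def nonvanishing {m : ℕ} (s : L.sections k m) : Y.Opens := ⨆ i, Y.basicOpen (s.1 i)

/-- `L` is ample: every point has an affine neighbourhood of the form `Y_s` with `s` a section of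
a positive power of `L` (for a quasi-compact scheme `Y`). -/
def IsAmple : Prop :=
  ∀ y : Y, ∃ (m : ℕ) (_ : 0 < m) (s : L.sections k m),
    y ∈ L.nonvanishing k s ∧ IsAffineOpen (L.nonvanishing k s)

lemma mul_mem_sections {m n : ℕ} {s s' : ∀ i, Γ(Y, L.V i)} (hs : s ∈ L.sections k m)
    (hs' : s' ∈ L.sections k n) : s * s' ∈ L.sections k (m + n) := by
  intro i j
  simp only [Pi.mul_apply, map_mul]
  rw [hs i j, hs' i j]
  ring

lemma one_mem_sections : (1 : ∀ i, Γ(Y, L.V i)) ∈ L.sections k 0 := by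
  intro i j
  simp

open Polynomial in
/-- The section ring `⨁_{m ≥ 0} Γ(Y, L^m)` as a subring: the polynomials `∑ s_m T^m` with
`s_m ∈ Γ(Y, L^m)`. -/
def sectionSubalgebra : Subalgebra k (∀ i, Γ(Y, L.V i))[X] where
  carrier := {p | ∀ m, p.coeff m ∈ L.sections k m}
  mul_mem' {p q} hp hq m := by
    rw [coeff_mul]
    refine Submodule.sum_mem _ fun x hx => ?_
    rw [← Finset.HasAntidiagonal.mem_antidiagonal.mp hx]
    exact L.mul_mem_sections k (hp _) (hq _)
  add_mem' {p q} hp hq m := by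
    rw [coeff_add]
    exact Submodule.add_mem _ (hp m) (hq m)
  algebraMap_mem' c m := by
    rw [Polynomial.algebraMap_apply, coeff_C]
    split_ifs with h
    · subst h
      rw [Algebra.algebraMap_eq_smul_one]
      exact Submodule.smul_mem _ _ (L.one_mem_sections k)
    · exact Submodule.zero_mem _

/-- The section ring `S = ⨁_{m ≥ 0} Γ(Y, L^m)`. -/
def SectionRing : Type u := L.sectionSubalgebra k

instance : CommRing (L.SectionRing k) := inferInstanceAs (CommRing (L.sectionSubalgebra k))

instance : Algebra k (L.SectionRing k) := inferInstanceAs (Algebra k (L.sectionSubalgebra k))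

/-- The homogeneous element `s T^m` of the section ring. -/
def homog (m : ℕ) (s : L.sections k m) : L.SectionRing k :=
  ⟨Polynomial.monomial m s.1, fun n => by
    rw [Polynomial.coeff_monomial]
    split_ifs with h
    · subst h; exact s.2
    · exact Submodule.zero_mem _⟩

/-- The component of degree `m` of an element of the section ring. -/
def coeff (m : ℕ) : L.SectionRing k →ₗ[k] (∀ i, Γ(Y, L.V i)) :=
  ((Polynomial.lcoeff (∀ i, Γ(Y, L.V i)) m).restrictScalars k) ∘ₗ
    (L.sectionSubalgebra k).val.toLinearMap

/-- The irrelevant ideal `S_+ = ⨁_{m > 0} Γ(Y, L^m)`. -/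
def irrelevant : Ideal (L.SectionRing k) where
  carrier := {p | L.coeff k 0 p = 0}
  add_mem' {p q} hp hq := by
    change L.coeff k 0 (p + q) = 0
    rw [map_add, hp, hq, add_zero]
  zero_mem' := map_zero _
  smul_mem' p q hq := by
    change (p.1 * q.1).coeff 0 = 0
    rw [Polynomial.mul_coeff_zero, show q.1.coeff 0 = 0 from hq, mul_zero]

/-- The affine cone `C(Y) = Spec S`. -/
abbrev cone : Scheme.{u} := Spec (.of (L.SectionRing k))

/-- The complement of the vertex, as an open subset of the cone. -/
def coneOpen : (L.cone k).Opens := complVanishing (L.irrelevant k)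

/-- The punctured cone `U = C(Y) \ {0}`. -/
def puncturedCone : Scheme.{u} := (L.coneOpen k).toScheme

/-- The open immersion `U ⟶ C(Y)`. -/
def incl : L.puncturedCone k ⟶ L.cone k := (L.coneOpen k).ι

instance : IsOpenImmersion (L.incl k) := inferInstanceAs (IsOpenImmersion (L.coneOpen k).ι)

/-- The `k`-scheme structure of `U`. -/
instance puncturedConeOver : (L.puncturedCone k).Over (Spec (.of k)) :=
  ⟨L.incl k ≫ Spec.map (CommRingCat.ofHom (algebraMap k (L.SectionRing k)))⟩

/-- The function on an open subset `W` of `U` given by an element of the section ring. -/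
def fn (W : (L.puncturedCone k).Opens) : L.SectionRing k →+* Γ(L.puncturedCone k, W) :=
  (pull (L.incl k) ⊤ W le_top).comp (Scheme.ΓSpecIso (.of (L.SectionRing k))).inv.hom

/-- The action of `c ∈ k^×` on the section ring: multiplication by `c^m` on `Γ(Y, L^m)`. -/
def scaleAlg (c : kˣ) : L.SectionRing k →ₐ[k] L.SectionRing k :=
  (((Polynomial.aeval (Polynomial.C (algebraMap k (∀ i, Γ(Y, L.V i)) c) *
    Polynomial.X)).restrictScalars k).comp (L.sectionSubalgebra k).val).codRestrict
      (L.sectionSubalgebra k) fun p m => by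
      change (p.1.comp (Polynomial.C (algebraMap k (∀ i, Γ(Y, L.V i)) c) *
        Polynomial.X)).coeff m ∈ _
      rw [Polynomial.comp_C_mul_X_coeff, ← map_pow, mul_comm, ← Algebra.smul_def]
      exact Submodule.smul_mem _ _ (p.2 m)

lemma coeff_scaleAlg (c : kˣ) (p : L.SectionRing k) (m : ℕ) :
    L.coeff k m (L.scaleAlg k c p) = ((c : k) ^ m) • L.coeff k m p := by
  change (p.1.comp (Polynomial.C (algebraMap k (∀ i, Γ(Y, L.V i)) c) * Polynomial.X)).coeff m =
    ((c : k) ^ m) • p.1.coeff m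
  rw [Polynomial.comp_C_mul_X_coeff, ← map_pow, mul_comm, ← Algebra.smul_def]

lemma ext_coeff {p q : L.SectionRing k} (h : ∀ m, L.coeff k m p = L.coeff k m q) : p = q :=
  Subtype.ext (Polynomial.ext h)

lemma scaleAlg_scaleAlg (c d : kˣ) (h : c * d = 1) (p : L.SectionRing k) :
    L.scaleAlg k c (L.scaleAlg k d p) = p := by
  apply L.ext_coeff k
  intro m
  rw [coeff_scaleAlg, coeff_scaleAlg, smul_smul, ← mul_pow, ← Units.val_mul, h, Units.val_one,
    one_pow, one_smul]

/-- The action of `c ∈ k^×` on the section ring, as a ring homomorphism. -/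
def scaleHom (c : kˣ) : L.SectionRing k →+* L.SectionRing k := L.scaleAlg k c

/-- The action of `c ∈ k^×` on the cone. -/
def scaleCone (c : kˣ) : L.cone k ⟶ L.cone k :=
  Spec.map (CommRingCat.ofHom (L.scaleHom k c))

lemma scaleCone_comp (c d : kˣ) (h : c * d = 1) :
    L.scaleCone k c ≫ L.scaleCone k d = 𝟙 _ := by
  rw [scaleCone, scaleCone, ← Spec.map_comp, ← CommRingCat.ofHom_comp, ← Spec.map_id]
  exact congrArg Spec.map (CommRingCat.hom_ext (RingHom.ext (L.scaleAlg_scaleAlg k c d h)))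

lemma scaleCone_mem (c : kˣ) (x : L.cone k) (hx : x ∈ L.coneOpen k) :
    L.scaleCone k c x ∈ L.coneOpen k :=
  map_mem_complVanishing (L.irrelevant k) (L.scaleHom k c) (L.scaleHom k c⁻¹)
    (fun p hp => (L.coeff_scaleAlg k c⁻¹ p 0).trans
      (by rw [show L.coeff k 0 p = 0 from hp, smul_zero]))
    (L.scaleAlg_scaleAlg k c c⁻¹ (mul_inv_cancel c)) x hx

/-- The action of `c ∈ k^×` on the punctured cone. -/
def scale (c : kˣ) : L.puncturedCone k ⟶ L.puncturedCone k :=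
  IsOpenImmersion.lift (L.incl k) (L.incl k ≫ L.scaleCone k c) (by
    rintro _ ⟨x, rfl⟩
    have h := L.scaleCone_mem k c (L.incl k x) x.2
    exact ⟨⟨_, h⟩, rfl⟩)

lemma scale_incl (c : kˣ) : L.scale k c ≫ L.incl k = L.incl k ≫ L.scaleCone k c :=
  IsOpenImmersion.lift_fac _ _ _

lemma scale_comp (c d : kˣ) (h : c * d = 1) : L.scale k c ≫ L.scale k d = 𝟙 _ := by
  rw [← cancel_mono (L.incl k), Category.assoc, scale_incl, ← Category.assoc, scale_incl,
    Category.assoc, L.scaleCone_comp k c d h, Category.comp_id, Category.id_comp]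

instance (c : kˣ) : (L.scale k c).IsOver (Spec (.of k)) where
  comp_over := by
    change L.scale k c ≫ L.incl k ≫ Spec.map _ = L.incl k ≫ Spec.map _
    rw [← Category.assoc, scale_incl, Category.assoc, scaleCone, ← Spec.map_comp,
      ← CommRingCat.ofHom_comp]
    congr 3
    exact RingHom.ext (L.scaleAlg k c).commutes

/-- The automorphism of the punctured cone given by `c ∈ k^×`. -/
@[simps hom]
def scaleIso (c : kˣ) : L.puncturedCone k ≅ L.puncturedCone k where
  hom := L.scale k c
  inv := L.scale k c⁻¹
  hom_inv_id := L.scale_comp k c c⁻¹ (mul_inv_cancel c)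
  inv_hom_id := L.scale_comp k c⁻¹ c (inv_mul_cancel c)

instance (c : kˣ) : (L.scaleIso k c).hom.IsOver (Spec (.of k)) :=
  inferInstanceAs ((L.scale k c).IsOver (Spec (.of k)))

/-- `π : U ⟶ Y` is the projection of the punctured cone onto `Y`: a `𝔾_m`-invariant morphism of
`k`-schemes such that the functions on `U` given by sections of the powers of `L` are their
pullbacks with respect to a trivialisation of `π^* L`. In terms of the frame of `L` on `V i`, the
trivialisation is a unit `t i` on `π⁻¹ (V i)`, and the section `s` of `L^m` becomes the function
`π^#(s i) * (t i)^m`. -/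
structure IsProjection (π : L.puncturedCone k ⟶ Y) : Prop where
  isOver : π.IsOver (Spec (.of k))
  scale_comp : ∀ c : kˣ, L.scale k c ≫ π = π
  exists_trivialisation : ∃ t : ∀ i, Γ(L.puncturedCone k, π ⁻¹ᵁ (L.V i))ˣ,
    ∀ (m : ℕ) (s : L.sections k m) (i : L.ι),
      L.fn k (π ⁻¹ᵁ (L.V i)) (L.homog k m s) =
        pull π (L.V i) (π ⁻¹ᵁ (L.V i)) le_rfl (s.1 i) * (t i : Γ(L.puncturedCone k, _)) ^ m

/-- The weight-zero part `Hⁿ(U, T_U)_{(0)}`: the classes fixed by the action of `𝔾_m(k) = k^×`. -/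
def weightZeroCohomology (n : ℕ) :
    Submodule k (SheafCoh.H (tangentSheaf k (L.puncturedCone k)) n) where
  carrier := {v | ∀ c : kˣ, cohomologyAct (L.scaleIso k c) n v = v}
  add_mem' {v w} hv hw c := by rw [map_add, hv c, hw c]
  zero_mem' c := map_zero _
  smul_mem' r v hv c := by rw [map_smul, hv c]

variable {L} {k} {π : L.puncturedCone k ⟶ Y} (hπ : L.IsProjection k π)

/-- The weight-zero part `(π_* T_U)_{(0)}`: the subsheaf of vector fields invariant under the action
of `𝔾_m(k) = k^×`. -/
def IsProjection.weightZero : TopCat.Sheaf (ModuleCat.{u} k) Y.toTopCat :=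
  invariantSheaf k (L.scale k) π hπ.scale_comp

/-- The canonical map `Hⁿ(Y, (π_* T_U)_{(0)}) → Hⁿ(U, T_U)`. -/
def IsProjection.toPuncturedCone (n : ℕ) :
    SheafCoh.H hπ.weightZero n →ₗ[k] SheafCoh.H (tangentSheaf k (L.puncturedCone k)) n :=
  SheafCoh.H.pullback π.base (invariantIncl k (L.scale k) π hπ.scale_comp) n

/-- `e : 𝒪_Y ⟶ (π_* T_U)_{(0)}` is the Euler map `a ↦ π^#(a) E`, where `E` is the Euler vector
field, the one that multiplies homogeneous elements of `S` of degree `m` by `m`. -/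
def IsProjection.IsEulerMap (e : structureSheaf k Y ⟶ hπ.weightZero) : Prop :=
  ∀ (V : Y.Opens) (a : Γ(Y, V)) (W : (L.puncturedCone k).Opens) (hW : W ≤ π ⁻¹ᵁ V)
    (m : ℕ) (s : L.sections k m),
    VF.ap (show invariantFields (L.scale k) π V from (e.hom.app (op V)).hom a).1 hW
        (L.fn k W (L.homog k m s)) =
      pull π V W hW a * ((m : Γ(L.puncturedCone k, W)) * L.fn k W (L.homog k m s))

/-- `p : (π_* T_U)_{(0)} ⟶ T_Y` is the differential of `π`:
`π^#(p(D)(b)) = D(π^#(b))`. -/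
def IsProjection.IsDifferential (p : hπ.weightZero ⟶ tangentSheaf k Y) : Prop :=
  ∀ (V : Y.Opens) (D : invariantFields (L.scale k) π V) (V' : Y.Opens) (hV' : V' ≤ V)
    (b : Γ(Y, V')),
    pull π V' (π ⁻¹ᵁ V') le_rfl
        (VF.ap (show vectorFields k Y V from (p.hom.app (op V)).hom D) hV' b) =
      VF.ap D.1 (show π ⁻¹ᵁ V' ≤ π ⁻¹ᵁ V from fun _ hx => hV' hx)
        (pull π V' (π ⁻¹ᵁ V') le_rfl b)

end LineBundle

end AlgGeom
end

/-!
The proof rests on charts. The *charts* of `L` are the nonempty affine open subsets `Y_s`, with `s`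
a section of a positive power of `L`, over which `L` is trivial. By ampleness they form a basis of
the topology of `Y`. For a chart with ring of functions `A = Γ(Y, Y_s)`, the localization of the
section ring at `s` is the ring `A[T;T⁻¹]` of Laurent polynomials (`Chart.isLocalization`): this is
the extension of a section of a power of `L` from `Y_s` to `Y` after multiplication by a power of
`s`. Hence `D(s) = Spec A[T;T⁻¹]` is an open subset of the cone. These sets cover the punctured cone
(`exists_elt_not_mem`); as the section ring is not known to be finitely generated, this is derived
from the valuative criterion for the proper scheme `Y`. The maps `Spec A[T;T⁻¹] ⟶ Spec A` glue to
the projection `π`, and any morphism with the required trivialisation is equal to them in the charts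
(`existsUnique_isProjection`).

The Euler sequence is exact because an invariant derivation of `A[T;T⁻¹]` that vanishes on `A` is an
`A`-multiple of the Euler derivation `T ∂/∂T`, and every derivation of `A` extends to an invariant
derivation of `A[T;T⁻¹]` (`IsProjection.shortExact`). The long exact sequence is that of `Ext` out
of the constant sheaf, and statements (b) and (c) are linear algebra given (a).

For (a), embed `T_U` in an injective sheaf `I` with quotient `Q`. Every class in `H¹(U, T_U)` is the
image of a global section of `Q` under the connecting map. As `π_* I` is injective too, every class
in `H¹(Y, (π_* T_U)_{(0)})` is the image of a global section of the cokernel of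
`(π_* T_U)_{(0)} ⟶ π_* I`. Let `g` be the action of `2 ∈ k^×`. As `2` is not a root of unity, over a
chart the derivations fixed by `g` are those fixed by all of `k^×`, every derivation is the sum of
one fixed by `g` and one in the image of `g - 1`, and `(g - 1)² D = 0` implies `(g - 1) D = 0`
(`exists_decomposition`, `actDer_eq_of_sub`); the last property passes to the vector fields on all
sets `π⁻¹ V`. Modifying local lifts to `I` by vector fields in the image of `g - 1` then shows that
`H¹(Y, (π_* T_U)_{(0)}) ⟶ H¹(U, T_U)` is injective (`pullback_injective_of_decomposition`) and that
its image contains the classes fixed by `g` (`exists_pullback_eq_of_decomposition`). All classes in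
the image are fixed by `k^×` (`pullback_fixed`). Surjectivity needs lifts of sections of `Q` over
the affine open sets `π⁻¹ Y_s`; they exist by the usual argument with a partition of unity
(`exists_lift_of_isAffineOpen`), in which only vector fields are multiplied by functions.

For (d), let `t i` be fibre coordinates of `π` over a trivialising cover `V i`. If the Atiyah class
vanishes, then there are differentials `ω i` on `V i` with `ω j - ω i = dlog (g i j)`, that is, a
connection on `L`. For an invariant vector field `E` the functions `E (t i) / t i - ⟨p E, ω i⟩`
agree on overlaps and are invariant, so that they define a function on `Y`. This is a retraction of
the Euler map (`IsProjection.eulerHom_retraction`), the extension splits, and `δ = 0`.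
-/

noncomputable section

/-! ### Sections and first cohomology of sheaves of vector spaces -/

namespace SheafCoh

variable {k : Type u} [Field k] {X Y : TopCat.{u}}

/-- Restriction of sections. -/
abbrev sres (F : TopCat.Sheaf (ModuleCat.{u} k) X) {W W' : Opens X} (h : W' ≤ W) :
    F.obj.obj (op W) →ₗ[k] F.obj.obj (op W') :=
  (F.obj.map (homOfLE h).op).hom

/-- The map on sections over `W` of a morphism of sheaves. -/
abbrev sapp {F G : TopCat.Sheaf (ModuleCat.{u} k) X} (φ : F ⟶ G) (W : Opens X) :
    F.obj.obj (op W) →ₗ[k] G.obj.obj (op W) :=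
  (φ.hom.app (op W)).hom

lemma sres_sres (F : TopCat.Sheaf (ModuleCat.{u} k) X) {W W' W'' : Opens X} (h : W' ≤ W)
    (h' : W'' ≤ W') (x : F.obj.obj (op W)) : sres F h' (sres F h x) = sres F (h'.trans h) x := by
  simp only [sres, ← LinearMap.comp_apply, ← ModuleCat.hom_comp, ← Functor.map_comp]
  rfl

lemma sres_self (F : TopCat.Sheaf (ModuleCat.{u} k) X) {W : Opens X} (h : W ≤ W)
    (x : F.obj.obj (op W)) : sres F h x = x := by
  have : F.obj.map (homOfLE h).op = 𝟙 _ := F.obj.map_id (op W)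
  exact congrArg (fun φ => φ.hom x) this

lemma sapp_sres {F G : TopCat.Sheaf (ModuleCat.{u} k) X} (φ : F ⟶ G) {W W' : Opens X}
    (h : W' ≤ W) (x : F.obj.obj (op W)) :
    sapp φ W' (sres F h x) = sres G h (sapp φ W x) :=
  congrArg (fun ψ => ψ.hom x) (φ.hom.naturality (homOfLE h).op)

lemma sapp_comp {F G H : TopCat.Sheaf (ModuleCat.{u} k) X} (φ : F ⟶ G) (ψ : G ⟶ H) (W : Opens X)
    (x : F.obj.obj (op W)) : sapp (φ ≫ ψ) W x = sapp ψ W (sapp φ W x) := rfl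

/-- Sections that agree locally are equal. -/
lemma section_ext (F : TopCat.Sheaf (ModuleCat.{u} k) X) {ι : Type*} {U : ι → Opens X}
    {W : Opens X} (hW : W ≤ iSup U) {x y : F.obj.obj (op W)}
    (h : ∀ i (V : Opens X) (hV : V ≤ W), V ≤ U i → sres F hV x = sres F hV y) : x = y := by
  refine TopCat.Sheaf.eq_of_locally_eq' F (fun p : W => W ⊓ U (Opens.mem_iSup.mp (hW p.2)).choose)
    W (fun p => homOfLE inf_le_left) ?_ x y fun p => h _ _ _ inf_le_right
  intro p hp
  exact Opens.mem_iSup.mpr ⟨⟨p, hp⟩, hp, (Opens.mem_iSup.mp (hW hp)).choose_spec⟩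

/-- Sections that agree on overlaps glue. -/
lemma section_glue (F : TopCat.Sheaf (ModuleCat.{u} k) X) {ι : Type u} {U : ι → Opens X}
    {W : Opens X} (hU : ∀ i, U i ≤ W) (hW : W ≤ iSup U) (s : ∀ i, F.obj.obj (op (U i)))
    (hs : ∀ i j, sres F inf_le_left (s i) = sres F (inf_le_right : U i ⊓ U j ≤ U j) (s j)) :
    ∃ x : F.obj.obj (op W), ∀ i, sres F (hU i) x = s i :=
  (TopCat.Sheaf.existsUnique_gluing' F U W (fun i => homOfLE (hU i)) hW s hs).exists

/-- Evaluation of sheaves on an open subset. -/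
abbrev secFunctor (k : Type u) [Field k] {X : TopCat.{u}} (W : Opens X) :
    TopCat.Sheaf (ModuleCat.{u} k) X ⥤ ModuleCat.{u} k :=
  sheafToPresheaf _ _ ⋙ (evaluation _ _).obj (op W)

instance secFunctor_preservesFiniteLimits (W : Opens X) :
    PreservesFiniteLimits (secFunctor k W) :=
  comp_preservesFiniteLimits (sheafToPresheaf (Opens.grothendieckTopology X) (ModuleCat.{u} k))
    ((evaluation _ _).obj (op W))

/-- The constant sheaf functor is left adjoint to global sections. -/
abbrev constAdj (k : Type u) [Field k] (X : TopCat.{u}) :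
    (constantSheaf (Opens.grothendieckTopology X) (ModuleCat.{u} k) :
      ModuleCat.{u} k ⥤ TopCat.Sheaf (ModuleCat.{u} k) X) ⊣ secFunctor k (⊤ : Opens X) :=
  constantSheafAdj (Opens.grothendieckTopology X) (ModuleCat.{u} k)
      (isTerminalTop (α := Opens X))

/-- The morphism from the constant sheaf given by a global section. -/
def secHom {F : TopCat.Sheaf (ModuleCat.{u} k) X} (x : F.obj.obj (op ⊤)) : const k X ⟶ F :=
  ((constAdj k X).homEquiv (ModuleCat.of k k) F).symm
    (ModuleCat.ofHom (LinearMap.toSpanSingleton k _ x))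

lemma homEquiv_secHom {F : TopCat.Sheaf (ModuleCat.{u} k) X} (x : F.obj.obj (op ⊤)) :
    (constAdj k X).homEquiv (ModuleCat.of k k) F (secHom x) =
      ModuleCat.ofHom (LinearMap.toSpanSingleton k _ x) :=
  Equiv.apply_symm_apply _ _

lemma secHom_surjective {F : TopCat.Sheaf (ModuleCat.{u} k) X} (φ : const k X ⟶ F) :
    ∃ x : F.obj.obj (op ⊤), secHom x = φ := by
  refine ⟨((constAdj k X).homEquiv (ModuleCat.of k k) F φ).hom (1 : k), ?_⟩
  apply ((constAdj k X).homEquiv (ModuleCat.of k k) F).injective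
  refine (homEquiv_secHom _).trans ?_
  ext
  exact one_smul k _

lemma secHom_injective {F : TopCat.Sheaf (ModuleCat.{u} k) X} {x y : F.obj.obj (op ⊤)}
    (h : secHom x = secHom y) : x = y := by
  have h3 := ((constAdj k X).homEquiv (ModuleCat.of k k) F).symm.injective h
  have h4 := congrArg (fun φ => φ.hom (1 : k)) h3
  exact (one_smul k _).symm.trans (h4.trans (one_smul k _))

lemma secHom_comp {F G : TopCat.Sheaf (ModuleCat.{u} k) X} (x : F.obj.obj (op ⊤)) (φ : F ⟶ G) :
    secHom x ≫ φ = secHom (sapp φ ⊤ x) := by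
  refine ((constAdj k X).homEquiv_naturality_right_symm _ _).symm.trans ?_
  refine congrArg ((constAdj k X).homEquiv (ModuleCat.of k k) G).symm ?_
  ext
  exact congrArg (sapp φ ⊤) (one_smul k x) |>.trans (one_smul k _).symm

lemma secHom_sub {F : TopCat.Sheaf (ModuleCat.{u} k) X} (x y : F.obj.obj (op ⊤)) :
    secHom (x - y) = secHom x - secHom y := by
  obtain ⟨z, hz⟩ := secHom_surjective (secHom x - secHom y)
  have h : ∀ φ : const k X ⟶ F, (constAdj k X).homEquiv (ModuleCat.of k k) F φ =
      (constAdj k X).unit.app _ ≫ φ.hom.app (op ⊤) :=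
    fun φ => (constAdj k X).homEquiv_unit _ _ _
  have e : (constAdj k X).homEquiv _ F (secHom z) =
      (constAdj k X).homEquiv _ _ (secHom x) - (constAdj k X).homEquiv _ _ (secHom y) := by
    rw [hz, h, h, h]
    exact Preadditive.comp_sub ..
  rw [homEquiv_secHom, homEquiv_secHom, homEquiv_secHom] at e
  have e' := congrArg (fun φ => φ.hom (1 : k)) e
  rw [← hz]
  congr 1
  exact ((one_smul k z).symm.trans (e'.trans (congrArg₂ (· - ·) (one_smul k x)
    (one_smul k y)))).symm

/-- The connecting map from global sections to `H¹` for a short exact sequence of sheaves. -/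
def bd {S : ShortComplex (TopCat.Sheaf (ModuleCat.{u} k) X)} (hS : S.ShortExact)
    (q : S.X₃.obj.obj (op ⊤)) : H S.X₁ 1 :=
  (Abelian.Ext.mk₀ (secHom q)).comp hS.extClass (zero_add 1)

section

variable {S : ShortComplex (TopCat.Sheaf (ModuleCat.{u} k) X)} (hS : S.ShortExact)

lemma bd_sub (q q' : S.X₃.obj.obj (op ⊤)) : bd hS (q - q') = bd hS q - bd hS q' := by
  have e : Abelian.Ext.mk₀ (secHom q - secHom q') =
      Abelian.Ext.mk₀ (secHom q) - Abelian.Ext.mk₀ (secHom q') :=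
    map_sub Abelian.Ext.addEquiv₀.symm _ _
  rw [bd, secHom_sub, e]
  exact map_sub ((Abelian.Ext.bilinearCompOfLinear k _ _ _ 0 1 1 (zero_add 1)).flip hS.extClass)
    _ _

lemma bd_eq_zero_iff (q : S.X₃.obj.obj (op ⊤)) :
    bd hS q = 0 ↔ ∃ y : S.X₂.obj.obj (op ⊤), sapp S.g ⊤ y = q := by
  constructor
  · intro h
    obtain ⟨x, hx⟩ := Abelian.Ext.covariant_sequence_exact₃ _ hS _ (zero_add 1) h
    obtain ⟨φ, rfl⟩ := (Abelian.Ext.mk₀_bijective _ _).2 x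
    obtain ⟨y, rfl⟩ := secHom_surjective φ
    refine ⟨y, ?_⟩
    rw [Abelian.Ext.mk₀_comp_mk₀, secHom_comp] at hx
    exact secHom_injective ((Abelian.Ext.mk₀_bijective _ _).1 hx)
  · rintro ⟨y, rfl⟩
    rw [bd, ← secHom_comp, ← Abelian.Ext.mk₀_comp_mk₀,
      Abelian.Ext.comp_assoc _ _ _ _ (zero_add 1) (by lia), hS.comp_extClass,
      Abelian.Ext.comp_zero]

/-- If the middle term is injective, then every class in `H¹` comes from a global section of the
quotient. -/
lemma exists_bd_eq [Injective S.X₂] (v : H S.X₁ 1) : ∃ q, bd hS q = v := by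
  obtain ⟨x, hx⟩ := Abelian.Ext.covariant_sequence_exact₁ _ hS v
    (Abelian.Ext.eq_zero_of_injective _) (zero_add 1)
  obtain ⟨φ, rfl⟩ := (Abelian.Ext.mk₀_bijective _ _).2 x
  obtain ⟨q, rfl⟩ := secHom_surjective φ
  exact ⟨q, hx⟩

omit hS in
lemma injective_of_mono {F G : TopCat.Sheaf (ModuleCat.{u} k) X} (φ : F ⟶ G) [Mono φ]
    (W : Opens X) : Function.Injective (sapp φ W) := by
  have h : Mono ((secFunctor k W).map φ) := inferInstance
  exact (ModuleCat.mono_iff_injective _).mp h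

include hS in
lemma sections_injective (W : Opens X) : Function.Injective (sapp S.f W) := by
  have := hS.mono_f
  exact injective_of_mono S.f W

include hS in
lemma sections_exact (W : Opens X) (x : S.X₂.obj.obj (op W)) (hx : sapp S.g W x = 0) :
    ∃ y, sapp S.f W y = x := by
  have := hS.mono_f
  have : (secFunctor k W).PreservesZeroMorphisms := ⟨fun _ _ => rfl⟩
  have h := hS.exact.map_of_mono_of_preservesKernel (secFunctor k W) inferInstance inferInstance
  exact (ShortComplex.moduleCat_exact_iff _).mp h x hx

include hS in
lemma sections_locally_surjective (W : Opens X) (q : S.X₃.obj.obj (op W)) (x : X) (hx : x ∈ W) :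
    ∃ (V : Opens X) (hV : V ≤ W) (s : S.X₂.obj.obj (op V)), x ∈ V ∧
      sapp S.g V s = sres S.X₃ hV q := by
  have := hS.epi_g
  obtain ⟨V, hV, ⟨s, hs⟩, hxV⟩ := (TopCat.Presheaf.isLocallySurjective_iff _).mp
    ((TopCat.Sheaf.isLocallySurjective_iff_epi S.g).mpr this) W q x hx
  exact ⟨V, hV, s, hxV, hs⟩

end

/-- The short exact sequence attached to a monomorphism of sheaves. -/
lemma shortExact_cokernel {F G : TopCat.Sheaf (ModuleCat.{u} k) X} (φ : F ⟶ G) [Mono φ] :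
    (ShortComplex.mk φ (cokernel.π φ) (cokernel.condition φ)).ShortExact where
  exact := ShortComplex.exact_cokernel φ

lemma mono_of_injective {F G : TopCat.Sheaf (ModuleCat.{u} k) X} (φ : F ⟶ G)
    (h : ∀ W, Function.Injective (sapp φ W)) : Mono φ := by
  have : Mono φ.hom := by
    have : ∀ W, Mono (φ.hom.app W) := fun W => (ModuleCat.mono_iff_injective _).mpr (h W.unop)
    exact NatTrans.mono_of_mono_app _
  exact (sheafToPresheaf _ _).mono_of_mono_map this

/-- Naturality of the connecting map for the pullback along a continuous map: the maps `φ₁`, `φ₂`,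
`φ₃` correspond to a morphism from the inverse image of `S` to `T`. -/
lemma pullback_bd (f : X ⟶ Y) {S : ShortComplex (TopCat.Sheaf (ModuleCat.{u} k) Y)}
    {T : ShortComplex (TopCat.Sheaf (ModuleCat.{u} k) X)} (hS : S.ShortExact) (hT : T.ShortExact)
    (φ₁ : S.X₁ ⟶ (TopCat.Sheaf.pushforward (ModuleCat.{u} k) f).obj T.X₁)
    (φ₂ : S.X₂ ⟶ (TopCat.Sheaf.pushforward (ModuleCat.{u} k) f).obj T.X₂)
    (φ₃ : S.X₃ ⟶ (TopCat.Sheaf.pushforward (ModuleCat.{u} k) f).obj T.X₃)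
    (h₁₂ : φ₁ ≫ (TopCat.Sheaf.pushforward (ModuleCat.{u} k) f).map T.f = S.f ≫ φ₂)
    (h₂₃ : φ₂ ≫ (TopCat.Sheaf.pushforward (ModuleCat.{u} k) f).map T.g = S.g ≫ φ₃)
    (q : S.X₃.obj.obj (op ⊤)) :
    H.pullback f φ₁ 1 (bd hS q) = bd hT (sapp φ₃ ⊤ q) := by
  let P := TopCat.Sheaf.pullback (ModuleCat.{u} k) f
  let adj := TopCat.Sheaf.pullbackPushforwardAdjunction (ModuleCat.{u} k) f
  let ψ₁ : P.obj S.X₁ ⟶ T.X₁ := (adj.homEquiv _ _).symm φ₁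
  let ψ₂ : P.obj S.X₂ ⟶ T.X₂ := (adj.homEquiv _ _).symm φ₂
  let ψ₃ : P.obj S.X₃ ⟶ T.X₃ := (adj.homEquiv _ _).symm φ₃
  let ψ : S.map P ⟶ T :=
    { τ₁ := ψ₁
      τ₂ := ψ₂
      τ₃ := ψ₃
      comm₁₂ := (adj.homEquiv_naturality_right_symm _ _).symm.trans
        ((congrArg _ h₁₂).trans (adj.homEquiv_naturality_left_symm _ _))
      comm₂₃ := (adj.homEquiv_naturality_right_symm _ _).symm.trans
        ((congrArg _ h₂₃).trans (adj.homEquiv_naturality_left_symm _ _)) }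
  -- the connecting maps are compositions with extension classes, so it remains to compare sections
  have key : constToPullback f ≫ P.map (secHom q) ≫ ψ₃ =
      secHom (F := T.X₃) (sapp φ₃ ⊤ q) := by
    have h1 : adj.unit.app (const k Y) ≫
        (TopCat.Sheaf.pushforward (ModuleCat.{u} k) f).map (P.map (secHom q) ≫ ψ₃) =
        secHom q ≫ φ₃ := by
      refine (adj.homEquiv_unit _ _ _).symm.trans ?_
      refine (congrArg _ (adj.homEquiv_naturality_left_symm _ _).symm).trans ?_
      exact Equiv.apply_symm_apply _ _
    have h2 := congrArg (fun χ => (constAdj k Y).unit.app (ModuleCat.of k k) ≫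
      χ.hom.app (op ⊤)) h1
    refine ((constAdj k X).homEquiv_naturality_right_symm _ _).symm.trans ?_
    refine congrArg ((constAdj k X).homEquiv (ModuleCat.of k k) T.X₃).symm ?_
    refine Eq.trans ?_ (h2.trans ?_)
    · rfl
    · rw [secHom_comp]
      exact ((constAdj k Y).homEquiv_unit _ _ _).symm.trans (homEquiv_secHom _)
  obtain ⟨x, hx⟩ : ∃ x : Abelian.Ext (P.obj S.X₃) (P.obj S.X₁) 1,
      x = (hS.map_of_exact P).extClass := ⟨_, rfl⟩
  have e1 : (bd hS q).mapExactFunctor P =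
      (Abelian.Ext.mk₀ (P.map (secHom q))).comp x (zero_add 1) := by
    rw [bd, Abelian.Ext.mapExactFunctor_comp, Abelian.Ext.mapExactFunctor_mk₀,
      Abelian.Ext.mapExactFunctor_extClass, hx]
  have e2 : x.comp (Abelian.Ext.mk₀ ψ₁) (add_zero 1) =
      (Abelian.Ext.mk₀ ψ₃).comp hT.extClass (zero_add 1) := by
    rw [hx]
    exact ShortComplex.ShortExact.extClass_naturality (hS.map_of_exact P) hT ψ
  change (((Abelian.Ext.mk₀ (constToPullback f)).comp
    ((bd hS q).mapExactFunctor P) (zero_add 1)).comp (Abelian.Ext.mk₀ ψ₁) (add_zero 1)) = _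
  rw [e1, Abelian.Ext.comp_assoc_of_third_deg_zero, Abelian.Ext.comp_assoc_of_third_deg_zero, e2]
  change _ = (Abelian.Ext.mk₀ (secHom (F := T.X₃) (sapp φ₃ ⊤ q))).comp hT.extClass (zero_add 1)
  rw [← key, ← Abelian.Ext.mk₀_comp_mk₀, ← Abelian.Ext.mk₀_comp_mk₀,
    Abelian.Ext.comp_assoc_of_second_deg_zero, Abelian.Ext.comp_assoc_of_second_deg_zero]

end SheafCoh

/-! ### Derivations of localizations -/

section DerivationLocalization

variable {k B B' B'' : Type*} [CommRing k] [CommRing B] [CommRing B'] [CommRing B'']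
  [Algebra k B'] [Algebra k B''] [Algebra B B']

/-- A derivation extends to a localization: the ring homomorphism `b ↦ b + ε d b` into the dual
numbers sends units modulo `ε` to units. -/
lemma exists_derivation_extension [Algebra k B] (f : B) [IsLocalization.Away f B']
    [IsScalarTower k B B'] (d : Derivation k B B) :
    ∃ d' : Derivation k B' B', ∀ b, d' (algebraMap B B' b) = algebraMap B B' (d b) := by
  let φ : B →+* TrivSqZeroExt B' B' :=
    { toFun := fun b => TrivSqZeroExt.inl (algebraMap B B' b) +
        TrivSqZeroExt.inr (algebraMap B B' (d b))
      map_one' := by simp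
      map_zero' := by simp
      map_mul' := fun a b => by
        ext
        · simp
        · simp only [Derivation.leibniz, smul_eq_mul, map_add, map_mul, TrivSqZeroExt.snd_add,
            TrivSqZeroExt.snd_inl, TrivSqZeroExt.snd_inr, zero_add, TrivSqZeroExt.snd_mul,
            TrivSqZeroExt.fst_add, TrivSqZeroExt.fst_inl, TrivSqZeroExt.fst_inr, add_zero,
            MulOpposite.smul_eq_mul_unop, MulOpposite.unop_op]
          ring
      map_add' := fun a b => by
        ext
        · simp
        · simp only [map_add, TrivSqZeroExt.snd_add, TrivSqZeroExt.snd_inl,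
            TrivSqZeroExt.snd_inr, zero_add] }
  have hf : IsUnit (φ f) := by
    rw [TrivSqZeroExt.isUnit_iff_isUnit_fst]
    simpa [φ] using IsLocalization.Away.algebraMap_isUnit (S := B') f
  let ψ : B' →+* TrivSqZeroExt B' B' := IsLocalization.Away.lift f hf
  have hψ : ∀ b, ψ (algebraMap B B' b) = φ b := IsLocalization.Away.lift_eq f hf
  -- the lift `ψ` is again of the form `x ↦ x + ε d' x`
  have hfst : ∀ x, (ψ x).fst = x := by
    have : ((TrivSqZeroExt.fstHom B' B' B' : _ →+* _).comp ψ) = RingHom.id B' := by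
      apply IsLocalization.ringHom_ext (Submonoid.powers f)
      ext b
      simp [hψ, φ]
    exact fun x => congrArg (fun g : B' →+* B' => g x) this
  have hk : ∀ c : k, (ψ (algebraMap k B' c)).snd = 0 := fun c => by
    rw [IsScalarTower.algebraMap_apply k B B', hψ]
    simp [φ]
  refine ⟨Derivation.mk'
    { toFun := fun x => (ψ x).snd
      map_add' := fun x y => by simp
      map_smul' := fun c x => by
        rw [Algebra.smul_def, map_mul, TrivSqZeroExt.snd_mul, hk, hfst]
        simp [Algebra.smul_def] }
    (fun x y => by
      change (ψ (x * y)).snd = x * (ψ y).snd + y * (ψ x).snd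
      rw [map_mul, TrivSqZeroExt.snd_mul, hfst, hfst, smul_eq_mul,
        MulOpposite.smul_eq_mul_unop, MulOpposite.unop_op, mul_comm y]), fun b => ?_⟩
  change (ψ (algebraMap B B' b)).snd = _
  rw [hψ]
  exact zero_add _

/-- A derivation of a localization is determined by its values on the original ring. -/
lemma derivation_localization_ext (f : B) [IsLocalization.Away f B'] (ψ : B' →+* B'')
    (d : Derivation k B' B') (d' : Derivation k B'' B'')
    (h : ∀ b, ψ (d (algebraMap B B' b)) = d' (ψ (algebraMap B B' b))) (x : B') :
    ψ (d x) = d' (ψ x) := by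
  obtain ⟨n, b, hb⟩ := IsLocalization.Away.surj f x
  have h1 := h b
  have h2 := h (f ^ n)
  have hu : IsUnit (ψ (algebraMap B B' (f ^ n))) := by
    rw [map_pow]
    exact ((IsLocalization.Away.algebraMap_isUnit f).pow n).map ψ
  rw [← map_pow] at hb
  rw [← hb, map_mul ψ, Derivation.leibniz, Derivation.leibniz, map_add, smul_eq_mul, smul_eq_mul,
    smul_eq_mul, smul_eq_mul, map_mul ψ, map_mul ψ, h2] at h1
  exact hu.mul_left_cancel (add_left_cancel h1)

/-- If `d` is a derivation of `B_f` and `B` is a finitely generated domain, then `f ^ N d` maps `B`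
into itself for all large `N`. -/
lemma exists_pow_mul_derivation [Algebra k B] [Algebra.FiniteType k B] [IsScalarTower k B B']
    (f : B) [IsLocalization.Away f B'] (hinj : Function.Injective (algebraMap B B'))
    (d : Derivation k B' B') :
    ∃ (N : ℕ) (e : Derivation k B B), ∀ b,
      algebraMap B B' (e b) = algebraMap B B' (f ^ N) * d (algebraMap B B' b) := by
  obtain ⟨s, hs⟩ := Algebra.FiniteType.out (R := k) (A := B)
  -- a common denominator of the values of `d` at finitely many generators
  have hN : ∃ N, ∀ b ∈ s, ∃ a, algebraMap B B' a =
      algebraMap B B' (f ^ N) * d (algebraMap B B' b) := by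
    choose n a ha using fun b : B => IsLocalization.Away.surj f (d (algebraMap B B' b))
    refine ⟨s.sup n, fun b hb => ⟨f ^ (s.sup n - n b) * a b, ?_⟩⟩
    rw [map_mul, ← ha, mul_comm (d _), ← map_pow, ← mul_assoc, ← map_mul, ← pow_add,
      Nat.sub_add_cancel (Finset.le_sup hb)]
  obtain ⟨N, hN⟩ := hN
  have hall : ∀ b, ∃ a, algebraMap B B' a = algebraMap B B' (f ^ N) * d (algebraMap B B' b) := by
    intro b
    have hb : b ∈ Algebra.adjoin k (s : Set B) := hs ▸ Algebra.mem_top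
    induction hb using Algebra.adjoin_induction with
    | mem b hb => exact hN b hb
    | algebraMap c =>
      refine ⟨0, ?_⟩
      rw [← IsScalarTower.algebraMap_apply k B B']
      simp
    | add x y _ _ hx hy =>
      obtain ⟨a, ha⟩ := hx
      obtain ⟨a', ha'⟩ := hy
      exact ⟨a + a', by rw [map_add, map_add, map_add, mul_add, ha, ha']⟩
    | mul x y _ _ hx hy =>
      obtain ⟨a, ha⟩ := hx
      obtain ⟨a', ha'⟩ := hy
      refine ⟨x * a' + y * a, ?_⟩
      rw [map_add, map_mul, map_mul, ha, ha', map_mul (algebraMap B B') x y, Derivation.leibniz,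
        smul_eq_mul, smul_eq_mul]
      ring
  choose e he using hall
  refine ⟨N, Derivation.mk'
    { toFun := e
      map_add' := fun x y => hinj <| by rw [map_add, he, he, he, map_add, map_add, mul_add]
      map_smul' := fun c x => hinj <| by
        rw [RingHom.id_apply, Algebra.smul_def, Algebra.smul_def, map_mul, he, he, map_mul,
          ← IsScalarTower.algebraMap_apply k B B', ← Algebra.smul_def (A := B') c (_ : B'),
          Derivation.map_smul, Algebra.smul_def (A := B') c (_ : B')]
        ring }
    (fun x y => hinj <| by
        change algebraMap B B' (e (x * y)) = algebraMap B B' (x * e y + y * e x)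
        rw [map_add, map_mul, map_mul, he, he, he, map_mul (algebraMap B B') x y,
          Derivation.leibniz, smul_eq_mul, smul_eq_mul]
        ring), he⟩

end DerivationLocalization

/-! ### Vector fields on affine open subsets -/

namespace AlgGeom

variable {k : Type u} [Field k] {X : Scheme.{u}} [X.Over (Spec (.of k))]

lemma res_self {W : X.Opens} (h : W ≤ W) (f : Γ(X, W)) : res h f = f :=
  congrArg (fun φ : Γ(X, W) ⟶ Γ(X, W) => φ.hom f) (X.presheaf.map_id (op W))

lemma res_injective [IsIntegral X] {V W : X.Opens} (h : V ≤ W) (hV : (V : Set X).Nonempty) :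
    Function.Injective (res h : Γ(X, W) →+* Γ(X, V)) := by
  have : Nonempty V := hV.to_subtype
  exact map_injective_of_isIntegral X (homOfLE h)

lemma sections_ext {ι : Type*} {U : ι → X.Opens} {V : X.Opens} {f g : Γ(X, V)}
    (hU : ∀ x ∈ V, ∃ i, x ∈ U i ∧ U i ≤ V) (h : ∀ i (hi : U i ≤ V), res hi f = res hi g) :
    f = g := by
  choose i hi hi' using fun x : V => hU x.1 x.2
  exact X.sheaf.eq_of_locally_eq' (fun x : V => U (i x)) V (fun x => homOfLE (hi' x))
    (fun x hx => Opens.mem_iSup.mpr ⟨⟨x, hx⟩, hi _⟩) f g (fun x => h _ _)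

lemma sections_glue {ι : Type u} {U : ι → X.Opens} {V : X.Opens} (hU : ∀ i, U i ≤ V)
    (hV : ∀ x ∈ V, ∃ i, x ∈ U i) (s : ∀ i, Γ(X, U i))
    (hs : ∀ i j, res (inf_le_left : U i ⊓ U j ≤ U i) (s i) =
      res (inf_le_right : U i ⊓ U j ≤ U j) (s j)) :
    ∃ f : Γ(X, V), ∀ i, res (hU i) f = s i :=
  (X.sheaf.existsUnique_gluing' U V (fun i => homOfLE (hU i))
    (fun x hx => Opens.mem_iSup.mpr (hV x hx)) s hs).exists

namespace VF

lemma ext {W : X.Opens} {D D' : vectorFields k X W}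
    (h : ∀ (V : X.Opens) (hV : V ≤ W) (f : Γ(X, V)), VF.ap D hV f = VF.ap D' hV f) : D = D' := by
  apply Subtype.ext
  funext V
  ext f
  exact h V.1 V.2 f

/-- Vector fields that agree on a basis of open subsets are equal. -/
lemma ext_basis {ι : Type*} {U : ι → X.Opens} {W : X.Opens}
    (hU : ∀ V ≤ W, ∀ x ∈ V, ∃ i, x ∈ U i ∧ U i ≤ V) {D D' : vectorFields k X W}
    (h : ∀ i (hi : U i ≤ W) (f : Γ(X, U i)), VF.ap D hi f = VF.ap D' hi f) : D = D' := by
  refine ext fun V hV f => ?_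
  refine sections_ext (hU V hV) fun i hi => ?_
  rw [VF.ap_res, VF.ap_res, h]

/-- Compatible derivations on a basis of open subsets define a vector field. -/
lemma exists_of_basis {ι : Type u} {U : ι → X.Opens} {W : X.Opens}
    (hU : ∀ V ≤ W, ∀ x ∈ V, ∃ i, x ∈ U i ∧ U i ≤ V)
    (d : ∀ i, Derivation k Γ(X, U i) Γ(X, U i))
    (hd : ∀ i j (h : U j ≤ U i) (f : Γ(X, U i)), res h (d i f) = d j (res h f)) :
    ∃ D : vectorFields k X W, ∀ i (hi : U i ≤ W) (f : Γ(X, U i)), VF.ap D hi f = d i f := by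
  have hex : ∀ (V : {V : X.Opens // V ≤ W}) (f : Γ(X, V.1)),
      ∃ g : Γ(X, V.1), ∀ i (h : U i ≤ V.1), res h g = d i (res h f) := by
    intro V f
    obtain ⟨g, hg⟩ := sections_glue (ι := {i // U i ≤ V.1}) (U := fun i => U i.1) (V := V.1)
      (fun i => i.2) (fun x hx => by
        obtain ⟨i, hi, hi'⟩ := hU V.1 V.2 x hx
        exact ⟨⟨i, hi'⟩, hi⟩) (fun i => d i.1 (res i.2 f)) (fun i j => by
        refine sections_ext (U := U) (fun x hx =>
          hU _ ((inf_le_left.trans i.2).trans V.2) x hx) fun l hl => ?_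
        rw [res_res, res_res, hd, hd, res_res, res_res])
    exact ⟨g, fun i h => hg ⟨i, h⟩⟩
  choose v hv using hex
  refine ⟨⟨fun V => Derivation.mk'
    { toFun := v V
      map_add' := fun f g => by
        refine sections_ext (hU V.1 V.2) fun i hi => ?_
        rw [map_add, hv, hv, hv, map_add, map_add]
      map_smul' := fun c f => by
        refine sections_ext (hU V.1 V.2) fun i hi => ?_
        rw [RingHom.id_apply, res_smul, hv, hv, res_smul, Derivation.map_smul] }
    (fun f g => by
        refine sections_ext (hU V.1 V.2) fun i hi => ?_
        change res _ (v V (f * g)) = res _ (f * v V g + g * v V f)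
        rw [map_add, map_mul, map_mul, hv, hv, hv, map_mul, Derivation.leibniz, smul_eq_mul,
          smul_eq_mul]), ?_⟩, ?_⟩
  · intro V V' h f
    refine sections_ext (hU V'.1 V'.2) fun i hi => ?_
    change res hi (res h (v V f)) = res hi (v V' (res h f))
    rw [res_res, hv, hv, res_res]
  · intro i hi f
    change v ⟨U i, hi⟩ f = d i f
    have := hv ⟨U i, hi⟩ f i le_rfl
    rwa [res_self, res_self] at this

lemma ap_congr {W : X.Opens} {D D' : vectorFields k X W} (e : D = D') {V : X.Opens} (h : V ≤ W)
    (f : Γ(X, V)) : VF.ap D h f = VF.ap D' h f := by rw [e]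

lemma ap_add {W V : X.Opens} (D : vectorFields k X W) (h : V ≤ W) (f g : Γ(X, V)) :
    VF.ap D h (f + g) = VF.ap D h f + VF.ap D h g := Derivation.map_add _ _ _

lemma ap_mul {W V : X.Opens} (D : vectorFields k X W) (h : V ≤ W) (f g : Γ(X, V)) :
    VF.ap D h (f * g) = f * VF.ap D h g + g * VF.ap D h f := Derivation.leibniz _ _ _

lemma ap_algebraMap {W V : X.Opens} (D : vectorFields k X W) (h : V ≤ W) (c : k) :
    VF.ap D h (algebraMap k Γ(X, V) c) = 0 := Derivation.map_algebraMap _ _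

/-- The product of a vector field with a function. -/
def smul {W : X.Opens} (a : Γ(X, W)) (D : vectorFields k X W) : vectorFields k X W :=
  ⟨fun V => res V.2 a • D.1 V, fun V V' h f => by
    simp only [Derivation.smul_apply, smul_eq_mul, map_mul, res_res]
    rw [D.2 V V' h f]⟩

lemma ap_smul {W V : X.Opens} (a : Γ(X, W)) (D : vectorFields k X W) (h : V ≤ W) (f : Γ(X, V)) :
    VF.ap (VF.smul a D) h f = res h a * VF.ap D h f := rfl

lemma ap_vectorFieldsRes {W W' V : X.Opens} (D : vectorFields k X W) (h' : W' ≤ W) (h : V ≤ W')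
    (f : Γ(X, V)) : VF.ap (vectorFieldsRes k X h' D) h f = VF.ap D (h.trans h') f := rfl

lemma smul_res {W W' : X.Opens} (a : Γ(X, W)) (D : vectorFields k X W) (h : W' ≤ W) :
    vectorFieldsRes k X h (VF.smul a D) = VF.smul (res h a) (vectorFieldsRes k X h D) := by
  refine ext fun V hV f => ?_
  simp only [ap_vectorFieldsRes, ap_smul, res_res]

lemma sub_ap {W V : X.Opens} (D D' : vectorFields k X W) (h : V ≤ W) (f : Γ(X, V)) :
    VF.ap (D - D') h f = VF.ap D h f - VF.ap D' h f := rfl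

lemma add_ap {W V : X.Opens} (D D' : vectorFields k X W) (h : V ≤ W) (f : Γ(X, V)) :
    VF.ap (D + D') h f = VF.ap D h f + VF.ap D' h f := rfl

lemma smul_sub {W : X.Opens} (a : Γ(X, W)) (D D' : vectorFields k X W) :
    VF.smul a (D - D') = VF.smul a D - VF.smul a D' := by
  refine ext fun V hV f => ?_
  simp only [sub_ap, ap_smul, mul_sub]

lemma smul_smul {W : X.Opens} (a b : Γ(X, W)) (D : vectorFields k X W) :
    VF.smul a (VF.smul b D) = VF.smul (a * b) D := by
  refine ext fun V hV f => ?_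
  simp only [ap_smul, map_mul, mul_assoc]

lemma sum_smul {W : X.Opens} {ι : Type*} (s : Finset ι) (a : ι → Γ(X, W))
    (D : vectorFields k X W) : VF.smul (∑ i ∈ s, a i) D = ∑ i ∈ s, VF.smul (a i) D := by
  classical
  induction s using Finset.induction_on with
  | empty =>
    refine ext fun V hV f => ?_
    simp only [Finset.sum_empty, ap_smul, map_zero, zero_mul]
    rfl
  | insert i s hi ih =>
    rw [Finset.sum_insert hi, Finset.sum_insert hi, ← ih]
    refine ext fun V hV f => ?_
    simp only [add_ap, ap_smul, map_add, add_mul]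

lemma one_smul {W : X.Opens} (D : vectorFields k X W) : VF.smul 1 D = D := by
  refine ext fun V hV f => ?_
  simp only [ap_smul, map_one, one_mul]

/-- On an integral scheme vector fields are determined by their restriction to a nonempty open
subset. -/
lemma res_injective [IsIntegral X] {W W' : X.Opens} (h : W' ≤ W) (hW' : (W' : Set X).Nonempty) :
    Function.Injective (vectorFieldsRes k X h) := by
  intro D D' hD
  refine ext fun V hV f => ?_
  by_cases hV' : (V : Set X).Nonempty
  · have hne : ((V ⊓ W' : X.Opens) : Set X).Nonempty :=
      nonempty_preirreducible_inter V.2 W'.2 hV' hW'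
    apply AlgGeom.res_injective (inf_le_left : V ⊓ W' ≤ V) hne
    rw [VF.ap_res, VF.ap_res]
    exact ap_congr hD inf_le_right _
  · exact sections_ext (ι := Empty) (U := Empty.elim) (fun x hx => (hV' ⟨x, hx⟩).elim)
      (fun i => i.elim)

end VF

section affine

lemma affine_basis {W : X.Opens} (hW : IsAffineOpen W) (V : X.Opens) (hV : V ≤ W) (x : X)
    (hx : x ∈ V) : ∃ f : Γ(X, W), x ∈ X.basicOpen f ∧ X.basicOpen f ≤ V := by
  obtain ⟨f, hf, hf'⟩ := hW.exists_basicOpen_le ⟨x, hx⟩ (hV hx)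
  exact ⟨f, hf', hf⟩

variable (k) in
lemma isScalarTower_basicOpen {W : X.Opens} (f : Γ(X, W)) :
    IsScalarTower k Γ(X, W) Γ(X, X.basicOpen f) :=
  IsScalarTower.of_algebraMap_eq fun c => (res_algebraMap k X (X.basicOpen_le f) c).symm

/-- A vector field on an affine open subset is determined by its values on the functions
defined there. -/
lemma VF.ext_affine {W : X.Opens} (hW : IsAffineOpen W) {D D' : vectorFields k X W}
    (h : ∀ f : Γ(X, W), VF.ap D le_rfl f = VF.ap D' le_rfl f) : D = D' := by
  refine VF.ext_basis (U := fun f : Γ(X, W) => X.basicOpen f) (affine_basis hW) fun f hf g => ?_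
  have := hW.isLocalization_basicOpen f
  refine derivation_localization_ext f (RingHom.id _) (D.1 ⟨_, hf⟩) (D'.1 ⟨_, hf⟩) (fun b => ?_) g
  change VF.ap D hf (res hf b) = VF.ap D' hf (res hf b)
  rw [← VF.ap_res D le_rfl hf, ← VF.ap_res D' le_rfl hf, h]

/-- A derivation of the ring of functions of an affine open subset extends to a vector field. -/
lemma VF.exists_of_derivation {W : X.Opens} (hW : IsAffineOpen W)
    (d : Derivation k Γ(X, W) Γ(X, W)) :
    ∃ D : vectorFields k X W, ∀ f : Γ(X, W), VF.ap D le_rfl f = d f := by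
  have hex : ∀ f : Γ(X, W), ∃ d' : Derivation k Γ(X, X.basicOpen f) Γ(X, X.basicOpen f),
      ∀ b, d' (res (X.basicOpen_le f) b) = res (X.basicOpen_le f) (d b) := fun f => by
    have := hW.isLocalization_basicOpen f
    have := isScalarTower_basicOpen k f
    exact exists_derivation_extension f d
  choose d' hd' using hex
  obtain ⟨D, hD⟩ := VF.exists_of_basis (U := fun f : Γ(X, W) => X.basicOpen f) (W := W)
    (affine_basis hW) d' (fun f g h x => by
      have := hW.isLocalization_basicOpen f
      refine derivation_localization_ext f (res h) (d' f) (d' g) (fun b => ?_) x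
      change res h (d' f (res _ b)) = d' g (res h (res _ b))
      rw [hd', res_res, res_res, hd'])
  refine ⟨D, fun f => ?_⟩
  refine sections_ext (affine_basis hW W le_rfl) fun g hg => ?_
  rw [VF.ap_res, hD]
  exact hd' g f

/-- If `D` is a vector field on `D(f) ⊆ W`, where `W` is affine with finitely generated ring of
functions, then `f ^ n D` extends to `W` for all large `n`. -/
lemma VF.exists_pow_smul [IsIntegral X] {W : X.Opens} (hW : IsAffineOpen W)
    [Algebra.FiniteType k Γ(X, W)] (f : Γ(X, W)) (hf : (X.basicOpen f : Set X).Nonempty)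
    (D : vectorFields k X (X.basicOpen f)) :
    ∃ N : ℕ, ∀ n ≥ N, ∃ e : vectorFields k X W, vectorFieldsRes k X (X.basicOpen_le f) e =
      VF.smul (res (X.basicOpen_le f) (f ^ n)) D := by
  have := hW.isLocalization_basicOpen f
  have := isScalarTower_basicOpen k f
  obtain ⟨N, d, hd⟩ := exists_pow_mul_derivation f (AlgGeom.res_injective (X.basicOpen_le f) hf)
    (D.1 ⟨_, le_rfl⟩)
  obtain ⟨e, he⟩ := VF.exists_of_derivation hW d
  refine ⟨N, fun n hn => ⟨VF.smul (f ^ (n - N)) e, ?_⟩⟩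
  have key : vectorFieldsRes k X (X.basicOpen_le f) e =
      VF.smul (res (X.basicOpen_le f) (f ^ N)) D := by
    refine VF.ext_affine (hW.basicOpen f) fun g => ?_
    refine derivation_localization_ext f (RingHom.id _)
      ((vectorFieldsRes k X (X.basicOpen_le f) e).1 ⟨_, le_rfl⟩)
      ((VF.smul (res (X.basicOpen_le f) (f ^ N)) D).1 ⟨_, le_rfl⟩) (fun b => ?_) g
    change VF.ap e (X.basicOpen_le f) (res _ b) = res le_rfl (res _ (f ^ N)) * VF.ap D le_rfl _
    rw [← VF.ap_res e le_rfl, he, res_res]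
    exact hd b
  rw [VF.smul_res, key, VF.smul_smul, ← map_mul, ← pow_add, Nat.sub_add_cancel hn]

end affine

end AlgGeom

/-! ### Vanishing of the first cohomology of the tangent sheaf on affine open subsets -/

namespace AlgGeom

open SheafCoh

variable {k : Type u} [Field k] {X : Scheme.{u}} [X.Over (Spec (.of k))]

lemma finiteType_basicOpen {W : X.Opens} (hW : IsAffineOpen W) [Algebra.FiniteType k Γ(X, W)]
    (f : Γ(X, W)) : Algebra.FiniteType k Γ(X, X.basicOpen f) := by
  have := hW.isLocalization_basicOpen f
  have := isScalarTower_basicOpen k f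
  have : Algebra.FiniteType Γ(X, W) Γ(X, X.basicOpen f) :=
    IsLocalization.finiteType_of_monoid_fg (Submonoid.powers f) _
  exact Algebra.FiniteType.trans (S := Γ(X, W)) inferInstance inferInstance

/-- Extension of vector fields from `U ∩ D(f)` to an affine open `U ⊆ W`, for a function `f` on
`W`. -/
lemma VF.exists_pow_smul_of_le [IsIntegral X] {W U O : X.Opens} (hU : IsAffineOpen U)
    [Algebra.FiniteType k Γ(X, U)] (hUW : U ≤ W) (f : Γ(X, W)) (hO : X.basicOpen (res hUW f) = O)
    (hne : (O : Set X).Nonempty) (hOU : O ≤ U) (D : vectorFields k X O) :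
    ∃ N : ℕ, ∀ n ≥ N, ∃ e : vectorFields k X U, vectorFieldsRes k X hOU e =
      VF.smul (res (hOU.trans hUW) (f ^ n)) D := by
  subst hO
  obtain ⟨N, hN⟩ := VF.exists_pow_smul hU (res hUW f) hne D
  refine ⟨N, fun n hn => ?_⟩
  obtain ⟨e, he⟩ := hN n hn
  refine ⟨e, he.trans ?_⟩
  rw [← RingHom.map_pow, res_res]

set_option maxHeartbeats 1000000 in
/-- Sections of a quotient of a sheaf by the tangent sheaf lift over affine open subsets.
The obstruction is a Čech cocycle of vector fields on a finite cover by basic open subsets `D(f i)`;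
it is split by means of a partition of unity `∑ h i * f i ^ N = 1`. -/
lemma exists_lift_of_isAffineOpen [IsIntegral X]
    {I Q : TopCat.Sheaf (ModuleCat.{u} k) X.toTopCat} {i : tangentSheaf k X ⟶ I} {p : I ⟶ Q}
    {w : i ≫ p = 0} (hS : (ShortComplex.mk i p w).ShortExact) {W : X.Opens} (hW : IsAffineOpen W)
    [Algebra.FiniteType k Γ(X, W)] (q : Q.obj.obj (op W)) :
    ∃ s : I.obj.obj (op W), sapp p W s = q := by
  -- a finite cover by nonempty basic open subsets over which `q` lifts
  let F : Set Γ(X, W) := {f | (X.basicOpen f : Set X).Nonempty ∧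
    ∃ s : I.obj.obj (op (X.basicOpen f)), sapp p _ s = sres Q (X.basicOpen_le f) q}
  have hF : ∀ x ∈ W, ∃ f ∈ F, x ∈ X.basicOpen f := by
    intro x hx
    obtain ⟨V, hV, s, hxV, hs⟩ := sections_locally_surjective hS W q x hx
    obtain ⟨f, hf, hf'⟩ := affine_basis hW V hV x hxV
    refine ⟨f, ⟨⟨x, hf⟩, sres I hf' s, ?_⟩, hf⟩
    rw [sapp_sres]
    exact (congrArg _ hs).trans (sres_sres _ _ _ _)
  have hspan : Ideal.span F = ⊤ := by
    rw [← hW.iSup_basicOpen_eq_self_iff]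
    refine le_antisymm (iSup_le fun f => X.basicOpen_le _) fun x hx => ?_
    obtain ⟨f, hf, hxf⟩ := hF x hx
    exact Opens.mem_iSup.mpr ⟨⟨f, hf⟩, hxf⟩
  obtain ⟨t, htF, ht⟩ := (Ideal.span_eq_top_iff_finite _).mp hspan
  choose hne s hs using fun f : t => htF f.2
  let U : t → X.Opens := fun f => X.basicOpen f.1
  have hUW : ∀ j, U j ≤ W := fun j => X.basicOpen_le _
  have hUaff : ∀ j, IsAffineOpen (U j) := fun j => hW.basicOpen _
  let ι : ∀ V : X.Opens, vectorFields k X V →ₗ[k] I.obj.obj (op V) := fun V => sapp i V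
  have hι : ∀ V, Function.Injective (ι V) := fun V => sections_injective hS V
  have hιres : ∀ {V V' : X.Opens} (h : V' ≤ V) (D : vectorFields k X V),
      ι V' (vectorFieldsRes k X h D) = sres I h (ι V D) := fun h D => sapp_sres i h D
  -- the Čech cocycle `c l j = s j - s l` of vector fields
  have hc : ∀ l j, ∃ c : vectorFields k X (U l ⊓ U j), ι _ c =
      sres I inf_le_right (s j) - sres I inf_le_left (s l) := fun l j => by
    refine sections_exact hS _ _ ?_
    change sapp p (U l ⊓ U j) (_ - _) = 0
    rw [map_sub, sapp_sres, sapp_sres, hs, hs, sres_sres, sres_sres, sub_self]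
  choose c hc using hc
  have hinter : ∀ l j, X.basicOpen (res (hUW j) l.1) = U l ⊓ U j := fun l j =>
    (X.basicOpen_res _ _).trans (inf_comm _ _)
  have hne2 : ∀ l j, ((U l ⊓ U j : X.Opens) : Set X).Nonempty := fun l j =>
    nonempty_preirreducible_inter (U l).2 (U j).2 (hne l) (hne j)
  -- `l ^ M c l j` extends from `U l ⊓ U j` to a vector field `e l j` on `U j`
  have hN : ∀ l j, ∃ N : ℕ, ∀ n ≥ N, ∃ e : vectorFields k X (U j),
      vectorFieldsRes k X (inf_le_right : U l ⊓ U j ≤ U j) e =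
        VF.smul (res (inf_le_right.trans (hUW j)) (l.1 ^ n)) (c l j) := fun l j => by
    have := finiteType_basicOpen (k := k) hW j.1
    exact VF.exists_pow_smul_of_le (hUaff j) (hUW j) l.1 (hinter l j) (hne2 l j) inf_le_right _
  choose N hN using hN
  let M : ℕ := Finset.univ.sup fun x : t × t => N x.1 x.2
  choose e he using fun l j => hN l j M (Finset.le_sup (f := fun x : t × t => N x.1 x.2)
    (Finset.mem_univ (l, j)))
  -- a partition of unity
  have hpow : Ideal.span (Set.range fun l : t => l.1 ^ M) = ⊤ := by
    have := Ideal.span_pow_eq_top (t : Set Γ(X, W)) ht M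
    rwa [Set.image_eq_range] at this
  obtain ⟨h, hh⟩ := Ideal.mem_span_range_iff_exists_fun.mp
    (show (1 : Γ(X, W)) ∈ _ from hpow ▸ Submodule.mem_top)
  have hcoc : ∀ l a b, vectorFieldsRes k X inf_le_left (e l b |> vectorFieldsRes k X
      (inf_le_right : U a ⊓ U b ≤ U b)) - vectorFieldsRes k X inf_le_left
        (e l a |> vectorFieldsRes k X (inf_le_left : U a ⊓ U b ≤ U a)) =
      vectorFieldsRes k X (inf_le_left : U a ⊓ U b ⊓ U l ≤ U a ⊓ U b)
        (VF.smul (res (inf_le_left.trans (hUW a)) (l.1 ^ M)) (c a b)) := fun l a b => by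
    have h1 := congrArg (vectorFieldsRes k X
      (le_inf inf_le_right (inf_le_left.trans inf_le_right) : U a ⊓ U b ⊓ U l ≤ U l ⊓ U b)) (he l b)
    have h2 := congrArg (vectorFieldsRes k X
      (le_inf inf_le_right (inf_le_left.trans inf_le_left) : U a ⊓ U b ⊓ U l ≤ U l ⊓ U a)) (he l a)
    refine (congrArg₂ (· - ·) h1 h2).trans ?_
    rw [VF.smul_res, VF.smul_res, VF.smul_res, res_res, res_res, res_res, ← VF.smul_sub]
    congr 1
    apply hι
    rw [map_sub, hιres, hιres, hιres, hc, hc, hc]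
    simp only [map_sub, sres_sres]
    abel
  -- the identity holds on the triple overlap, hence on `U a ⊓ U b`, as `X` is integral
  have hcoc' : ∀ l a b, vectorFieldsRes k X (inf_le_right : U a ⊓ U b ≤ U b) (e l b) -
      vectorFieldsRes k X (inf_le_left : U a ⊓ U b ≤ U a) (e l a) =
      VF.smul (res (inf_le_left.trans (hUW a)) (l.1 ^ M)) (c a b) := fun l a b => by
    apply VF.res_injective (inf_le_left : U a ⊓ U b ⊓ U l ≤ U a ⊓ U b)
      (nonempty_preirreducible_inter (U a ⊓ U b).2 (U l).2 (hne2 a b) (hne l))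
    rw [map_sub]
    exact hcoc l a b
  -- `∑ h l e l j` splits the cocycle `c`
  have hglue : ∀ a b, sres I inf_le_left (s a - ι _ (∑ l, VF.smul (res (hUW a) (h l)) (e l a))) =
      sres I (inf_le_right : U a ⊓ U b ≤ U b)
        (s b - ι _ (∑ l, VF.smul (res (hUW b) (h l)) (e l b))) := fun a b => by
    have h1 : vectorFieldsRes k X (inf_le_right : U a ⊓ U b ≤ U b)
        (∑ l, VF.smul (res (hUW b) (h l)) (e l b)) - vectorFieldsRes k X inf_le_left
        (∑ l, VF.smul (res (hUW a) (h l)) (e l a)) = c a b := by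
      rw [map_sum, map_sum, ← Finset.sum_sub_distrib]
      have h2 : ∀ l ∈ Finset.univ, vectorFieldsRes k X (inf_le_right : U a ⊓ U b ≤ U b)
          (VF.smul (res (hUW b) (h l)) (e l b)) - vectorFieldsRes k X inf_le_left
          (VF.smul (res (hUW a) (h l)) (e l a)) =
          VF.smul (res (inf_le_left.trans (hUW a) : U a ⊓ U b ≤ W) (h l * l.1 ^ M)) (c a b) := by
        intro l _
        rw [VF.smul_res, VF.smul_res, res_res, res_res, ← VF.smul_sub, hcoc', VF.smul_smul,
          map_mul]
      rw [Finset.sum_congr rfl h2, ← VF.sum_smul, ← map_sum, hh, map_one, VF.one_smul]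
    have h3 := congrArg (ι _) h1
    rw [map_sub, hιres, hιres, hc] at h3
    rw [map_sub, map_sub, sub_eq_sub_iff_sub_eq_sub, ← neg_sub, ← h3, neg_sub]
  have hcov : ∀ x ∈ W, ∃ j, x ∈ U j := by
    intro x hx
    rw [← hW.iSup_basicOpen_eq_self_iff.mpr ht] at hx
    exact Opens.mem_iSup.mp hx
  obtain ⟨y, hy⟩ := section_glue I (U := U) hUW (fun x hx => Opens.mem_iSup.mpr (hcov x hx)) _
    hglue
  refine ⟨y, section_ext Q (U := U) (fun x hx => Opens.mem_iSup.mpr (hcov x hx)) ?_⟩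
  intro j V hV hVj
  have hz : ∀ D, sapp p (U j) (ι _ D) = 0 := fun D => by
    have := congrArg (fun φ => sapp φ (U j) D) w
    exact this
  have h1 := congrArg (sapp p (U j)) (hy j)
  rw [sapp_sres, map_sub, hz, hs, sub_zero] at h1
  have h2 := congrArg (sres Q hVj) h1
  rwa [sres_sres, sres_sres] at h2

end AlgGeom

/-! ### Functions on an integral scheme as elements of the function field -/

namespace AlgGeom

section FunctionField

variable {Y : Scheme.{u}} [IsIntegral Y]

/-- A function on an open subset containing the generic point, as a rational function. -/
def gen (V : Y.Opens) (hV : genericPoint Y ∈ V) : Γ(Y, V) →+* Y.functionField :=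
  (Y.presheaf.germ V (genericPoint Y) hV).hom

lemma gen_res {V W : Y.Opens} (h : V ≤ W) (hV : genericPoint Y ∈ V) (f : Γ(Y, W)) :
    gen V hV (res h f) = gen W (h hV) f :=
  congrArg (fun φ => φ.hom f) (Y.presheaf.germ_res (homOfLE h) _ hV)

lemma gen_injective {V : Y.Opens} (hV : genericPoint Y ∈ V) :
    Function.Injective (gen V hV) := germ_injective_of_isIntegral _ _ _

lemma genericPoint_mem_iff (V : Y.Opens) : genericPoint Y ∈ V ↔ (V : Set Y).Nonempty :=
  ⟨fun h => ⟨_, h⟩, fun h =>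
    ((genericPoint_spec Y).mem_open_set_iff V.isOpen).mpr (by simpa using h)⟩

lemma genericPoint_mem {V : Y.Opens} {y : Y} (hy : y ∈ V) : genericPoint Y ∈ V :=
  (genericPoint_mem_iff V).mpr ⟨y, hy⟩

lemma sections_eq_of_not_mem {V : Y.Opens} (hV : genericPoint Y ∉ V) (f g : Γ(Y, V)) : f = g :=
  sections_ext (ι := Empty) (U := Empty.elim) (fun _ hx => (hV (genericPoint_mem hx)).elim)
    (fun i => i.elim)

/-- Functions on `V` are determined by the associated rational functions. -/
lemma gen_ext {V : Y.Opens} {f g : Γ(Y, V)} (h : ∀ hV, gen V hV f = gen V hV g) : f = g := by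
  by_cases hV : genericPoint Y ∈ V
  · exact gen_injective hV (h hV)
  · exact sections_eq_of_not_mem hV f g

/-- The rational function `κ` is regular on `V`; for empty `V` there is no condition. -/
def Reg (V : Y.Opens) (κ : Y.functionField) : Prop :=
  ∀ hV : genericPoint Y ∈ V, ∃ a : Γ(Y, V), gen V hV a = κ

lemma Reg.mono {V W : Y.Opens} {κ : Y.functionField} (h : Reg W κ) (hVW : V ≤ W) : Reg V κ := by
  intro hV
  obtain ⟨a, ha⟩ := h (hVW hV)
  exact ⟨res hVW a, (gen_res hVW hV a).trans ha⟩

lemma Reg.mul {V : Y.Opens} {κ κ' : Y.functionField} (h : Reg V κ) (h' : Reg V κ') :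
    Reg V (κ * κ') := by
  intro hV
  obtain ⟨a, ha⟩ := h hV
  obtain ⟨a', ha'⟩ := h' hV
  exact ⟨a * a', by rw [map_mul, ha, ha']⟩

lemma Reg.pow {V : Y.Opens} {κ : Y.functionField} (h : Reg V κ) (n : ℕ) : Reg V (κ ^ n) := by
  intro hV
  obtain ⟨a, ha⟩ := h hV
  exact ⟨a ^ n, by rw [map_pow, ha]⟩

/-- Regularity is a local condition. -/
lemma Reg.of_cover {V : Y.Opens} {κ : Y.functionField}
    (h : ∀ y ∈ V, ∃ W : Y.Opens, y ∈ W ∧ Reg (V ⊓ W) κ) : Reg V κ := by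
  intro hV
  choose W hyW hW using fun y : V => h y.1 y.2
  have hη : ∀ y : V, genericPoint Y ∈ V ⊓ W y := fun y => genericPoint_mem ⟨y.2, hyW y⟩
  choose a ha using fun y : V => hW y (hη y)
  obtain ⟨b, hb⟩ := sections_glue (U := fun y : V => V ⊓ W y) (V := V) (fun y => inf_le_left)
    (fun x hx => ⟨⟨x, hx⟩, hx, hyW ⟨x, hx⟩⟩) a (fun y z => by
      refine gen_ext fun h => ?_
      rw [gen_res, gen_res, ha, ha])
  refine ⟨b, ?_⟩
  have y : V := ⟨_, hV⟩
  rw [← ha y, ← hb y, gen_res]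

lemma isUnit_res_basicOpen {X : Scheme.{u}} {V W : X.Opens} (f : Γ(X, W)) (h : V ≤ W)
    (hV : V ≤ X.basicOpen f) : IsUnit (res h f) := by
  have h1 : IsUnit (res (X.basicOpen_le f) f) := X.toRingedSpace.isUnit_res_basicOpen f
  have h2 := h1.map (res hV)
  rwa [res_res] at h2

lemma le_basicOpen_of_isUnit {X : Scheme.{u}} {V W : X.Opens} (f : Γ(X, W)) (h : V ≤ W)
    (hu : IsUnit (res h f)) : V ≤ X.basicOpen f := by
  have := X.basicOpen_of_isUnit hu
  rw [X.basicOpen_res] at this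
  exact this ▸ inf_le_right

end FunctionField

/-! ### Sections of line bundles -/

namespace LineBundle

variable {k : Type u} [Field k] {Y : Scheme.{u}} (L : LineBundle Y) [Y.Over (Spec (.of k))]

lemma exists_mem_V (y : Y) : ∃ i, y ∈ L.V i := by
  have : y ∈ ⨆ i, L.V i := L.iSup_V ▸ Opens.mem_top y
  exact Opens.mem_iSup.mp this

lemma mem_nonvanishing {m : ℕ} (s : L.sections k m) (y : Y) :
    y ∈ L.nonvanishing k s ↔ ∃ i, y ∈ Y.basicOpen (s.1 i) := Opens.mem_iSup

lemma nonvanishing_inf_V {m : ℕ} (s : L.sections k m) (i : L.ι) :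
    L.nonvanishing k s ⊓ L.V i = Y.basicOpen (s.1 i) := by
  refine le_antisymm ?_ (le_inf (le_iSup (fun i => Y.basicOpen (s.1 i)) i) (Y.basicOpen_le _))
  rintro y ⟨hy, hi⟩
  obtain ⟨j, hj⟩ := (L.mem_nonvanishing s y).mp hy
  have hjV := Y.basicOpen_le _ hj
  have h1 : y ∈ Y.basicOpen (res (inf_le_right : L.V i ⊓ L.V j ≤ L.V j) (s.1 j)) := by
    rw [Y.basicOpen_res]
    exact ⟨⟨hi, hjV⟩, hj⟩
  have h2 : y ∈ Y.basicOpen (res (inf_le_left : L.V i ⊓ L.V j ≤ L.V i) (s.1 i)) := by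
    rw [s.2 i j, Y.basicOpen_mul]
    exact ⟨(Y.basicOpen_of_isUnit ((L.g i j).isUnit.pow m)).ge ⟨hi, hjV⟩, h1⟩
  rw [Y.basicOpen_res] at h2
  exact h2.2

lemma isUnit_res_of_le_nonvanishing {m : ℕ} (s : L.sections k m) {i : L.ι} {V : Y.Opens}
    (hi : V ≤ L.V i) (hs : V ≤ L.nonvanishing k s) : IsUnit (res hi (s.1 i)) :=
  isUnit_res_basicOpen _ _ ((le_inf hs hi).trans (L.nonvanishing_inf_V s i).le)

/-- The product of sections of powers of a line bundle. -/
def mulSec {m n : ℕ} (s : L.sections k m) (s' : L.sections k n) : L.sections k (m + n) :=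
  ⟨s.1 * s'.1, L.mul_mem_sections k s.2 s'.2⟩

lemma nonvanishing_mulSec {m n : ℕ} (s : L.sections k m) (s' : L.sections k n) :
    L.nonvanishing k (L.mulSec s s') = L.nonvanishing k s ⊓ L.nonvanishing k s' := by
  ext y
  obtain ⟨i, hi⟩ := L.exists_mem_V y
  have key : ∀ {m : ℕ} (s : L.sections k m), y ∈ L.nonvanishing k s ↔ y ∈ Y.basicOpen (s.1 i) :=
    fun s => by
      rw [← L.nonvanishing_inf_V]
      exact ⟨fun h => ⟨h, hi⟩, fun h => h.1⟩
  have h1 := key (L.mulSec s s')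
  have h2 := key s
  have h3 := key s'
  change y ∈ L.nonvanishing k (L.mulSec s s') ↔ y ∈ L.nonvanishing k s ∧ y ∈ L.nonvanishing k s'
  rw [h1, h2, h3]
  change y ∈ Y.basicOpen (s.1 i * s'.1 i) ↔ _
  rw [Y.basicOpen_mul]
  rfl

variable [IsIntegral Y]

open Classical in
/-- The transition functions as rational functions; the value is `1` when one of the two open
subsets is empty. -/
def G (i j : L.ι) : Y.functionFieldˣ :=
  if h : genericPoint Y ∈ L.V i ⊓ L.V j then Units.map (gen _ h : _ →* _) (L.g i j) else 1

lemma G_eq {i j : L.ι} (h : genericPoint Y ∈ L.V i ⊓ L.V j) :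
    L.G i j = Units.map (gen _ h : _ →* _) (L.g i j) := dif_pos h

lemma G_mul {i j l : L.ι} (hi : genericPoint Y ∈ L.V i) (hj : genericPoint Y ∈ L.V j)
    (hl : genericPoint Y ∈ L.V l) : L.G i j * L.G j l = L.G i l := by
  rw [L.G_eq ⟨hi, hj⟩, L.G_eq ⟨hj, hl⟩, L.G_eq ⟨hi, hl⟩]
  ext
  have := congrArg (gen _ (show genericPoint Y ∈ L.V i ⊓ L.V j ⊓ L.V l from ⟨⟨hi, hj⟩, hl⟩))
    (L.cocycle i j l)
  rw [map_mul, gen_res, gen_res, gen_res] at this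
  exact this

lemma G_self {i : L.ι} (hi : genericPoint Y ∈ L.V i) : L.G i i = 1 :=
  mul_left_cancel ((L.G_mul hi hi hi).trans (mul_one _).symm)

lemma reg_G_zpow (i j : L.ι) (n : ℤ) {V : Y.Opens} (hV : V ≤ L.V i ⊓ L.V j) :
    Reg V ((L.G i j ^ n : Y.functionFieldˣ) : Y.functionField) := by
  intro h
  refine ⟨res hV ((L.g i j ^ n : Γ(Y, _)ˣ) : Γ(Y, L.V i ⊓ L.V j)), ?_⟩
  rw [gen_res, L.G_eq (hV h), ← map_zpow]
  rfl

lemma gen_section {m : ℕ} (s : L.sections k m) {i j : L.ι} (hi : genericPoint Y ∈ L.V i)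
    (hj : genericPoint Y ∈ L.V j) :
    gen _ hi (s.1 i) = (L.G i j : Y.functionField) ^ m * gen _ hj (s.1 j) := by
  have h : genericPoint Y ∈ L.V i ⊓ L.V j := ⟨hi, hj⟩
  have := congrArg (gen (L.V i ⊓ L.V j) h) (s.2 i j)
  rw [map_mul, map_pow, gen_res, gen_res] at this
  rw [this, L.G_eq h]
  rfl

/-- Sections of `L ^ n` from compatible families of regular rational functions. -/
lemma exists_section_of_reg (n : ℕ) (ρ : L.ι → Y.functionField)
    (hρ : ∀ i j, genericPoint Y ∈ L.V i → genericPoint Y ∈ L.V j →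
      ρ i = (L.G i j : Y.functionField) ^ n * ρ j)
    (hreg : ∀ i, Reg (L.V i) (ρ i)) :
    ∃ r : L.sections k n, ∀ i (hi : genericPoint Y ∈ L.V i), gen _ hi (r.1 i) = ρ i := by
  have : ∀ i, ∃ a : Γ(Y, L.V i), ∀ hi, gen _ hi a = ρ i := fun i => by
    by_cases hi : genericPoint Y ∈ L.V i
    · obtain ⟨a, ha⟩ := hreg i hi
      exact ⟨a, fun _ => ha⟩
    · exact ⟨0, fun h => (hi h).elim⟩
  choose r hr using this
  refine ⟨⟨r, fun i j => gen_ext fun h => ?_⟩, hr⟩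
  rw [map_mul, map_pow, gen_res, gen_res, hr, hr, hρ i j h.1 h.2, L.G_eq h]
  rfl

/-- A section of `L ^ n` over the nonvanishing locus of a section `s` of `L ^ m` extends to a
global section of `L ^ (n + N m)` after multiplication with `s ^ N`, for all large `N`. -/
lemma exists_extension [CompactSpace Y] {m : ℕ} (s : L.sections k m)
    (hs : genericPoint Y ∈ L.nonvanishing k s) (n : ℤ) (ρ : L.ι → Y.functionField)
    (hρ : ∀ i j, genericPoint Y ∈ L.V i → genericPoint Y ∈ L.V j →
      ρ i = ((L.G i j ^ n : Y.functionFieldˣ) : Y.functionField) * ρ j)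
    (hreg : ∀ i, Reg (L.nonvanishing k s ⊓ L.V i) (ρ i)) :
    ∃ N : ℕ, ∀ N' ≥ N, ∀ l : ℕ, (l : ℤ) = n + N' * m → ∃ r : L.sections k l,
      ∀ i (hi : genericPoint Y ∈ L.V i), gen _ hi (r.1 i) = ρ i * gen _ hi (s.1 i) ^ N' := by
  -- near every point a power of `s` clears the denominators of `ρ j`, and a finite number of
  -- neighbourhoods suffices
  have hloc : ∀ y : Y, ∃ (j : L.ι) (W : Y.Opens) (N : ℕ), y ∈ W ∧ W ≤ L.V j ∧
      ∀ N' ≥ N, ∀ hj : genericPoint Y ∈ L.V j, Reg W (ρ j * gen _ hj (s.1 j) ^ N') := by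
    intro y
    obtain ⟨j, hj⟩ := L.exists_mem_V y
    obtain ⟨_, ⟨W, hW, rfl⟩, hyW, hWj⟩ :=
      Y.isBasis_affineOpens.exists_subset_of_mem_open hj (L.V j).2
    replace hyW : y ∈ W := hyW
    replace hWj : W ≤ L.V j := hWj
    have hηW : genericPoint Y ∈ W := genericPoint_mem hyW
    have hηj : genericPoint Y ∈ L.V j := hWj hηW
    let f : Γ(Y, W) := res hWj (s.1 j)
    have hf : Y.basicOpen f ≤ L.nonvanishing k s ⊓ L.V j := by
      rw [L.nonvanishing_inf_V, Y.basicOpen_res]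
      exact inf_le_right
    have hηf : genericPoint Y ∈ Y.basicOpen f := by
      rw [Y.basicOpen_res, ← L.nonvanishing_inf_V]
      exact ⟨hηW, hs, hηj⟩
    obtain ⟨a, ha⟩ := (hreg j).mono hf hηf
    have := hW.isLocalization_basicOpen f
    obtain ⟨N, b, hb⟩ := IsLocalization.Away.surj f a
    have hb' : Reg W (ρ j * gen _ hηj (s.1 j) ^ N) := by
      intro h
      refine ⟨b, ?_⟩
      have := congrArg (gen _ hηf) hb
      change gen _ hηf (a * (res _ f) ^ N) = gen _ hηf (res _ b) at this
      rw [map_mul, map_pow, gen_res, gen_res, gen_res, ha] at this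
      exact this.symm
    refine ⟨j, W, N, hyW, hWj, fun N' hN' hj' => ?_⟩
    have hσ : Reg W (gen _ hj' (s.1 j)) := fun h => ⟨res hWj (s.1 j), gen_res _ _ _⟩
    have := hb'.mul (hσ.pow (N' - N))
    rwa [mul_assoc, ← pow_add, Nat.add_sub_cancel' hN'] at this
  choose j W N hyW hWj hN using hloc
  obtain ⟨t, ht⟩ := isCompact_univ.elim_finite_subcover (fun y : Y => (W y : Set Y))
    (fun y => (W y).2) (fun y _ => Set.mem_iUnion.mpr ⟨y, hyW y⟩)
  refine ⟨t.sup N, fun N' hN' l hl => ?_⟩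
  -- the functions `ρ i * s i ^ N'` change from one trivialisation to another like sections of
  -- `L ^ l`
  have hpow : ∀ i i', genericPoint Y ∈ L.V i → genericPoint Y ∈ L.V i' → ∀ hi hi',
      ρ i * gen _ hi (s.1 i) ^ N' =
        ((L.G i i' ^ (l : ℤ) : Y.functionFieldˣ) : Y.functionField) *
          (ρ i' * gen _ hi' (s.1 i') ^ N') := by
    intro i i' h h' hi hi'
    rw [hρ i i' h h', L.gen_section s hi hi', hl, zpow_add, mul_comm (N' : ℤ), zpow_mul,
      zpow_natCast, zpow_natCast]
    push_cast
    ring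
  classical
  obtain ⟨r, hr⟩ := L.exists_section_of_reg (k := k) l
    (fun i => if hi : genericPoint Y ∈ L.V i then ρ i * gen _ hi (s.1 i) ^ N' else 0)
    (fun i i' hi hi' => by
      rw [dif_pos hi, dif_pos hi', hpow i i' hi hi' hi hi', zpow_natCast, Units.val_pow_eq_pow_val])
    (fun i => by
      refine Reg.of_cover fun y hy => ?_
      obtain ⟨z, hz, hyz⟩ := Set.mem_iUnion₂.mp (ht (Set.mem_univ y))
      refine ⟨W z, hyz, fun h => ?_⟩
      have hj' : genericPoint Y ∈ L.V (j z) := hWj z h.2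
      have hi : genericPoint Y ∈ L.V i := h.1
      rw [dif_pos hi, hpow i (j z) hi hj' hi hj']
      exact ((L.reg_G_zpow i (j z) l (inf_le_inf_left _ (hWj z))).mul
        ((hN z N' ((Finset.le_sup hz).trans hN') hj').mono inf_le_right)) h)
  refine ⟨r, fun i hi => ?_⟩
  rw [hr i hi, dif_pos hi]

variable (k) in
/-- The charts used to describe the punctured cone: the nonempty affine open subsets of the form
`Y_s`, where `s` is a section of a positive power of `L` and `L` is trivialised on `Y_s`. -/
structure Chart where
  /-- the degree of the section -/
  m : ℕ
  m_pos : 0 < m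
  /-- the section -/
  s : L.sections k m
  /-- the index of a trivialisation -/
  i : L.ι
  isAffineOpen : IsAffineOpen (L.nonvanishing k s)
  le_V : L.nonvanishing k s ≤ L.V i
  genericPoint_mem : genericPoint Y ∈ L.nonvanishing k s

/-- The open subset `Y_s` of a chart. -/
abbrev Chart.dom {L : LineBundle Y} (b : L.Chart k) : Y.Opens := L.nonvanishing k b.s

/-- The charts form a basis of the topology. -/
lemma exists_chart [CompactSpace Y] (hL : L.IsAmple k) {V : Y.Opens} {i : L.ι} (hV : V ≤ L.V i)
    {y : Y} (hy : y ∈ V) : ∃ b : L.Chart k, b.i = i ∧ y ∈ b.dom ∧ b.dom ≤ V := by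
  obtain ⟨m, hm, s, hys, haff⟩ := hL y
  have hηs := AlgGeom.genericPoint_mem hys
  obtain ⟨h, hh, hyh⟩ := haff.exists_basicOpen_le (V := V) ⟨y, hy⟩ hys
  -- `D(h)` is contained in `V`, and `r = h s ^ N` extends to a section with `Y_{rs} = D(h)`
  obtain ⟨N, hN⟩ := L.exists_extension s hηs 0 (fun _ => gen _ hηs h)
    (fun i j _ _ => by simp) (fun i hη => ⟨res inf_le_left h, gen_res _ _ _⟩)
  obtain ⟨r, hr⟩ := hN N le_rfl (N * m) (by simp)
  have hres : ∀ j, res (inf_le_right : L.nonvanishing k s ⊓ L.V j ≤ L.V j) (r.1 j) =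
      res inf_le_left h * res (inf_le_right : L.nonvanishing k s ⊓ L.V j ≤ L.V j) (s.1 j) ^ N := by
    intro j
    refine gen_ext fun hη => ?_
    rw [map_mul, map_pow, gen_res, gen_res, gen_res, hr]
  have hunit : ∀ j, IsUnit (res (inf_le_right : L.nonvanishing k s ⊓ L.V j ≤ L.V j) (s.1 j)) :=
    fun j => L.isUnit_res_of_le_nonvanishing s _ inf_le_left
  have e : L.nonvanishing k (L.mulSec r s) = Y.basicOpen h := by
    rw [nonvanishing_mulSec]
    ext z
    obtain ⟨j, hj⟩ := L.exists_mem_V z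
    have h1 : Y.basicOpen (res (inf_le_right : L.nonvanishing k s ⊓ L.V j ≤ L.V j) (r.1 j)) =
        Y.basicOpen (res (inf_le_left : L.nonvanishing k s ⊓ L.V j ≤ L.nonvanishing k s) h) := by
      rw [hres, Y.basicOpen_mul, Y.basicOpen_of_isUnit ((hunit j).pow N)]
      exact inf_eq_left.mpr (Y.basicOpen_le _)
    rw [Y.basicOpen_res, Y.basicOpen_res, ← L.nonvanishing_inf_V] at h1
    constructor
    · rintro ⟨hz1, hz2⟩
      exact (h1.le ⟨⟨hz2, hj⟩, hz1, hj⟩).2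
    · intro hz
      have hzs := Y.basicOpen_le _ hz
      exact ⟨(h1.ge ⟨⟨hzs, hj⟩, hz⟩).2.1, hzs⟩
  exact ⟨⟨N * m + m, by omega, L.mulSec r s, i, e ▸ haff.basicOpen h, e.le.trans (hh.trans hV),
    AlgGeom.genericPoint_mem (e.ge hyh)⟩, rfl, e.ge hyh, e.le.trans hh⟩

end LineBundle

end AlgGeom

/-! ### Localizations of the section ring -/

namespace AlgGeom

namespace LineBundle

open LaurentPolynomial

variable {k : Type u} [Field k] {Y : Scheme.{u}} {L : LineBundle Y} [Y.Over (Spec (.of k))]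

lemma coeff_mem (p : L.SectionRing k) (n : ℕ) : L.coeff k n p ∈ L.sections k n := p.2 n

variable (k L) in
/-- The section ring as a subring of a polynomial ring. -/
def polyHom : L.SectionRing k →+* Polynomial (∀ i, Γ(Y, L.V i)) :=
  ((L.sectionSubalgebra k).val : L.sectionSubalgebra k →+* _)

lemma polyHom_injective : Function.Injective (L.polyHom k) := Subtype.val_injective

lemma polyHom_homog (m : ℕ) (s : L.sections k m) :
    L.polyHom k (L.homog k m s) = Polynomial.monomial m s.1 := rfl

lemma sum_homog (p : L.SectionRing k) :
    p = ∑ n ∈ (L.polyHom k p).support, L.homog k n ⟨L.coeff k n p, coeff_mem p n⟩ := by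
  apply polyHom_injective
  rw [map_sum]
  exact Polynomial.as_sum_support (L.polyHom k p)

/-- Ring homomorphisms from the section ring are determined by their values on homogeneous
elements. -/
lemma ringHom_ext_homog {R : Type*} [Semiring R] {φ ψ : L.SectionRing k →+* R}
    (h : ∀ n s, φ (L.homog k n s) = ψ (L.homog k n s)) : φ = ψ := by
  ext p
  rw [sum_homog p, map_sum, map_sum]
  exact Finset.sum_congr rfl fun n _ => h n _

variable (k) in
/-- Restriction of the sections of the powers of `L` to an open subset on which `L` is trivialised:
the ring homomorphism from `S` to the ring of Laurent polynomials in one variable `T` which maps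
`s` of degree `m` to `s T ^ m`. -/
def ev (i : L.ι) {V : Y.Opens} (h : V ≤ L.V i) : L.SectionRing k →+* Γ(Y, V)[T;T⁻¹] :=
  ((Polynomial.toLaurent (R := Γ(Y, V))).comp
    (Polynomial.mapRingHom ((res h).comp (Pi.evalRingHom (fun j => Γ(Y, L.V j)) i)))).comp
    (L.polyHom k)

lemma ev_homog (i : L.ι) {V : Y.Opens} (h : V ≤ L.V i) (m : ℕ) (s : L.sections k m) :
    ev k i h (L.homog k m s) = C (res h (s.1 i)) * T m := by
  rw [ev, RingHom.comp_apply, polyHom_homog, RingHom.comp_apply, Polynomial.coe_mapRingHom,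
    Polynomial.map_monomial, Polynomial.toLaurent_C_mul_T]
  rfl

lemma algebraMap_eq_homog (c : k) :
    algebraMap k (L.SectionRing k) c = L.homog k 0 ⟨c • 1, Submodule.smul_mem _ _
      (L.one_mem_sections k)⟩ := by
  apply Subtype.ext
  change Polynomial.C (algebraMap k (∀ i, Γ(Y, L.V i)) c) = Polynomial.monomial 0 (c • 1)
  rw [Polynomial.monomial_zero_left, Algebra.algebraMap_eq_smul_one]

lemma ev_algebraMap (i : L.ι) {V : Y.Opens} (h : V ≤ L.V i) (c : k) :
    ev k i h (algebraMap k (L.SectionRing k) c) = C (algebraMap k Γ(Y, V) c) := by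
  rw [algebraMap_eq_homog, ev_homog]
  simp only [Pi.smul_apply, Pi.one_apply, res_smul, map_one, Nat.cast_zero, T_zero, mul_one]
  rw [Algebra.algebraMap_eq_smul_one]

variable [IsIntegral Y]

/-- A function on the domain of a chart, multiplied with a power of the section defining the chart,
extends to a global section of a power of `L`. -/
lemma exists_section_on_chart [CompactSpace Y] (b : L.Chart k) (n : ℤ) (a : Γ(Y, b.dom)) :
    ∃ N : ℕ, ∀ N' ≥ N, ∀ l : ℕ, (l : ℤ) = n + N' * b.m → ∃ r : L.sections k l,
      res b.le_V (r.1 b.i) = a * res b.le_V (b.s.1 b.i) ^ N' := by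
  have hη := b.genericPoint_mem
  have hi := b.le_V hη
  obtain ⟨N, hN⟩ := L.exists_extension b.s hη n
    (fun j => ((L.G j b.i ^ n : Y.functionFieldˣ) : Y.functionField) * gen _ hη a)
    (fun i j h h' => by
      rw [← L.G_mul h h' hi, mul_zpow, Units.val_mul, mul_assoc])
    (fun j => ((L.reg_G_zpow j b.i n (le_inf inf_le_right (inf_le_left.trans b.le_V))).mul
      (Reg.mono (fun _ => ⟨a, rfl⟩) inf_le_left)))
  refine ⟨N, fun N' hN' l hl => ?_⟩
  obtain ⟨r, hr⟩ := hN N' hN' l hl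
  refine ⟨r, gen_injective hη ?_⟩
  rw [gen_res, hr, map_mul, map_pow, gen_res, L.G_self hi, one_zpow, Units.val_one, one_mul]

/-- The localization map `S → A[T, T⁻¹]` of a chart, where `A` is the ring of functions of the
chart. -/
abbrev Chart.ev (b : L.Chart k) : L.SectionRing k →+* Γ(Y, b.dom)[T;T⁻¹] :=
  LineBundle.ev k b.i b.le_V

/-- The element of the section ring defining a chart. -/
def Chart.elt (b : L.Chart k) : L.SectionRing k := L.homog k b.m b.s

lemma Chart.isUnit_section (b : L.Chart k) : IsUnit (res b.le_V (b.s.1 b.i)) :=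
  L.isUnit_res_of_le_nonvanishing _ _ le_rfl

lemma Chart.ev_elt (b : L.Chart k) : b.ev b.elt = C (res b.le_V (b.s.1 b.i)) * T b.m :=
  ev_homog _ _ _ _

lemma Chart.isUnit_ev_elt (b : L.Chart k) : IsUnit (b.ev b.elt) := by
  rw [b.ev_elt]
  exact (b.isUnit_section.map C).mul (isUnit_T _)

/-- Every Laurent polynomial over the ring of functions of the chart `Y_s` lies in the section ring
after multiplication by a power of `s`. -/
lemma Chart.exists_ev_eq [CompactSpace Y] (b : L.Chart k) (x : Γ(Y, b.dom)[T;T⁻¹]) :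
    ∃ N, ∀ N' ≥ N, ∃ r, x * b.ev b.elt ^ N' = b.ev r := by
  induction x using LaurentPolynomial.induction_on' with
  | add p q hp hq =>
    obtain ⟨N, hN⟩ := hp
    obtain ⟨M, hM⟩ := hq
    refine ⟨max N M, fun N' hN' => ?_⟩
    obtain ⟨r, hr⟩ := hN N' (le_of_max_le_left hN')
    obtain ⟨r', hr'⟩ := hM N' (le_of_max_le_right hN')
    exact ⟨r + r', by rw [add_mul, hr, hr', map_add]⟩
  | C_mul_T n a =>
    obtain ⟨N, hN⟩ := exists_section_on_chart b n a
    refine ⟨max N n.natAbs, fun N' hN' => ?_⟩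
    have h0 : 0 ≤ n + N' * b.m := by
      have h1 := b.m_pos
      have h2 : n.natAbs ≤ N' := le_of_max_le_right hN'
      have h3 : N' ≤ N' * b.m := Nat.le_mul_of_pos_right _ h1
      have h4 : ((N' * b.m : ℕ) : ℤ) = N' * b.m := Nat.cast_mul _ _
      omega
    obtain ⟨l, hl⟩ := Int.eq_ofNat_of_zero_le h0
    obtain ⟨r, hr⟩ := hN N' (le_of_max_le_left hN') l hl.symm
    refine ⟨L.homog k l r, ?_⟩
    have hl' : (l : ℤ) = n + N' * b.m := hl.symm
    rw [b.ev_elt, ev_homog, hr, mul_pow, T_pow, hl', T_add, map_mul, map_pow]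
    ring

/-! ### The punctured cone at its generic point -/

/-- The field of fractions of `K[X]`, where `K` is the function field of `Y`; it is the function
field of the cone. -/
abbrev ConeField (Y : Scheme.{u}) [IsIntegral Y] : Type u :=
  FractionRing (Polynomial Y.functionField)

lemma exists_genericPoint_mem (L : LineBundle Y) : ∃ i, genericPoint Y ∈ L.V i :=
  L.exists_mem_V _

/-- The index of an open subset of the trivialising cover which contains the generic point. -/
def i₀ (L : LineBundle Y) : L.ι := L.exists_genericPoint_mem.choose

lemma genericPoint_mem_i₀ (L : LineBundle Y) : genericPoint Y ∈ L.V L.i₀ :=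
  L.exists_genericPoint_mem.choose_spec

variable (k) in
/-- The section ring as a subring of `K[X]`, by means of a frame of `L` at the generic point. -/
def genEval (L : LineBundle Y) : L.SectionRing k →+* Polynomial Y.functionField :=
  (Polynomial.mapRingHom
    ((gen _ L.genericPoint_mem_i₀).comp (Pi.evalRingHom (fun j => Γ(Y, L.V j)) L.i₀))).comp
    (L.polyHom k)

lemma genEval_homog (m : ℕ) (s : L.sections k m) : L.genEval k (L.homog k m s) =
    Polynomial.monomial m (gen _ L.genericPoint_mem_i₀ (s.1 L.i₀)) := by
  rw [genEval, RingHom.comp_apply, polyHom_homog, Polynomial.coe_mapRingHom,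
    Polynomial.map_monomial]
  rfl

lemma genEval_injective : Function.Injective (L.genEval k) := by
  rw [injective_iff_map_eq_zero]
  intro p hp
  refine L.ext_coeff k fun m => ?_
  have h1 : gen _ L.genericPoint_mem_i₀ (L.coeff k m p L.i₀) = 0 := by
    have := congrArg (fun q => Polynomial.coeff q m) hp
    exact (Polynomial.coeff_map (p := L.polyHom k p) _ m).symm.trans this
  funext j
  refine gen_ext fun hj => ?_
  have := L.gen_section ⟨_, coeff_mem p m⟩ hj L.genericPoint_mem_i₀
  change gen _ hj (L.coeff k m p j) = _ at this
  rw [this, h1, mul_zero, map_zero]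
  exact (map_zero _).symm

variable (k) in
/-- The section ring as a subring of the function field of the cone. -/
def toConeField (L : LineBundle Y) : L.SectionRing k →+* ConeField Y :=
  (algebraMap (Polynomial Y.functionField) (ConeField Y)).comp (L.genEval k)

lemma toConeField_injective : Function.Injective (L.toConeField k) :=
  (IsFractionRing.injective _ _).comp genEval_injective

instance : IsDomain (L.SectionRing k) := toConeField_injective.isDomain (L.toConeField k)

/-- The inclusion of the function field of `Y` in that of the cone. -/
def fieldIncl (Y : Scheme.{u}) [IsIntegral Y] : Y.functionField →+* ConeField Y :=
  (algebraMap (Polynomial Y.functionField) (ConeField Y)).comp Polynomial.C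

/-- The coordinate `T` of a chart as an element of the function field of the cone. -/
def coneCoord (i : L.ι) : (ConeField Y)ˣ :=
  Units.map (fieldIncl Y : _ →* _) (L.G L.i₀ i) *
    Units.mk0 (algebraMap (Polynomial Y.functionField) (ConeField Y) Polynomial.X)
      (by simp)

/-- The ring of functions on a chart of the punctured cone as a subring of the function field. -/
def Chart.toConeField (b : L.Chart k) : Γ(Y, b.dom)[T;T⁻¹] →+* ConeField Y :=
  eval₂ ((fieldIncl Y).comp (gen _ b.genericPoint_mem)) (coneCoord b.i)

lemma Chart.toConeField_C_mul_T (b : L.Chart k) (a : Γ(Y, b.dom)) (n : ℤ) :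
    b.toConeField (C a * T n) = fieldIncl Y (gen _ b.genericPoint_mem a) *
      ((coneCoord b.i ^ n : (ConeField Y)ˣ) : ConeField Y) :=
  eval₂_C_mul_T _ _ _ _

lemma Chart.toConeField_C (b : L.Chart k) (a : Γ(Y, b.dom)) :
    b.toConeField (C a) = fieldIncl Y (gen _ b.genericPoint_mem a) := by
  have := b.toConeField_C_mul_T a 0
  rwa [T_zero, mul_one, zpow_zero, Units.val_one, mul_one] at this

lemma Chart.toConeField_comp_ev (b : L.Chart k) : b.toConeField.comp b.ev = L.toConeField k := by
  refine ringHom_ext_homog fun m s => ?_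
  rw [RingHom.comp_apply, ev_homog, b.toConeField_C_mul_T, gen_res, LineBundle.toConeField,
    RingHom.comp_apply, genEval_homog,
    L.gen_section s L.genericPoint_mem_i₀ (b.le_V b.genericPoint_mem), zpow_natCast, coneCoord,
    mul_pow, Units.val_mul, Units.val_pow_eq_pow_val, Units.val_pow_eq_pow_val, Units.val_mk0,
    ← Polynomial.C_mul_X_pow_eq_monomial, map_mul, map_pow, map_mul, map_mul, map_pow,
    map_pow]
  simp only [fieldIncl, Units.coe_map, MonoidHom.coe_coe, RingHom.comp_apply]
  ring_nf

lemma Chart.ev_injective (b : L.Chart k) : Function.Injective b.ev := by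
  have : Function.Injective (b.toConeField.comp b.ev) := by
    rw [b.toConeField_comp_ev]
    exact toConeField_injective
  rw [RingHom.coe_comp] at this
  exact this.of_comp

/-- The ring of Laurent polynomials over the ring of functions of a chart is a localization of the
section ring. -/
lemma Chart.isLocalization [CompactSpace Y] (b : L.Chart k) :
    letI := b.ev.toAlgebra
    IsLocalization.Away b.elt Γ(Y, b.dom)[T;T⁻¹] := by
  let := b.ev.toAlgebra
  refine IsLocalization.Away.mk _ b.isUnit_ev_elt (fun x => ?_) fun r r' h => ⟨0, ?_⟩
  · obtain ⟨N, hN⟩ := b.exists_ev_eq x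
    exact ⟨N, hN N le_rfl⟩
  · rw [b.ev_injective h]

lemma Chart.toConeField_injective [CompactSpace Y] (b : L.Chart k) :
    Function.Injective b.toConeField := by
  rw [injective_iff_map_eq_zero]
  intro x hx
  obtain ⟨N, hN⟩ := b.exists_ev_eq x
  obtain ⟨r, hr⟩ := hN N le_rfl
  have h1 := congrArg b.toConeField hr
  rw [map_mul, hx, zero_mul, ← RingHom.comp_apply, b.toConeField_comp_ev] at h1
  rw [LineBundle.toConeField_injective (h1.symm.trans (map_zero _).symm), map_zero] at hr
  exact (b.isUnit_ev_elt.pow N).mul_left_eq_zero.mp hr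

end LineBundle

end AlgGeom

/-! ### The charts cover the punctured cone -/

namespace AlgGeom

lemma fromSpec_over (k : Type u) [Field k] {X : Scheme.{u}} [X.Over (Spec (.of k))] {W : X.Opens}
    (hW : IsAffineOpen W) :
    hW.fromSpec ≫ (X ↘ Spec (.of k)) = Spec.map (CommRingCat.ofHom (algebraMap k Γ(X, W))) := by
  rw [← IsAffineOpen.SpecMap_appLE_fromSpec (X ↘ Spec (.of k)) (isAffineOpen_top _) hW le_top,
    IsAffineOpen.fromSpec_top, Scheme.isoSpec_Spec_inv, ← Spec.map_comp]
  rfl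

namespace LineBundle

open LaurentPolynomial

variable {k : Type u} [Field k] {Y : Scheme.{u}} {L : LineBundle Y} [Y.Over (Spec (.of k))]

/-- A section of a positive power of `L` which does not lie in the homogeneous prime ideal of
a point of the punctured cone. -/
lemma exists_homog_not_mem (x : L.cone k) (hx : x ∈ L.coneOpen k) :
    ∃ (d : ℕ) (_ : 0 < d) (r : L.sections k d), L.homog k d r ∉ x.asIdeal := by
  rw [coneOpen, mem_complVanishing] at hx
  push Not at hx
  obtain ⟨f, hf, hfx⟩ := hx
  by_contra! H
  refine hfx ?_
  rw [sum_homog f]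
  refine Ideal.sum_mem _ fun n _ => ?_
  rcases Nat.eq_zero_or_pos n with rfl | hn
  · have : L.homog k 0 ⟨L.coeff k 0 f, coeff_mem f 0⟩ = 0 := by
      apply polyHom_injective
      rw [polyHom_homog, map_zero]
      exact (congrArg _ hf).trans (map_zero _)
    rw [this]
    exact x.asIdeal.zero_mem
  · exact H n hn _

variable [IsIntegral Y]

/-- The generic point of the cone, as a point of `Y` with values in the function field of the
cone. -/
def genericPointOfY (Y : Scheme.{u}) [IsIntegral Y] : Spec (.of (ConeField Y)) ⟶ Y :=
  Spec.map (CommRingCat.ofHom (fieldIncl Y)) ≫ Y.fromSpecStalk (genericPoint Y)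

lemma Chart.genericPointOfY_eq (b : L.Chart k) : genericPointOfY Y =
    Spec.map (CommRingCat.ofHom ((fieldIncl Y).comp (gen _ b.genericPoint_mem))) ≫
      b.isAffineOpen.fromSpec := by
  rw [genericPointOfY, ← b.isAffineOpen.fromSpecStalk_eq_fromSpecStalk b.genericPoint_mem,
    IsAffineOpen.fromSpecStalk, CommRingCat.ofHom_comp, Spec.map_comp, Category.assoc]
  rfl

lemma Chart.toConeField_ev (b : L.Chart k) (r : L.SectionRing k) :
    b.toConeField (b.ev r) = L.toConeField k r :=
  congrArg (fun f => f r) b.toConeField_comp_ev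

lemma Chart.fieldIncl_algebraMap (b : L.Chart k) (c : k) :
    fieldIncl Y (gen _ b.genericPoint_mem (algebraMap k Γ(Y, b.dom) c)) =
      L.toConeField k (algebraMap k (L.SectionRing k) c) := by
  rw [← b.toConeField_ev, ev_algebraMap, b.toConeField_C]

/-- The charts cover the punctured cone. For a point `𝔭` of the punctured cone there is a valuation
ring `A` of the function field of the cone which dominates `S_𝔭`. As `Y` is proper, the generic
point of `Y` extends to a morphism `Spec A ⟶ Y`. If the image of the closed point lies in `Y_s`
and `r ∉ 𝔭` is homogeneous of degree `d`, then `r ^ m / s ^ d` is a function on `Y_s`, hence an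
element of `A`, and therefore `s` is a unit of `A`. -/
lemma exists_elt_not_mem [IsProper (Y ↘ Spec (.of k))] [CompactSpace Y] (hL : L.IsAmple k)
    (x : L.cone k) (hx : x ∈ L.coneOpen k) : ∃ b : L.Chart k, b.elt ∉ x.asIdeal := by
  obtain ⟨d, hd, r, hr⟩ := exists_homog_not_mem x hx
  let 𝔭 : Ideal (L.SectionRing k) := x.asIdeal
  have : 𝔭.IsPrime := x.isPrime
  have hunit : ∀ y : 𝔭.primeCompl, IsUnit (L.toConeField k y) := fun y => by
    refine IsUnit.mk0 _ fun h => y.2 ?_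
    have h0 : (y : L.SectionRing k) = 0 := toConeField_injective (h.trans (map_zero _).symm)
    rw [h0]
    exact 𝔭.zero_mem
  let φ : Localization.AtPrime 𝔭 →+* ConeField Y := IsLocalization.lift hunit
  have hφ : ∀ s, φ (algebraMap _ _ s) = L.toConeField k s := IsLocalization.lift_eq hunit
  obtain ⟨A, hA, hloc⟩ := IsLocalRing.exists_factor_valuationRing φ
  let ψ : L.SectionRing k →+* A := (φ.codRestrict A.toSubring hA).comp (algebraMap _ _)
  have hψ : ∀ s, algebraMap A (ConeField Y) (ψ s) = L.toConeField k s := hφ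
  have hψu : ∀ s, IsUnit (ψ s) ↔ s ∉ 𝔭 := fun s => by
    exact (isUnit_map_iff (φ.codRestrict A.toSubring hA) _).trans
      (IsLocalization.AtPrime.isUnit_to_map_iff (Localization.AtPrime 𝔭) 𝔭 s)
  have b₀ : L.Chart k := (L.exists_chart hL le_rfl L.genericPoint_mem_i₀).choose
  have hsq : CommSq (genericPointOfY Y) (Spec.map (CommRingCat.ofHom (algebraMap A (ConeField Y))))
      (Y ↘ Spec (.of k))
      (Spec.map (CommRingCat.ofHom (ψ.comp (algebraMap k (L.SectionRing k))))) := ⟨by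
    rw [b₀.genericPointOfY_eq, Category.assoc, fromSpec_over, ← Spec.map_comp, ← Spec.map_comp,
      ← CommRingCat.ofHom_comp, ← CommRingCat.ofHom_comp]
    congr 2
    ext c
    exact (b₀.fieldIncl_algebraMap c).trans (hψ _).symm⟩
  -- the valuative criterion gives an extension `l : Spec A ⟶ Y` of the generic point of `Y`
  have hcrit : ValuativeCriterion.Existence (Y ↘ Spec (.of k)) := by
    have : UniversallyClosed (Y ↘ Spec (.of k)) := inferInstance
    rw [UniversallyClosed.eq_valuativeCriterion] at this
    exact this.1
  obtain ⟨l, hl⟩ : ∃ l : Spec (.of A) ⟶ Y,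
      Spec.map (CommRingCat.ofHom (algebraMap A (ConeField Y))) ≫ l = genericPointOfY Y := by
    obtain ⟨⟨l, hl, -⟩⟩ := (hcrit ⟨A, ConeField Y, _, _, hsq⟩).exists_lift
    exact ⟨l, hl⟩
  obtain ⟨j, hj⟩ := L.exists_mem_V (l (IsLocalRing.closedPoint A))
  obtain ⟨b, -, hb, -⟩ := L.exists_chart hL le_rfl hj
  refine ⟨b, (hψu _).mp ?_⟩
  -- a morphism from a local scheme lies in every open subset that contains its closed point
  have htop : l ⁻¹ᵁ b.dom = ⊤ := (IsLocalRing.closedPoint_mem_iff (R := A) (l ⁻¹ᵁ b.dom)).mp hb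
  have hrange : Set.range l ⊆ Set.range b.isAffineOpen.fromSpec := by
    rw [b.isAffineOpen.range_fromSpec]
    rintro _ ⟨z, rfl⟩
    exact htop.ge (Opens.mem_top z)
  obtain ⟨μ, hμ⟩ := Spec.map_surjective (IsOpenImmersion.lift b.isAffineOpen.fromSpec l hrange)
  have hμl : Spec.map μ ≫ b.isAffineOpen.fromSpec = l := by
    rw [hμ, IsOpenImmersion.lift_fac]
  have hμA : μ ≫ CommRingCat.ofHom (algebraMap A (ConeField Y)) =
      CommRingCat.ofHom ((fieldIncl Y).comp (gen _ b.genericPoint_mem)) := by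
    apply Spec.map_injective
    rw [← cancel_mono b.isAffineOpen.fromSpec, Spec.map_comp, Category.assoc, hμl,
      ← b.genericPointOfY_eq]
    exact hl
  -- the function `u = r ^ m / s ^ d` on `Y_s`
  obtain ⟨u, hu⟩ : ∃ u : Γ(Y, b.dom), C u * b.ev b.elt ^ d = b.ev (L.homog k d r) ^ b.m := by
    obtain ⟨v, hv⟩ := b.isUnit_section.exists_left_inv
    refine ⟨res b.le_V (r.1 b.i) ^ b.m * v ^ d, ?_⟩
    rw [b.ev_elt, ev_homog, mul_pow, mul_pow, T_pow, T_pow, mul_comm (b.m : ℤ), map_mul, map_pow,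
      map_pow]
    have : (C v * C (res b.le_V (b.s.1 b.i)) : Γ(Y, b.dom)[T;T⁻¹]) = 1 := by
      rw [← map_mul, hv, map_one]
    calc _ = C (res b.le_V (r.1 b.i)) ^ b.m *
          (C v * C (res b.le_V (b.s.1 b.i))) ^ d * T _ := by ring
      _ = _ := by rw [this, one_pow, mul_one]
  have key : μ.hom u * ψ b.elt ^ d = ψ (L.homog k d r) ^ b.m := by
    apply IsFractionRing.injective A (ConeField Y)
    have h1 := congrArg b.toConeField hu
    rw [map_mul, map_pow, map_pow, b.toConeField_C, b.toConeField_ev,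
      b.toConeField_ev] at h1
    rw [map_mul, map_pow, map_pow, hψ, hψ, ← h1]
    congr 1
    exact congrArg (fun f => f.hom u) hμA
  have h1 : IsUnit (μ.hom u * ψ b.elt ^ d) := by
    rw [key]
    exact ((hψu _).mpr hr).pow _
  exact (isUnit_pow_iff hd.ne').mp (isUnit_of_mul_isUnit_right h1)

end LineBundle

end AlgGeom

/-! ### Charts of the punctured cone -/

namespace AlgGeom

lemma pull_eq_app {X Y : Scheme.{u}} (f : X ⟶ Y) (V : Y.Opens) (a : Γ(Y, V)) :
    pull f V (f ⁻¹ᵁ V) le_rfl a = (f.app V).hom a :=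
  congrArg (fun φ : Γ(Y, V) ⟶ Γ(X, f ⁻¹ᵁ V) => φ.hom a) (Scheme.Hom.appLE_eq_app f)

lemma pull_specMap {R R' : CommRingCat.{u}} (φ : R ⟶ R') (V : (Spec R').Opens) (x : R) :
    pull (Spec.map φ) ⊤ V le_top ((Scheme.ΓSpecIso R).inv.hom x) =
      res le_top ((Scheme.ΓSpecIso R').inv.hom (φ.hom x)) := by
  rw [← res_pull (Spec.map φ) ⊤ ⊤ V le_top le_top]
  congr 1
  have := congrArg (fun f => f.hom x) (Scheme.ΓSpecIso_inv_naturality φ)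
  refine .trans ?_ this.symm
  exact pull_eq_app (Spec.map φ) ⊤ _

/-- Morphisms from an affine scheme to an affine open subset are determined by the pullback of
functions. -/
lemma hom_ext_of_pull {Z Y : Scheme.{u}} [IsAffine Z] {f g : Z ⟶ Y} {W : Y.Opens}
    (hW : IsAffineOpen W) (hf : ⊤ ≤ f ⁻¹ᵁ W) (hg : ⊤ ≤ g ⁻¹ᵁ W)
    (h : ∀ a, pull f W ⊤ hf a = pull g W ⊤ hg a) : f = g := by
  have e : f.appLE W ⊤ hf = g.appLE W ⊤ hg := CommRingCat.hom_ext (RingHom.ext h)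
  have h1 := IsAffineOpen.SpecMap_appLE_fromSpec f hW (isAffineOpen_top Z) hf
  rw [e, IsAffineOpen.SpecMap_appLE_fromSpec g hW (isAffineOpen_top Z) hg,
    IsAffineOpen.fromSpec_top, cancel_epi] at h1
  exact h1.symm

namespace LineBundle

open LaurentPolynomial

variable {k : Type u} [Field k] {Y : Scheme.{u}} {L : LineBundle Y} [Y.Over (Spec (.of k))]

lemma res_fn {W W' : (L.puncturedCone k).Opens} (h : W' ≤ W) (r : L.SectionRing k) :
    res h (L.fn k W r) = L.fn k W' r := res_pull _ _ _ _ _ _ _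

lemma fn_algebraMap (W : (L.puncturedCone k).Opens) (c : k) :
    L.fn k W (algebraMap k (L.SectionRing k) c) = algebraMap k Γ(L.puncturedCone k, W) c := by
  have h1 := pull_specMap (CommRingCat.ofHom (algebraMap k (L.SectionRing k))) ⊤ c
  rw [res_self] at h1
  change pull (L.incl k) ⊤ W le_top ((Scheme.ΓSpecIso (.of (L.SectionRing k))).inv.hom _) = _
  refine (congrArg _ h1.symm).trans ?_
  exact pull_pull _ _ _ _ _ _ _ _

lemma mem_basicOpen_fn (W : (L.puncturedCone k).Opens) (r : L.SectionRing k)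
    (x : L.puncturedCone k) :
    x ∈ (L.puncturedCone k).basicOpen (L.fn k W r) ↔ x ∈ W ∧ r ∉ (L.incl k x).asIdeal := by
  have h := basicOpen_eq_of_affine (R := .of (L.SectionRing k)) r
  have h' := Scheme.basicOpen_appLE (L.incl k) W ⊤ le_top
    ((Scheme.ΓSpecIso (.of (L.SectionRing k))).inv.hom r)
  change x ∈ (L.puncturedCone k).basicOpen ((L.incl k).appLE ⊤ W le_top _) ↔ _
  rw [h']
  constructor
  · rintro ⟨hW, hx⟩
    exact ⟨hW, h.le hx⟩
  · rintro ⟨hW, hx⟩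
    exact ⟨hW, h.ge hx⟩

variable [IsIntegral Y]

section

variable (b : L.Chart k)

/-- The open immersion of a chart in the cone. -/
def Chart.toCone : Spec (.of Γ(Y, b.dom)[T;T⁻¹]) ⟶ L.cone k :=
  Spec.map (CommRingCat.ofHom b.ev)

lemma Chart.elt_mem_irrelevant : b.elt ∈ L.irrelevant k := by
  change (Polynomial.monomial b.m b.s.1).coeff 0 = 0
  rw [Polynomial.coeff_monomial, if_neg b.m_pos.ne']

/-- The projection of a chart to `Y`. -/
def Chart.proj : Spec (.of Γ(Y, b.dom)[T;T⁻¹]) ⟶ Y :=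
  Spec.map (CommRingCat.ofHom C) ≫ b.isAffineOpen.fromSpec

lemma Chart.top_le_proj : ⊤ ≤ b.proj ⁻¹ᵁ b.dom := by
  intro z _
  have : b.proj z ∈ Set.range b.isAffineOpen.fromSpec := ⟨_, (Scheme.Hom.comp_apply _ _ _).symm⟩
  rwa [b.isAffineOpen.range_fromSpec] at this

lemma Chart.pull_proj (a : Γ(Y, b.dom)) :
    (Scheme.ΓSpecIso (.of Γ(Y, b.dom)[T;T⁻¹])).hom.hom (pull b.proj b.dom ⊤ b.top_le_proj a) =
      C a := by
  have h : ⊤ ≤ b.isAffineOpen.fromSpec ⁻¹ᵁ b.dom := b.isAffineOpen.fromSpec_preimage_self.ge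
  have h1 : pull b.isAffineOpen.fromSpec b.dom ⊤ h a = (Scheme.ΓSpecIso _).inv.hom a := by
    have := congrArg (fun φ : Γ(Y, b.dom) ⟶ _ => res h (φ.hom a)) b.isAffineOpen.fromSpec_app_self
    refine (res_pull b.isAffineOpen.fromSpec b.dom _ _ le_rfl h a).symm.trans ?_
    rw [pull_eq_app]
    refine this.trans ?_
    refine (res_res h (W := b.isAffineOpen.fromSpec ⁻¹ᵁ b.dom) le_top _).trans (res_self _ _)
  have h2 := pull_pull (Spec.map (CommRingCat.ofHom (C : Γ(Y, b.dom) →+* Γ(Y, b.dom)[T;T⁻¹])))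
    b.isAffineOpen.fromSpec b.dom ⊤ ⊤ h le_top a
  have h3 := h2.symm.trans ((congrArg _ h1).trans ((pull_specMap _ ⊤ a).trans (res_self _ _)))
  refine (congrArg (Scheme.ΓSpecIso (.of Γ(Y, b.dom)[T;T⁻¹])).hom.hom h3).trans ?_
  exact congrArg (fun f => f.hom (C a)) (Scheme.ΓSpecIso (.of Γ(Y, b.dom)[T;T⁻¹])).inv_hom_id

variable [CompactSpace Y]

instance : IsOpenImmersion b.toCone := by
  let := b.ev.toAlgebra
  have := b.isLocalization
  exact IsOpenImmersion.of_isLocalization (S := Γ(Y, b.dom)[T;T⁻¹]) b.elt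

lemma Chart.mem_range_toCone (x : L.cone k) : x ∈ Set.range b.toCone ↔ b.elt ∉ x.asIdeal := by
  let := b.ev.toAlgebra
  have := b.isLocalization
  have h := PrimeSpectrum.localization_away_comap_range Γ(Y, b.dom)[T;T⁻¹] b.elt
  exact Set.ext_iff.mp h x

/-- The open immersion of a chart in the punctured cone. -/
def Chart.toPuncturedCone : Spec (.of Γ(Y, b.dom)[T;T⁻¹]) ⟶ L.puncturedCone k :=
  IsOpenImmersion.lift (L.incl k) b.toCone (by
    intro x hx
    have hx' : x ∈ L.coneOpen k := fun h => (b.mem_range_toCone x).mp hx (h b.elt_mem_irrelevant)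
    exact ⟨⟨x, hx'⟩, rfl⟩)

lemma Chart.toPuncturedCone_incl : b.toPuncturedCone ≫ L.incl k = b.toCone :=
  IsOpenImmersion.lift_fac _ _ _

instance : IsOpenImmersion b.toPuncturedCone := by
  have : IsOpenImmersion (b.toPuncturedCone ≫ L.incl k) := by
    rw [b.toPuncturedCone_incl]; infer_instance
  exact IsOpenImmersion.of_comp _ (L.incl k)

/-- The image of a chart in the punctured cone. -/
def Chart.coneDom : (L.puncturedCone k).Opens := b.toPuncturedCone.opensRange

lemma Chart.isAffineOpen_coneDom : IsAffineOpen b.coneDom := isAffineOpen_opensRange _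

lemma Chart.mem_coneDom (x : L.puncturedCone k) : x ∈ b.coneDom ↔ b.elt ∉ (L.incl k x).asIdeal := by
  rw [← b.mem_range_toCone, ← b.toPuncturedCone_incl]
  constructor
  · rintro ⟨z, rfl⟩
    exact ⟨z, Scheme.Hom.comp_apply _ _ _⟩
  · rintro ⟨z, hz⟩
    refine ⟨z, (L.incl k).isOpenEmbedding.injective ?_⟩
    rw [← hz, Scheme.Hom.comp_apply]

lemma Chart.top_le_coneDom : ⊤ ≤ b.toPuncturedCone ⁻¹ᵁ b.coneDom := fun z _ => ⟨z, rfl⟩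

/-- Functions on the image of a chart, as Laurent polynomials. -/
def Chart.coneFn : Γ(L.puncturedCone k, b.coneDom) →+* Γ(Y, b.dom)[T;T⁻¹] :=
  (Scheme.ΓSpecIso (.of Γ(Y, b.dom)[T;T⁻¹])).hom.hom.comp
    (pull b.toPuncturedCone b.coneDom ⊤ b.top_le_coneDom)

lemma Chart.coneFn_bijective : Function.Bijective b.coneFn := by
  have h1 : IsIso (b.toPuncturedCone.app b.coneDom) :=
    b.toPuncturedCone.isIso_app _ le_rfl
  have h2 : IsIso (b.toPuncturedCone.appLE b.coneDom ⊤ b.top_le_coneDom) := by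
    rw [Scheme.Hom.appLE]
    have : IsIso (homOfLE b.top_le_coneDom).op := by
      have e : b.toPuncturedCone ⁻¹ᵁ b.coneDom = ⊤ := top_le_iff.mp b.top_le_coneDom
      exact ⟨(homOfLE e.le).op, Subsingleton.elim _ _, Subsingleton.elim _ _⟩
    infer_instance
  exact (ConcreteCategory.bijective_of_isIso
    (b.toPuncturedCone.appLE b.coneDom ⊤ b.top_le_coneDom ≫
      (Scheme.ΓSpecIso (.of Γ(Y, b.dom)[T;T⁻¹])).hom))

lemma Chart.coneFn_fn (r : L.SectionRing k) : b.coneFn (L.fn k b.coneDom r) = b.ev r := by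
  have h1 := pull_pull b.toPuncturedCone (L.incl k) ⊤ b.coneDom ⊤ le_top b.top_le_coneDom
    ((Scheme.ΓSpecIso (.of (L.SectionRing k))).inv.hom r)
  have h2 := h1.trans ((pull_congr b.toPuncturedCone_incl ⊤ ⊤ _ le_top _).trans
    ((pull_specMap (CommRingCat.ofHom b.ev) ⊤ r).trans (res_self _ _)))
  refine (congrArg (Scheme.ΓSpecIso (.of Γ(Y, b.dom)[T;T⁻¹])).hom.hom h2).trans ?_
  exact congrArg (fun f => f.hom (b.ev r))
    (Scheme.ΓSpecIso (.of Γ(Y, b.dom)[T;T⁻¹])).inv_hom_id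

lemma Chart.coneFn_algebraMap (c : k) :
    b.coneFn (algebraMap k _ c) = C (algebraMap k Γ(Y, b.dom) c) := by
  rw [← fn_algebraMap, b.coneFn_fn, ev_algebraMap]

/-- The generic point of the cone as a point of a chart. -/
def Chart.genericPt : Spec (.of (ConeField Y)) ⟶ Spec (.of Γ(Y, b.dom)[T;T⁻¹]) :=
  Spec.map (CommRingCat.ofHom b.toConeField)

instance : IsDominant b.genericPt := by
  refine ⟨?_⟩
  refine (PrimeSpectrum.denseRange_comap_iff_ker_le_nilRadical b.toConeField).mpr ?_
  rw [(RingHom.injective_iff_ker_eq_bot _).mp b.toConeField_injective]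
  exact bot_le

lemma Chart.genericPt_toPuncturedCone (b' : L.Chart k) :
    b.genericPt ≫ b.toPuncturedCone = b'.genericPt ≫ b'.toPuncturedCone := by
  rw [← cancel_mono (L.incl k), Category.assoc, Category.assoc, b.toPuncturedCone_incl,
    b'.toPuncturedCone_incl]
  simp only [genericPt, toCone, ← Spec.map_comp, ← CommRingCat.ofHom_comp, toConeField_comp_ev]

omit [CompactSpace Y] in
lemma Chart.genericPt_proj : b.genericPt ≫ b.proj = genericPointOfY Y := by
  rw [b.genericPointOfY_eq, proj, genericPt, ← Category.assoc, ← Spec.map_comp,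
    ← CommRingCat.ofHom_comp]
  have : b.toConeField.comp C = (fieldIncl Y).comp (gen _ b.genericPoint_mem) :=
    RingHom.ext b.toConeField_C
  rw [this]

lemma Chart.proj_over : b.proj ≫ (Y ↘ Spec (.of k)) =
    b.toPuncturedCone ≫ (L.puncturedCone k ↘ Spec (.of k)) := by
  change _ = b.toPuncturedCone ≫ L.incl k ≫ Spec.map _
  rw [← Category.assoc, b.toPuncturedCone_incl, proj, Category.assoc, fromSpec_over, toCone,
    ← Spec.map_comp, ← Spec.map_comp, ← CommRingCat.ofHom_comp, ← CommRingCat.ofHom_comp]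
  have : (C : _ →+* Γ(Y, b.dom)[T;T⁻¹]).comp (algebraMap k Γ(Y, b.dom)) =
      b.ev.comp (algebraMap k (L.SectionRing k)) := RingHom.ext fun c => (ev_algebraMap _ _ c).symm
  rw [this]

end

end LineBundle

end AlgGeom

/-! ### The projection of the punctured cone -/

namespace AlgGeom

lemma isUnit_of_local {X : Scheme.{u}} {ι : Type*} {U : ι → X.Opens} {V : X.Opens}
    (hU : ∀ i, U i ≤ V) (hV : ∀ x ∈ V, ∃ i, x ∈ U i) {f : Γ(X, V)}
    (h : ∀ i, IsUnit (res (hU i) f)) : IsUnit f := by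
  have : V ≤ X.basicOpen f := fun x hx => by
    obtain ⟨i, hi⟩ := hV x hx
    exact le_basicOpen_of_isUnit f (hU i) (h i) hi
  have h1 := isUnit_res_basicOpen f le_rfl this
  rwa [res_self] at h1

namespace LineBundle

open LaurentPolynomial

variable {k : Type u} [Field k] {Y : Scheme.{u}} {L : LineBundle Y} [Y.Over (Spec (.of k))]

/-- A fibre coordinate of `π : U ⟶ Y` over `V i`, defined on an open subset `W` of `π⁻¹ (V i)`: a
function `t` such that the function on the cone given by a section `s` of `L ^ m` is
`π^#(s i) * t ^ m`. -/
def IsCoord (π : L.puncturedCone k ⟶ Y) (i : L.ι) {W : (L.puncturedCone k).Opens}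
    (hW : W ≤ π ⁻¹ᵁ (L.V i)) (t : Γ(L.puncturedCone k, W)) : Prop :=
  ∀ (m : ℕ) (s : L.sections k m), L.fn k W (L.homog k m s) = pull π (L.V i) W hW (s.1 i) * t ^ m

/-- `π` has an invertible fibre coordinate over each `V i`. -/
def HasCoords (π : L.puncturedCone k ⟶ Y) : Prop :=
  ∃ t : ∀ i, Γ(L.puncturedCone k, π ⁻¹ᵁ (L.V i))ˣ,
    ∀ i, IsCoord π i le_rfl (t i : Γ(L.puncturedCone k, π ⁻¹ᵁ (L.V i)))

variable {π : L.puncturedCone k ⟶ Y} {i : L.ι} {W : (L.puncturedCone k).Opens}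
    {hW : W ≤ π ⁻¹ᵁ (L.V i)} {t : Γ(L.puncturedCone k, W)}

lemma IsCoord.res (ht : IsCoord π i hW t) {W' : (L.puncturedCone k).Opens} (h : W' ≤ W) :
    IsCoord π i (h.trans hW) (AlgGeom.res h t) := by
  intro m s
  rw [← res_fn h, ht m s, map_mul, map_pow, res_pull]

lemma preimage_mono {X Y : Scheme.{u}} (f : X ⟶ Y) {V V' : Y.Opens} (h : V ≤ V') :
    f ⁻¹ᵁ V ≤ f ⁻¹ᵁ V' := fun _ hx => h hx

lemma pull_scale_fn (c : kˣ) (W W' : (L.puncturedCone k).Opens) (h : W' ≤ L.scale k c ⁻¹ᵁ W)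
    (r : L.SectionRing k) :
    pull (L.scale k c) W W' h (L.fn k W r) = L.fn k W' (L.scaleHom k c r) := by
  have h1 := pull_pull (L.scale k c) (L.incl k) ⊤ W W' le_top h
    ((Scheme.ΓSpecIso (.of (L.SectionRing k))).inv.hom r)
  have h2 := pull_pull (L.incl k) (L.scaleCone k c) ⊤ ⊤ W' le_top le_top
    ((Scheme.ΓSpecIso (.of (L.SectionRing k))).inv.hom r)
  refine h1.trans ((pull_congr (L.scale_incl k c) ⊤ W' _ le_top _).trans (h2.symm.trans ?_))
  exact congrArg (pull (L.incl k) ⊤ W' le_top)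
    ((pull_specMap (CommRingCat.ofHom (L.scaleHom k c)) ⊤ r).trans (res_self _ _))

lemma scaleHom_homog (c : kˣ) (m : ℕ) (s : L.sections k m) :
    L.scaleHom k c (L.homog k m s) = algebraMap k _ ((c : k) ^ m) * L.homog k m s := by
  rw [← Algebra.smul_def]
  refine L.ext_coeff k fun n => ?_
  refine (L.coeff_scaleAlg k c _ n).trans ?_
  rw [map_smul]
  by_cases h : n = m
  · rw [h]
  · have : L.coeff k n (L.homog k m s) = 0 :=
      Polynomial.coeff_monomial_of_ne _ (fun e => h e)
    rw [this, smul_zero, smul_zero]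

lemma HasCoords.scale_comp (hπ : HasCoords π) (c : kˣ) : HasCoords (L.scale k c ≫ π) := by
  obtain ⟨t, ht⟩ := hπ
  let u : ∀ W : (L.puncturedCone k).Opens, Γ(L.puncturedCone k, W)ˣ := fun W =>
    Units.map (algebraMap k Γ(L.puncturedCone k, W) : k →* _) c
  have h : ∀ i, (L.scale k c ≫ π) ⁻¹ᵁ (L.V i) ≤ L.scale k c ⁻¹ᵁ (π ⁻¹ᵁ (L.V i)) := fun i => le_rfl
  refine ⟨fun i => (u _)⁻¹ * Units.map (pull (L.scale k c) (π ⁻¹ᵁ (L.V i)) _ (h i) : _ →* _) (t i),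
    fun i m s => ?_⟩
  have h1 := congrArg (pull (L.scale k c) (π ⁻¹ᵁ (L.V i)) _ (h i)) (ht i m s)
  rw [pull_scale_fn, scaleHom_homog, map_mul, map_mul, fn_algebraMap, map_pow, map_pow,
    pull_pull] at h1
  refine ((u _).isUnit.pow m).mul_left_cancel (h1.trans ?_)
  rw [Units.val_mul, mul_pow, mul_left_comm, ← mul_assoc (_ ^ m) (_ ^ m), ← mul_pow,
    Units.mul_inv, one_pow, one_mul]
  rfl

variable [IsIntegral Y]

lemma IsCoord.mem_iff [CompactSpace Y] (ht : IsCoord π i hW t) (hu : IsUnit t) (b : L.Chart k)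
    {x : L.puncturedCone k} (hx : x ∈ W) : x ∈ b.coneDom ↔ π x ∈ b.dom := by
  have h1 : x ∈ b.coneDom ↔ x ∈ (L.puncturedCone k).basicOpen (L.fn k W b.elt) := by
    rw [b.mem_coneDom, mem_basicOpen_fn]
    exact ⟨fun h => ⟨hx, h⟩, fun h => h.2⟩
  have h2 := Scheme.basicOpen_appLE π W (L.V i) hW (b.s.1 i)
  rw [h1, Chart.elt, ht b.m b.s, Scheme.basicOpen_mul,
    (L.puncturedCone k).basicOpen_of_isUnit (hu.pow b.m)]
  refine (show _ ↔ x ∈ (L.puncturedCone k).basicOpen (π.appLE (L.V i) W hW (b.s.1 i)) from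
    ⟨fun h => h.1, fun h => ⟨h, hx⟩⟩).trans ?_
  rw [h2, ← L.nonvanishing_inf_V b.s i]
  exact ⟨fun h => h.2.1, fun h => ⟨hx, h, hW hx⟩⟩

lemma isUnit_pull_section (b : L.Chart k) (hWb : W ≤ π ⁻¹ᵁ b.dom) (hi : W ≤ π ⁻¹ᵁ (L.V b.i)) :
    IsUnit (pull π (L.V b.i) W hi (b.s.1 b.i)) := by
  have := b.isUnit_section.map (pull π b.dom W hWb)
  rwa [pull_res] at this

/-- Fibre coordinates are unique. -/
lemma IsCoord.eq [CompactSpace Y] (b : L.Chart k) (hWb : W ≤ π ⁻¹ᵁ b.dom)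
    {hW : W ≤ π ⁻¹ᵁ (L.V b.i)} {t t' : Γ(L.puncturedCone k, W)}
    (ht : IsCoord π b.i hW t) (ht' : IsCoord π b.i hW t') (hu : IsUnit t) : t = t' := by
  obtain ⟨N, hN⟩ := exists_section_on_chart b 1 1
  obtain ⟨r, hr⟩ := hN N le_rfl (1 + N * b.m) (by push_cast; ring)
  have hr' := congrArg (pull π b.dom W hWb) hr
  rw [one_mul, pull_res, map_pow, pull_res] at hr'
  have key : ∀ t : Γ(L.puncturedCone k, W), IsCoord π b.i hW t →
      L.fn k W (L.homog k _ r) = t * L.fn k W (L.homog k _ b.s) ^ N := fun t ht => by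
    rw [ht _ r, ht _ b.s, hr']
    ring
  have hs : IsUnit (L.fn k W (L.homog k _ b.s)) := by
    rw [ht _ b.s]
    exact (isUnit_pull_section b hWb hW).mul (hu.pow _)
  exact (hs.pow N).mul_right_cancel ((key t ht).symm.trans (key t' ht'))

section

variable [CompactSpace Y] (b : L.Chart k)

lemma HasCoords.preimage_dom (hπ : HasCoords π) : π ⁻¹ᵁ b.dom = b.coneDom := by
  obtain ⟨t, ht⟩ := hπ
  ext x
  obtain ⟨i, hi⟩ := L.exists_mem_V (π x)
  exact ((ht i).mem_iff (t i).isUnit b hi).symm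

lemma HasCoords.coneFn_pull (hπ : HasCoords π) (hb : b.coneDom ≤ π ⁻¹ᵁ b.dom) (a : Γ(Y, b.dom)) :
    b.coneFn (pull π b.dom b.coneDom hb a) = C a := by
  obtain ⟨t, ht⟩ := hπ
  have hi : b.coneDom ≤ π ⁻¹ᵁ (L.V b.i) := hb.trans (preimage_mono π b.le_V)
  have ht' := (ht b.i).res hi
  obtain ⟨N, hN⟩ := exists_section_on_chart b 0 a
  obtain ⟨r, hr⟩ := hN N le_rfl (N * b.m) (by simp)
  have hr' := congrArg (pull π b.dom b.coneDom hb) hr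
  rw [map_mul, pull_res, map_pow, pull_res] at hr'
  have h1 : L.fn k b.coneDom (L.homog k _ r) =
      pull π b.dom b.coneDom hb a * L.fn k b.coneDom b.elt ^ N := by
    rw [Chart.elt, ht' _ r, ht' _ b.s, hr']
    ring
  have h2 := congrArg b.coneFn h1
  rw [map_mul, map_pow, b.coneFn_fn, b.coneFn_fn] at h2
  refine (b.isUnit_ev_elt.pow N).mul_right_cancel (h2.symm.trans ?_)
  rw [ev_homog, hr, b.ev_elt, mul_pow, T_pow, ← mul_assoc, map_mul, map_pow]
  push_cast
  rfl

/-- A morphism `U ⟶ Y` with fibre coordinates is the projection in the charts of the punctured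
cone. -/
lemma HasCoords.toPuncturedCone_comp (hπ : HasCoords π) : b.toPuncturedCone ≫ π = b.proj := by
  have hb := (hπ.preimage_dom b).ge
  have h1 : ⊤ ≤ (b.toPuncturedCone ≫ π) ⁻¹ᵁ b.dom :=
    b.top_le_coneDom.trans (preimage_mono b.toPuncturedCone hb)
  refine hom_ext_of_pull b.isAffineOpen h1 b.top_le_proj fun a => ?_
  have h2 := hπ.coneFn_pull b hb a
  rw [← b.pull_proj] at h2
  have h3 := (ConcreteCategory.bijective_of_isIso
    (Scheme.ΓSpecIso (.of Γ(Y, b.dom)[T;T⁻¹])).hom).1 h2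
  exact (pull_pull _ _ _ _ _ _ _ _).symm.trans h3

end

/-- Conversely, the projection in the charts has fibre coordinates. -/
lemma hasCoords_of_toPuncturedCone_comp [IsProper (Y ↘ Spec (.of k))] [CompactSpace Y]
    (hL : L.IsAmple k) (hπ : ∀ b : L.Chart k, b.toPuncturedCone ≫ π = b.proj) : HasCoords π := by
  have hdom : ∀ b : L.Chart k, b.coneDom ≤ π ⁻¹ᵁ b.dom := by
    rintro b _ ⟨z, rfl⟩
    have := b.top_le_proj (Opens.mem_top z)
    rw [← hπ b] at this
    exact this
  have hdomV : ∀ b : L.Chart k, b.coneDom ≤ π ⁻¹ᵁ (L.V b.i) := fun b =>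
    (hdom b).trans (preimage_mono π b.le_V)
  have hpull : ∀ (b : L.Chart k) (a), b.coneFn (pull π b.dom b.coneDom (hdom b) a) = C a :=
    fun b a => by
      rw [← b.pull_proj]
      have h1 := pull_pull b.toPuncturedCone π b.dom b.coneDom ⊤ (hdom b) b.top_le_coneDom a
      have h2 := h1.trans (pull_congr (hπ b) b.dom ⊤ _ b.top_le_proj a)
      exact congrArg (Scheme.ΓSpecIso (.of Γ(Y, b.dom)[T;T⁻¹])).hom.hom h2
  -- in a chart the variable `T` is a fibre coordinate
  have hτ : ∀ b : L.Chart k, ∃ τ, IsCoord π b.i (hdomV b) τ ∧ IsUnit τ := fun b => by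
    obtain ⟨τ, hτ⟩ := b.coneFn_bijective.2 (T 1)
    obtain ⟨τ', hτ'⟩ := b.coneFn_bijective.2 (T (-1))
    refine ⟨τ, fun m s => b.coneFn_bijective.1 ?_,
      IsUnit.of_mul_eq_one τ' (b.coneFn_bijective.1 ?_)⟩
    · rw [b.coneFn_fn, ev_homog, map_mul, map_pow, hτ, ← hpull b, pull_res, T_pow, mul_one]
    · rw [map_mul, hτ, hτ', ← T_add, map_one, add_neg_cancel, T_zero]
  choose τ hτ hτu using hτ
  have hdom' : ∀ b : L.Chart k, π ⁻¹ᵁ b.dom ≤ b.coneDom := fun b x hx => by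
    obtain ⟨b', hb'⟩ := exists_elt_not_mem hL (L.incl k x) x.2
    exact ((hτ b').mem_iff (hτu b') b ((b'.mem_coneDom x).mpr hb')).mpr hx
  -- fibre coordinates for the same index are unique, hence they glue
  have hglue : ∀ i, ∃ t : Γ(L.puncturedCone k, π ⁻¹ᵁ (L.V i)), IsUnit t ∧ IsCoord π i le_rfl t := by
    intro i
    let B := {b : L.Chart k // b.i = i}
    have hB : ∀ b : B, b.1.coneDom ≤ π ⁻¹ᵁ (L.V i) := fun b => by
      have := hdomV b.1
      rwa [b.2] at this
    have hcov : ∀ x ∈ π ⁻¹ᵁ (L.V i), ∃ b : B, x ∈ b.1.coneDom := fun x hx => by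
      obtain ⟨b, hb, hxb, -⟩ := L.exists_chart hL le_rfl hx
      exact ⟨⟨b, hb⟩, hdom' b hxb⟩
    have hcoord : ∀ b : B, IsCoord π i (hB b) (τ b.1) := by
      rintro ⟨b, rfl⟩
      exact hτ b
    obtain ⟨t, ht⟩ := sections_glue hB hcov (fun b => τ b.1) (fun b b' => by
      have h1 := (hcoord b).res (inf_le_left : b.1.coneDom ⊓ b'.1.coneDom ≤ _)
      have h2 := (hcoord b').res (inf_le_right : b.1.coneDom ⊓ b'.1.coneDom ≤ _)
      obtain ⟨b, rfl⟩ := b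
      exact h1.eq b (inf_le_left.trans (hdom b)) h2 ((hτu b).map _))
    refine ⟨t, isUnit_of_local hB hcov fun b => (ht b).symm ▸ hτu b.1, fun m s => ?_⟩
    refine sections_ext (U := fun b : B => b.1.coneDom) (fun x hx => ?_) fun b hb => ?_
    · obtain ⟨b, hb⟩ := hcov x hx
      exact ⟨b, hb, hB b⟩
    · rw [map_mul, map_pow, res_fn, ht, hcoord b m s, res_pull]
  choose t ht htc using hglue
  exact ⟨fun i => (ht i).unit, htc⟩

section

variable [IsProper (Y ↘ Spec (.of k))] [CompactSpace Y]

/-- The open cover of the punctured cone by the charts. -/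
def coneCover (hL : L.IsAmple k) : (L.puncturedCone k).OpenCover :=
  Scheme.Cover.mkOfCovers (L.Chart k) (fun b => Spec (.of Γ(Y, b.dom)[T;T⁻¹]))
    (fun b => b.toPuncturedCone) (fun x => by
      obtain ⟨b, hb⟩ := exists_elt_not_mem hL (L.incl k x) x.2
      exact ⟨b, (b.mem_coneDom x).mpr hb⟩) (fun b => inferInstanceAs (IsOpenImmersion _))

/-- The projections of two charts agree where both are defined: they agree at the generic point,
and `Y` is separated. -/
lemma Chart.proj_compat (b b' : L.Chart k) :
    pullback.fst b.toPuncturedCone b'.toPuncturedCone ≫ b.proj =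
      pullback.snd b.toPuncturedCone b'.toPuncturedCone ≫ b'.proj := by
  let ι : Spec (.of (ConeField Y)) ⟶ pullback b.toPuncturedCone b'.toPuncturedCone :=
    pullback.lift b.genericPt b'.genericPt (b.genericPt_toPuncturedCone b')
  have h1 : IsDominant (ι ≫ pullback.fst b.toPuncturedCone b'.toPuncturedCone) := by
    rw [pullback.lift_fst]
    infer_instance
  have := IsDominant.of_comp_of_isOpenImmersion ι
    (pullback.fst b.toPuncturedCone b'.toPuncturedCone)
  have : IsDomain Γ(Y, b.dom)[T;T⁻¹] := b.toConeField_injective.isDomain b.toConeField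
  have : IsReduced (pullback b.toPuncturedCone b'.toPuncturedCone) :=
    isReduced_of_isOpenImmersion (pullback.fst b.toPuncturedCone b'.toPuncturedCone)
  refine ext_of_isDominant_of_isSeparated (Y ↘ Spec (.of k)) ?_ ι ?_
  · rw [Category.assoc, Category.assoc, b.proj_over, b'.proj_over, ← Category.assoc,
      ← Category.assoc, pullback.condition]
  · rw [← Category.assoc, ← Category.assoc, pullback.lift_fst, pullback.lift_snd, b.genericPt_proj,
      b'.genericPt_proj]

/-- There is exactly one projection of the punctured cone onto `Y`. Its invariance under the action
of `k^×` is a consequence of the uniqueness. -/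
theorem existsUnique_isProjection (hL : L.IsAmple k) :
    ∃! π : L.puncturedCone k ⟶ Y, L.IsProjection k π := by
  have huniq : ∀ π π' : L.puncturedCone k ⟶ Y, HasCoords π → HasCoords π' → π = π' :=
    fun π π' h h' => (coneCover hL).hom_ext _ _ fun b =>
      (h.toPuncturedCone_comp b).trans (h'.toPuncturedCone_comp b).symm
  have hcoords : ∀ π : L.puncturedCone k ⟶ Y, L.IsProjection k π → HasCoords π := fun π h => by
    obtain ⟨t, ht⟩ := h.exists_trivialisation
    exact ⟨t, fun i m s => ht m s i⟩
  let π : L.puncturedCone k ⟶ Y := (coneCover hL).glueMorphisms (fun b => Chart.proj b)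
    Chart.proj_compat
  have hb : ∀ b : L.Chart k, b.toPuncturedCone ≫ π = b.proj :=
    (coneCover hL).ι_glueMorphisms (fun b => Chart.proj b) Chart.proj_compat
  have hπ : HasCoords π := hasCoords_of_toPuncturedCone_comp hL hb
  refine ⟨π, ⟨⟨?_⟩, fun c => huniq _ _ (hπ.scale_comp c) hπ, ?_⟩, fun π' h =>
    huniq _ _ (hcoords π' h) hπ⟩
  · refine (coneCover hL).hom_ext _ _ fun b => ?_
    change b.toPuncturedCone ≫ π ≫ _ = b.toPuncturedCone ≫ _
    exact (Category.assoc _ _ _).symm.trans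
      ((congrArg (· ≫ (Y ↘ Spec (.of k))) (hb b)).trans (Chart.proj_over b))
  · obtain ⟨t, ht⟩ := hπ
    exact ⟨t, fun m s i => ht i m s⟩

end

end LineBundle

end AlgGeom

/-! ### Derivations of rings of Laurent polynomials -/

namespace LaurentDer

open LaurentPolynomial

section CommRing

variable {k A : Type*} [CommRing k] [CommRing A] [Algebra k A] {M : Type*} [AddCommGroup M]
  [Module k M]

lemma smul_eq (c : k) (x : A[T;T⁻¹]) : c • x = C (algebraMap k A c) * x := by
  rw [Algebra.smul_def]
  rfl

/-- The linear map on Laurent polynomials with prescribed values on homogeneous elements. -/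
def ofHomog (F : ℤ → A →ₗ[k] M) : A[T;T⁻¹] →ₗ[k] M :=
  Finsupp.lsum k F ∘ₗ (AddMonoidAlgebra.coeffLinearEquiv k).toLinearMap

lemma ofHomog_apply (F : ℤ → A →ₗ[k] M) (a : A) (n : ℤ) : ofHomog F (C a * T n) = F n a := by
  rw [← single_eq_C_mul_T]
  exact Finsupp.sum_single_index (map_zero _)

lemma linearMap_ext {φ ψ : A[T;T⁻¹] →ₗ[k] M} (h : ∀ a n, φ (C a * T n) = ψ (C a * T n)) :
    φ = ψ := by
  refine LinearMap.ext fun x => ?_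
  induction x using LaurentPolynomial.induction_on' with
  | add p q hp hq => rw [map_add, map_add, hp, hq]
  | C_mul_T n a => exact h a n

lemma linearMap_eq (φ ψ : A[T;T⁻¹] →ₗ[k] M) (h : ∀ a n, φ (C a * T n) = ψ (C a * T n))
    (x : A[T;T⁻¹]) : φ x = ψ x := by rw [linearMap_ext h]

lemma C_mul_T_mul (a b : A) (i j : ℤ) :
    (C (a * b) * T (i + j) : A[T;T⁻¹]) = C a * T i * (C b * T j) := by
  rw [map_mul, T_add, mul_mul_mul_comm]

variable (k) in
/-- The inclusion of the homogeneous part of degree `n`. -/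
def homogPart (n : ℤ) : A →ₗ[k] A[T;T⁻¹] where
  toFun a := C a * T n
  map_add' a b := by rw [map_add, add_mul]
  map_smul' c a := by
    rw [RingHom.id_apply, smul_eq, Algebra.smul_def, map_mul, mul_assoc]

/-- Multiplication of the homogeneous part of degree `n` by the scalar `μ n`. -/
def weight (μ : ℤ → k) : A[T;T⁻¹] →ₗ[k] A[T;T⁻¹] := ofHomog fun n => μ n • homogPart k n

lemma weight_C_mul_T (μ : ℤ → k) (a : A) (n : ℤ) :
    weight μ (C a * T n) = μ n • (C a * T n) := ofHomog_apply _ _ _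

lemma weight_add (μ ν : ℤ → k) (x : A[T;T⁻¹]) :
    weight (fun n => μ n + ν n) x = weight μ x + weight ν x := by
  refine linearMap_eq (weight fun n => μ n + ν n) (weight μ + weight ν) (fun a n => ?_) x
  rw [LinearMap.add_apply, weight_C_mul_T, weight_C_mul_T, weight_C_mul_T, add_smul]

lemma weight_weight (μ ν : ℤ → k) (x : A[T;T⁻¹]) :
    weight μ (weight ν x) = weight (fun n => μ n * ν n) x := by
  refine linearMap_eq (weight μ ∘ₗ weight ν) (weight fun n => μ n * ν n) (fun a n => ?_) x
  rw [LinearMap.comp_apply, weight_C_mul_T, weight_C_mul_T, map_smul, weight_C_mul_T, smul_smul,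
    mul_comm]

lemma weight_const (c : k) (x : A[T;T⁻¹]) : weight (fun _ => c) x = c • x := by
  refine linearMap_eq (weight fun _ => c) (c • LinearMap.id) (fun a n => ?_) x
  rw [weight_C_mul_T]
  rfl

lemma weight_mul (μ : ℤ → k) (a : A) (i : ℤ) (y : A[T;T⁻¹]) :
    weight μ (C a * T i * y) = C a * T i * weight (fun n => μ (i + n)) y := by
  induction y using LaurentPolynomial.induction_on' with
  | add p q hp hq => rw [mul_add, map_add, map_add, hp, hq, mul_add]
  | C_mul_T n b =>
    rw [← C_mul_T_mul, weight_C_mul_T, weight_C_mul_T, C_mul_T_mul, smul_eq, smul_eq, mul_left_comm]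

lemma coeff_weight (μ : ℤ → k) (x : A[T;T⁻¹]) (n : ℤ) :
    (weight μ x).coeff n = μ n • x.coeff n := by
  induction x using LaurentPolynomial.induction_on' with
  | add p q hp hq =>
    rw [map_add, AddMonoidAlgebra.coeff_add, AddMonoidAlgebra.coeff_add, Finsupp.add_apply,
      Finsupp.add_apply, hp, hq, smul_add]
  | C_mul_T m a =>
    rw [weight_C_mul_T, ← single_eq_C_mul_T]
    change μ m • (Finsupp.single m a) n = μ n • (Finsupp.single m a) n
    by_cases h : m = n
    · rw [h]
    · rw [Finsupp.single_eq_of_ne (Ne.symm h), smul_zero, smul_zero]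

/-- The derivation with prescribed values on homogeneous elements. -/
def derivationOfHomog (F : ℤ → A →ₗ[k] A[T;T⁻¹])
    (hF : ∀ i j a b, F (i + j) (a * b) = C a * T i * F j b + C b * T j * F i a) :
    Derivation k A[T;T⁻¹] A[T;T⁻¹] :=
  Derivation.mk' (ofHomog F) fun x y => by
    induction x using LaurentPolynomial.induction_on' with
    | add p q hp hq => rw [add_mul, map_add, hp, hq, map_add, smul_add, add_smul]; abel
    | C_mul_T i a =>
      induction y using LaurentPolynomial.induction_on' with
      | add p q hp hq => rw [mul_add, map_add, hp, hq, map_add, smul_add, add_smul]; abel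
      | C_mul_T j b =>
        rw [← C_mul_T_mul, ofHomog_apply, ofHomog_apply, ofHomog_apply, hF, smul_eq_mul,
          smul_eq_mul]

lemma derivationOfHomog_apply (F : ℤ → A →ₗ[k] A[T;T⁻¹]) (hF) (a : A) (n : ℤ) :
    derivationOfHomog F hF (C a * T n) = F n a := ofHomog_apply _ _ _

lemma derivation_ext {D D' : Derivation k A[T;T⁻¹] A[T;T⁻¹]}
    (h : ∀ a n, D (C a * T n) = D' (C a * T n)) : D = D' := by
  refine Derivation.ext fun x => ?_
  exact linearMap_eq (D : A[T;T⁻¹] →ₗ[k] A[T;T⁻¹]) D' h x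

lemma derivation_ext_gen {D D' : Derivation k A[T;T⁻¹] A[T;T⁻¹]}
    (h : ∀ a, D (C a) = D' (C a)) (hT : D (T 1) = D' (T 1)) : D = D' := by
  have h1 : ∀ n : ℕ, D (T n) = D' (T n) := fun n => by
    rw [show (T (n : ℤ) : A[T;T⁻¹]) = T 1 ^ n by rw [T_pow, mul_one], Derivation.leibniz_pow,
      Derivation.leibniz_pow, hT]
  refine derivation_ext fun a n => ?_
  rw [Derivation.leibniz, Derivation.leibniz, h]
  congr 2
  obtain ⟨m, rfl | rfl⟩ := n.eq_nat_or_neg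
  · exact h1 m
  · have e : (T (-(m : ℤ)) * T (m : ℤ) : A[T;T⁻¹]) = 1 := by
      rw [← T_add, neg_add_cancel, T_zero]
    rw [Derivation.leibniz_of_mul_eq_one _ e, Derivation.leibniz_of_mul_eq_one _ e, h1]

lemma weightDer_aux (l : ℤ → k) (D : Derivation k A[T;T⁻¹] A[T;T⁻¹]) (i j : ℤ) (a b : A) :
    weight (fun n => l (n - (i + j))) (D (C (a * b) * T (i + j))) =
      C a * T i * weight (fun n => l (n - j)) (D (C b * T j)) +
        C b * T j * weight (fun n => l (n - i)) (D (C a * T i)) := by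
  rw [C_mul_T_mul, Derivation.leibniz, smul_eq_mul, smul_eq_mul, map_add, weight_mul, weight_mul]
  have h1 : ∀ n, i + n - (i + j) = n - j := fun n => by ring
  have h2 : ∀ n, j + n - (i + j) = n - i := fun n => by ring
  simp only [h1, h2]

/-- The derivation obtained from `D` by multiplying its homogeneous part of degree `w` by `l w`. For
each element of the ring only finitely many of the homogeneous parts of `D` are nonzero. -/
def weightDer (l : ℤ → k) (D : Derivation k A[T;T⁻¹] A[T;T⁻¹]) :
    Derivation k A[T;T⁻¹] A[T;T⁻¹] :=
  derivationOfHomog (fun j => weight (fun n => l (n - j)) ∘ₗ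
    (D : A[T;T⁻¹] →ₗ[k] A[T;T⁻¹]) ∘ₗ homogPart k j) (weightDer_aux l D)

lemma weightDer_apply (l : ℤ → k) (D : Derivation k A[T;T⁻¹] A[T;T⁻¹]) (a : A) (j : ℤ) :
    weightDer l D (C a * T j) = weight (fun n => l (n - j)) (D (C a * T j)) :=
  derivationOfHomog_apply _ _ _ _

lemma weightDer_zero (l : ℤ → k) : weightDer l (0 : Derivation k A[T;T⁻¹] A[T;T⁻¹]) = 0 :=
  derivation_ext fun a j => by
    rw [weightDer_apply]
    exact map_zero _

lemma weightDer_add (l μ : ℤ → k) (D : Derivation k A[T;T⁻¹] A[T;T⁻¹]) :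
    weightDer (fun n => l n + μ n) D = weightDer l D + weightDer μ D :=
  derivation_ext fun a j => by
    rw [Derivation.add_apply, weightDer_apply, weightDer_apply, weightDer_apply]
    exact weight_add _ _ _

lemma weightDer_weightDer (l μ : ℤ → k) (D : Derivation k A[T;T⁻¹] A[T;T⁻¹]) :
    weightDer l (weightDer μ D) = weightDer (fun n => l n * μ n) D :=
  derivation_ext fun a j => by
    rw [weightDer_apply, weightDer_apply, weightDer_apply, weight_weight]

lemma weightDer_const (c : k) (D : Derivation k A[T;T⁻¹] A[T;T⁻¹]) :
    weightDer (fun _ => c) D = c • D :=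
  derivation_ext fun a j => by
    rw [weightDer_apply, weight_const]
    rfl

/-- The action of `c` on derivations: the homogeneous part of degree `w` is multiplied by
`c ^ w`. -/
def actDer (c : kˣ) (D : Derivation k A[T;T⁻¹] A[T;T⁻¹]) : Derivation k A[T;T⁻¹] A[T;T⁻¹] :=
  weightDer (fun w => ((c ^ w : kˣ) : k)) D

/-- The action of `c` on Laurent polynomials: `T ↦ c T`. -/
def scaleT (c : kˣ) : A[T;T⁻¹] →ₗ[k] A[T;T⁻¹] := weight (fun w => ((c ^ w : kˣ) : k))

lemma actDer_apply (c : kˣ) (D : Derivation k A[T;T⁻¹] A[T;T⁻¹]) (x : A[T;T⁻¹]) :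
    actDer c D x = scaleT c (D (scaleT c⁻¹ x)) := by
  refine linearMap_eq (actDer c D : A[T;T⁻¹] →ₗ[k] A[T;T⁻¹])
    (scaleT c ∘ₗ (D : A[T;T⁻¹] →ₗ[k] A[T;T⁻¹]) ∘ₗ scaleT c⁻¹) (fun a j => ?_) x
  change weightDer _ D _ = scaleT c (D (weight _ _))
  rw [weightDer_apply, weight_C_mul_T, Derivation.map_smul, map_smul, scaleT, ← weight_const,
    weight_weight]
  congr 2
  funext n
  rw [← Units.val_mul, inv_zpow', ← zpow_add, neg_add_eq_sub]

lemma scaleT_mul (c : kˣ) (x y : A[T;T⁻¹]) : scaleT c (x * y) = scaleT c x * scaleT c y := by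
  induction x using LaurentPolynomial.induction_on' with
  | add p q hp hq => rw [add_mul, map_add, hp, hq, map_add, add_mul]
  | C_mul_T n a =>
    rw [scaleT, weight_mul, weight_C_mul_T, smul_mul_assoc, ← mul_smul_comm, ← map_smul,
      ← weight_const, weight_weight]
    congr 3
    funext m
    rw [zpow_add, Units.val_mul, mul_comm]

/-- The action of `c` on Laurent polynomials as a ring homomorphism. -/
def scaleTHom (c : kˣ) : A[T;T⁻¹] →+* A[T;T⁻¹] where
  toFun := scaleT c
  map_one' := by
    have := weight_C_mul_T (fun w => ((c ^ w : kˣ) : k)) (1 : A) 0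
    rwa [map_one, one_mul, T_zero, zpow_zero, Units.val_one, one_smul] at this
  map_mul' := scaleT_mul c
  map_zero' := map_zero _
  map_add' := map_add _

/-- The Euler derivation `T ∂/∂T`. -/
def euler : Derivation k A[T;T⁻¹] A[T;T⁻¹] :=
  derivationOfHomog (fun j => j • homogPart k j) (fun i j a b => by
    change (i + j) • (C (a * b) * T (i + j)) = C a * T i * (j • (C b * T j)) +
      C b * T j * (i • (C a * T i))
    rw [map_mul, T_add]
    simp only [zsmul_eq_mul]
    push_cast
    ring)

lemma euler_apply (a : A) (j : ℤ) : euler (k := k) (C a * T j) = j • (C a * T j) :=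
  derivationOfHomog_apply _ _ _ _

/-- The extension of a derivation of the coefficients that vanishes on `T`. -/
def horizontal (d : Derivation k A A) : Derivation k A[T;T⁻¹] A[T;T⁻¹] :=
  derivationOfHomog (fun j => homogPart k j ∘ₗ (d : A →ₗ[k] A)) (fun i j a b => by
    change C (d (a * b)) * T (i + j) = C a * T i * (C (d b) * T j) + C b * T j * (C (d a) * T i)
    rw [Derivation.leibniz, map_add, smul_eq_mul, smul_eq_mul, map_mul, map_mul, T_add]
    ring)

lemma horizontal_apply (d : Derivation k A A) (a : A) (j : ℤ) :
    horizontal d (C a * T j) = C (d a) * T j :=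
  derivationOfHomog_apply _ _ _ _

lemma actDer_euler (c : kˣ) : actDer c (euler : Derivation k A[T;T⁻¹] A[T;T⁻¹]) = euler :=
  derivation_ext fun a j => by
    rw [actDer, weightDer_apply, euler_apply, map_zsmul, weight_C_mul_T, sub_self, zpow_zero,
      Units.val_one, one_smul]

lemma actDer_horizontal (c : kˣ) (d : Derivation k A A) :
    actDer c (horizontal d) = horizontal d :=
  derivation_ext fun a j => by
    rw [actDer, weightDer_apply, horizontal_apply, weight_C_mul_T, sub_self, zpow_zero,
      Units.val_one, one_smul]

end CommRing

section Field

variable {k A : Type*} [Field k] [CharZero k] [CommRing A] [Algebra k A]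

variable (k) in
/-- The element `2` of `k^×`, which generates an infinite subgroup. -/
def two : kˣ := Units.mk0 2 two_ne_zero

lemma two_zpow_ne_one {n : ℤ} (hn : n ≠ 0) : ((two k ^ n : kˣ) : k) - 1 ≠ 0 := by
  rw [sub_ne_zero, Units.val_zpow_eq_zpow_val]
  change (2 : k) ^ n ≠ 1
  have h : ((2 : ℚ) ^ n) ≠ 1 := by
    rw [Ne, zpow_eq_one_iff_right₀ (by norm_num) (by norm_num)]
    exact hn
  have h' := (Rat.cast_injective (α := k)).ne h
  push_cast at h'
  exact h'

/-- The inverse of `2 ^ n - 1`, for `n ≠ 0`. -/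
def invTwo (k : Type*) [Field k] [CharZero k] (n : ℤ) : k := (((two k ^ n : kˣ) : k) - 1)⁻¹

/-- An invariant Laurent polynomial is constant. -/
lemma exists_C_of_scaleT_eq {x : A[T;T⁻¹]} (hx : scaleT (two k) x = x) : ∃ a, x = C a := by
  refine ⟨x.coeff 0, LaurentPolynomial.ext fun n => ?_⟩
  rw [C_apply]
  split_ifs with h
  · rw [h]
  · have h1 : ((two k ^ n : kˣ) : k) • x.coeff n = x.coeff n := by
      have := congrArg (fun y => y.coeff n) hx
      rwa [scaleT, coeff_weight] at this
    have h2 : (((two k ^ n : kˣ) : k) - 1) • x.coeff n = 0 := by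
      rw [sub_smul, h1, one_smul, sub_self]
    rw [← inv_smul_smul₀ (two_zpow_ne_one (k := k) h) (x.coeff n), h2, smul_zero]

omit [CharZero k] in
lemma sub_eq_weightDer (c : kˣ) (D : Derivation k A[T;T⁻¹] A[T;T⁻¹]) :
    actDer c D - D = weightDer (fun w => ((c ^ w : kˣ) : k) - 1) D := by
  have h1 := weightDer_add (fun w => ((c ^ w : kˣ) : k) - 1) (fun _ => 1) D
  rw [weightDer_const, one_smul] at h1
  rw [sub_eq_iff_eq_add, ← h1, actDer]
  congr 1
  funext w
  ring

/-- A derivation that is fixed by the action of `2` is homogeneous of degree `0`, hence fixed by the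
action of all scalars. -/
lemma actDer_eq_of_two {D : Derivation k A[T;T⁻¹] A[T;T⁻¹]} (h : actDer (two k) D = D) (c : kˣ) :
    actDer c D = D := by
  have h1 := sub_eq_weightDer (two k) D
  rw [h, sub_self] at h1
  rw [← sub_eq_zero, sub_eq_weightDer,
    ← weightDer_zero (fun w => (((c ^ w : kˣ) : k) - 1) * invTwo k w), h1, weightDer_weightDer]
  congr 1
  funext w
  by_cases hw : w = 0
  · simp [hw]
  · rw [mul_assoc, invTwo, inv_mul_cancel₀ (two_zpow_ne_one hw), mul_one]

/-- Zero is a semisimple eigenvalue of `g - 1`, where `g` is the action of `2` on derivations. -/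
lemma actDer_eq_of_sub {D : Derivation k A[T;T⁻¹] A[T;T⁻¹]}
    (h : actDer (two k) (actDer (two k) D - D) = actDer (two k) D - D) :
    actDer (two k) D = D := by
  have h1 := sub_eq_weightDer (two k) (actDer (two k) D - D)
  rw [h, sub_self, sub_eq_weightDer, weightDer_weightDer] at h1
  rw [← sub_eq_zero, sub_eq_weightDer, ← weightDer_zero (invTwo k), h1, weightDer_weightDer]
  congr 1
  funext w
  by_cases hw : w = 0
  · simp [hw]
  · rw [← mul_assoc, invTwo, inv_mul_cancel₀ (two_zpow_ne_one hw), one_mul]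

/-- Every derivation is the sum of an invariant derivation and one in the image of `g - 1`, where
`g` is the action of `2`. -/
lemma exists_decomposition (D : Derivation k A[T;T⁻¹] A[T;T⁻¹]) :
    ∃ D₀ D', actDer (two k) D₀ = D₀ ∧ D = D₀ + (actDer (two k) D' - D') := by
  refine ⟨weightDer (fun w => if w = 0 then 1 else 0) D, weightDer (invTwo k) D, ?_, ?_⟩
  · rw [actDer, weightDer_weightDer]
    congr 1
    funext w
    split_ifs with hw
    · simp [hw]
    · rw [mul_zero]
  · rw [sub_eq_weightDer, weightDer_weightDer, ← weightDer_add]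
    refine (one_smul k D).symm.trans ((weightDer_const 1 D).symm.trans ?_)
    congr 1
    funext w
    split_ifs with hw
    · simp [hw]
    · rw [invTwo, mul_inv_cancel₀ (two_zpow_ne_one hw), zero_add]

end Field

end LaurentDer

/-! ### Vector fields on the punctured cone in charts -/

/-- Transport of a derivation along an isomorphism of algebras. -/
def Derivation.conj {k R B : Type*} [CommRing k] [CommRing R] [CommRing B] [Algebra k R]
    [Algebra k B] (e : R ≃ₐ[k] B) (D : Derivation k R R) : Derivation k B B :=
  Derivation.mk' (e.toLinearMap ∘ₗ (D : R →ₗ[k] R) ∘ₗ e.symm.toLinearMap) fun x y => by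
    change e (D (e.symm (x * y))) = x * e (D (e.symm y)) + y * e (D (e.symm x))
    simp only [map_mul, Derivation.leibniz, smul_eq_mul, map_add, AlgEquiv.apply_symm_apply]

namespace AlgGeom

lemma VF.ext_cover {k : Type u} [Field k] {X : Scheme.{u}} [X.Over (Spec (.of k))] {ι : Type*}
    {U : ι → X.Opens} {W : X.Opens} (hU : ∀ x ∈ W, ∃ i, x ∈ U i) {D D' : vectorFields k X W}
    (h : ∀ i (V : X.Opens) (hV : V ≤ W) (_ : V ≤ U i) (f : Γ(X, V)),
      VF.ap D hV f = VF.ap D' hV f) : D = D' := by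
  refine VF.ext fun V hV f => ?_
  refine sections_ext (U := fun i => V ⊓ U i) (fun x hx => ?_) fun i hi => ?_
  · obtain ⟨i, hi⟩ := hU x (hV hx)
    exact ⟨i, ⟨hx, hi⟩, inf_le_left⟩
  · rw [VF.ap_res, VF.ap_res, h i _ _ inf_le_right]

lemma transportAp_pull {k : Type u} [Field k] {X : Scheme.{u}} [X.Over (Spec (.of k))] (σ : X ≅ X)
    [σ.hom.IsOver (Spec (.of k))] {U W W' : X.Opens} (D : vectorFields k X U) (hW : W ≤ U)
    (h₀ : W' ≤ σ.hom ⁻¹ᵁ U) (h : W' ≤ σ.hom ⁻¹ᵁ W) (f : Γ(X, W)) :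
    transportAp σ D h₀ (pull σ.hom W W' h f) = pull σ.hom W W' h (VF.ap D hW f) := by
  have hle : σ.inv ⁻¹ᵁ W' ≤ W := inv_le_of_le σ h
  have h2 : pull σ.inv W' (σ.inv ⁻¹ᵁ W') le_rfl (pull σ.hom W W' h f) = res hle f := by
    refine (pull_pull _ _ _ _ _ _ _ _).trans ?_
    refine (pull_congr σ.inv_hom_id W _ _ hle f).trans ?_
    have := res_pull (𝟙 X) W W _ le_rfl hle f
    exact this.symm.trans (congrArg _ (pull_id W _ f))
  rw [transportAp, h2, ← VF.ap_res D hW, pull_res]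

lemma transportAp_eq {k : Type u} [Field k] {X : Scheme.{u}} [X.Over (Spec (.of k))] (σ : X ≅ X)
    {W : X.Opens} (D : vectorFields k X W) {V : X.Opens} (h : V ≤ σ.hom ⁻¹ᵁ W) (hV : V ≤ W)
    (h₁ : V ≤ σ.hom ⁻¹ᵁ V) (h₂ : V ≤ σ.inv ⁻¹ᵁ V) (f : Γ(X, V)) :
    transportAp σ D h f = pull σ.hom V V h₁ (VF.ap D hV (pull σ.inv V V h₂ f)) := by
  rw [transportAp, ← res_pull σ.inv V _ V le_rfl h₂, ← VF.ap_res D (inv_le_of_le σ h), pull_res]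

namespace LineBundle

open LaurentPolynomial LaurentDer

variable {k : Type u} [Field k] {Y : Scheme.{u}} {L : LineBundle Y} [Y.Over (Spec (.of k))]
  [IsIntegral Y]

lemma Chart.isIntegral_puncturedCone (b : L.Chart k) : IsIntegral (L.puncturedCone k) := by
  have : (PrimeSpectrum.basicOpen b.elt : Set (PrimeSpectrum (L.SectionRing k))).Nonempty := by
    refine ⟨⟨⊥, Ideal.isPrime_bot⟩, fun h => ?_⟩
    have h1 := b.isUnit_ev_elt
    rw [Ideal.mem_bot.mp h, map_zero, isUnit_zero_iff] at h1
    have h2 := congrArg b.toConeField h1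
    rw [map_zero, map_one] at h2
    exact zero_ne_one h2
  obtain ⟨x, hx⟩ := this
  have hx' : x ∈ L.coneOpen k := fun h => hx (h b.elt_mem_irrelevant)
  have : Nonempty (L.puncturedCone k) := ⟨⟨x, hx'⟩⟩
  exact isIntegral_of_isOpenImmersion (L.incl k)

variable [CompactSpace Y]

section

variable (b : L.Chart k)

/-- Functions on the image of a chart are Laurent polynomials. -/
def Chart.coneEquiv : Γ(L.puncturedCone k, b.coneDom) ≃ₐ[k] Γ(Y, b.dom)[T;T⁻¹] :=
  AlgEquiv.ofBijective { b.coneFn with commutes' := b.coneFn_algebraMap } b.coneFn_bijective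

lemma Chart.coneEquiv_apply (f : Γ(L.puncturedCone k, b.coneDom)) : b.coneEquiv f = b.coneFn f :=
  rfl

variable {W : (L.puncturedCone k).Opens} (h : b.coneDom ≤ W)

/-- The derivation of the ring of functions of a chart given by a vector field. -/
def Chart.der (D : vectorFields k (L.puncturedCone k) W) :
    Derivation k Γ(Y, b.dom)[T;T⁻¹] Γ(Y, b.dom)[T;T⁻¹] :=
  (D.1 ⟨b.coneDom, h⟩).conj b.coneEquiv

lemma Chart.der_coneFn (D : vectorFields k (L.puncturedCone k) W)
    (f : Γ(L.puncturedCone k, b.coneDom)) :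
    b.der h D (b.coneFn f) = b.coneFn (VF.ap D h f) := by
  change b.coneEquiv (D.1 ⟨b.coneDom, h⟩ (b.coneEquiv.symm (b.coneEquiv f))) = _
  rw [AlgEquiv.symm_apply_apply]
  rfl

lemma Chart.der_eq_iff (D : vectorFields k (L.puncturedCone k) W)
    (d : Derivation k Γ(Y, b.dom)[T;T⁻¹] Γ(Y, b.dom)[T;T⁻¹]) :
    b.der h D = d ↔ ∀ f, b.coneFn (VF.ap D h f) = d (b.coneFn f) := by
  constructor
  · rintro rfl f
    exact (b.der_coneFn h D f).symm
  · intro H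
    refine Derivation.ext fun x => ?_
    obtain ⟨f, rfl⟩ := b.coneFn_bijective.2 x
    rw [b.der_coneFn, H]

lemma Chart.der_add (D D' : vectorFields k (L.puncturedCone k) W) :
    b.der h (D + D') = b.der h D + b.der h D' :=
  (b.der_eq_iff h _ _).mpr fun f => by
    rw [VF.add_ap, map_add, Derivation.add_apply, b.der_coneFn, b.der_coneFn]

lemma Chart.der_sub (D D' : vectorFields k (L.puncturedCone k) W) :
    b.der h (D - D') = b.der h D - b.der h D' :=
  (b.der_eq_iff h _ _).mpr fun f => by
    rw [VF.sub_ap, map_sub, Derivation.sub_apply, b.der_coneFn, b.der_coneFn]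

lemma Chart.der_res {W' : (L.puncturedCone k).Opens} (hW : W ≤ W')
    (D : vectorFields k (L.puncturedCone k) W') :
    b.der h (vectorFieldsRes k _ hW D) = b.der (h.trans hW) D := rfl

lemma Chart.ap_eq_of_der_eq {D D' : vectorFields k (L.puncturedCone k) W}
    (e : b.der h D = b.der h D') {V : (L.puncturedCone k).Opens} (hV : V ≤ W)
    (hVb : V ≤ b.coneDom) (f : Γ(L.puncturedCone k, V)) : VF.ap D hV f = VF.ap D' hV f := by
  have : vectorFieldsRes k _ h D = vectorFieldsRes k _ h D' := by
    refine VF.ext_affine b.isAffineOpen_coneDom fun f => b.coneFn_bijective.1 ?_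
    refine (b.der_coneFn h D f).symm.trans ?_
    rw [e]
    exact b.der_coneFn h D' f
  exact VF.ap_congr this hVb f

lemma Chart.exists_der_eq (hW : W ≤ b.coneDom)
    (d : Derivation k Γ(Y, b.dom)[T;T⁻¹] Γ(Y, b.dom)[T;T⁻¹]) :
    ∃ D : vectorFields k (L.puncturedCone k) W, b.der h D = d := by
  obtain ⟨D, hD⟩ := VF.exists_of_derivation b.isAffineOpen_coneDom (d.conj b.coneEquiv.symm)
  refine ⟨vectorFieldsRes k _ hW D, (b.der_eq_iff _ _ _).mpr fun f => ?_⟩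
  rw [VF.ap_vectorFieldsRes, hD]
  exact b.coneEquiv.apply_symm_apply _

/-- The action of `c` on the functions of a chart. -/
lemma Chart.coneFn_scale (c : kˣ) (hc : b.coneDom ≤ L.scale k c ⁻¹ᵁ b.coneDom)
    (f : Γ(L.puncturedCone k, b.coneDom)) :
    b.coneFn (pull (L.scale k c) _ _ hc f) = scaleT c (b.coneFn f) := by
  let := b.ev.toAlgebra
  have := b.isLocalization
  have key : (b.coneFn.comp (pull (L.scale k c) _ _ hc)).comp
      (b.coneEquiv.symm : Γ(Y, b.dom)[T;T⁻¹] →+* _) = scaleTHom c := by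
    refine IsLocalization.ringHom_ext (Submonoid.powers b.elt) (ringHom_ext_homog fun m s => ?_)
    change b.coneFn (pull (L.scale k c) _ _ hc (b.coneEquiv.symm (b.ev (L.homog k m s)))) =
      scaleT c (b.ev (L.homog k m s))
    rw [← b.coneFn_fn, ← b.coneEquiv_apply (L.fn k _ _), AlgEquiv.symm_apply_apply, pull_scale_fn,
      b.coneFn_fn, b.coneEquiv_apply, b.coneFn_fn, scaleHom_homog, map_mul, ev_algebraMap, ev_homog,
      scaleT, weight_C_mul_T, LaurentDer.smul_eq, zpow_natCast, Units.val_pow_eq_pow_val]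
  have := congrArg (fun φ => φ (b.coneEquiv f)) key
  refine .trans ?_ this
  change _ = b.coneFn (pull (L.scale k c) _ _ hc (b.coneEquiv.symm (b.coneEquiv f)))
  rw [AlgEquiv.symm_apply_apply]

end

variable {π : L.puncturedCone k ⟶ Y} (hπ : L.IsProjection k π)

omit [IsIntegral Y] [CompactSpace Y] in
include hπ in
lemma IsProjection.hasCoords : HasCoords π := by
  obtain ⟨t, ht⟩ := hπ.exists_trivialisation
  exact ⟨t, fun i m s => ht m s i⟩

section

include hπ

lemma IsProjection.preimage_dom (b : L.Chart k) : π ⁻¹ᵁ b.dom = b.coneDom :=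
  hπ.hasCoords.preimage_dom b

lemma IsProjection.coneDom_le (b : L.Chart k) {V : Y.Opens} (hV : b.dom ≤ V) :
    b.coneDom ≤ π ⁻¹ᵁ V :=
  (hπ.preimage_dom b).ge.trans (preimage_mono π hV)

omit [IsIntegral Y] [CompactSpace Y] in
lemma IsProjection.scale_preimage (c : kˣ) (V : Y.Opens) :
    L.scale k c ⁻¹ᵁ (π ⁻¹ᵁ V) = π ⁻¹ᵁ V := preimage_congr (hπ.scale_comp c) V

lemma IsProjection.coneDom_le_scale (c : kˣ) (b : L.Chart k) :
    b.coneDom ≤ L.scale k c ⁻¹ᵁ b.coneDom := by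
  rw [← hπ.preimage_dom b]
  exact (hπ.scale_preimage c b.dom).ge

lemma IsProjection.exists_chart (hL : L.IsAmple k) {V : Y.Opens} {x : L.puncturedCone k}
    (hx : x ∈ π ⁻¹ᵁ V) : ∃ b : L.Chart k, x ∈ b.coneDom ∧ b.dom ≤ V := by
  obtain ⟨i, hi⟩ := L.exists_mem_V (π x)
  obtain ⟨b, -, hb, hbV⟩ := L.exists_chart hL (V := V ⊓ L.V i) inf_le_right ⟨hx, hi⟩
  exact ⟨b, (hπ.preimage_dom b).le hb, hbV.trans inf_le_left⟩

lemma IsProjection.ext_charts (hL : L.IsAmple k) {V : Y.Opens}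
    {D D' : vectorFields k (L.puncturedCone k) (π ⁻¹ᵁ V)}
    (h : ∀ (b : L.Chart k) (hb : b.dom ≤ V), b.der (hπ.coneDom_le b hb) D =
      b.der (hπ.coneDom_le b hb) D') : D = D' := by
  refine VF.ext_cover (U := fun b : {b : L.Chart k // b.dom ≤ V} => b.1.coneDom) (fun x hx => ?_)
    fun b V' hV' hVb f => b.1.ap_eq_of_der_eq _ (h b.1 b.2) hV' hVb f
  obtain ⟨b, hxb, hb⟩ := hπ.exists_chart hL hx
  exact ⟨⟨b, hb⟩, hxb⟩

end

/-- The action of `c` on the vector fields on `π⁻¹ V`. -/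
def IsProjection.act (c : kˣ) (V : Y.Opens) : vectorFields k (L.puncturedCone k) (π ⁻¹ᵁ V) →ₗ[k]
    vectorFields k (L.puncturedCone k) (π ⁻¹ᵁ V) :=
  vectorFieldsRes k _ (hπ.scale_preimage c V).ge ∘ₗ transport (L.scaleIso k c) (π ⁻¹ᵁ V)

omit [IsIntegral Y] [CompactSpace Y] in
lemma IsProjection.act_ap (c : kˣ) {V : Y.Opens}
    (D : vectorFields k (L.puncturedCone k) (π ⁻¹ᵁ V)) {W : (L.puncturedCone k).Opens}
    (hW : W ≤ π ⁻¹ᵁ V) (f : Γ(L.puncturedCone k, W)) :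
    VF.ap (hπ.act c V D) hW f =
      transportAp (L.scaleIso k c) D (hW.trans (hπ.scale_preimage c V).ge) f := rfl

omit [IsIntegral Y] [CompactSpace Y] in
lemma IsProjection.act_eq_of_mem {V : Y.Opens}
    {D : vectorFields k (L.puncturedCone k) (π ⁻¹ᵁ V)} (hD : D ∈ invariantFields (L.scale k) π V)
    (c : kˣ) : hπ.act c V D = D := by
  refine VF.ext fun W hW f => ?_
  have h1 := hD c _ W (inv_le_of_le (L.scaleIso k c) (hW.trans (hπ.scale_preimage c V).ge)) hW
    (le_hom_inv (L.scaleIso k c) W)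
    (pull (L.scaleIso k c).inv W ((L.scaleIso k c).inv ⁻¹ᵁ W) le_rfl f)
  have h2 : pull (L.scale k c) _ W (le_hom_inv (L.scaleIso k c) W)
    (pull (L.scaleIso k c).inv W ((L.scaleIso k c).inv ⁻¹ᵁ W) le_rfl f) = f :=
    pull_hom_inv (L.scaleIso k c) W f
  exact (hπ.act_ap c D hW f).trans (h1.trans (congrArg _ h2))

omit [IsIntegral Y] [CompactSpace Y] in
lemma IsProjection.mem_of_act_eq {V : Y.Opens}
    {D : vectorFields k (L.puncturedCone k) (π ⁻¹ᵁ V)} (hD : ∀ c, hπ.act c V D = D) :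
    D ∈ invariantFields (L.scale k) π V := by
  intro c W W' hW hW' h f
  have h0 : W' ≤ (L.scaleIso k c).hom ⁻¹ᵁ (π ⁻¹ᵁ V) := hW'.trans (hπ.scale_preimage c V).ge
  have h1 : transportAp (L.scaleIso k c) D h0 (pull (L.scale k c) W W' h f) =
      VF.ap D hW' (pull (L.scale k c) W W' h f) := VF.ap_congr (hD c) hW' _
  exact (transportAp_pull (L.scaleIso k c) D hW h0 h f).symm.trans h1

omit [IsIntegral Y] [CompactSpace Y] in
lemma IsProjection.mem_invariantFields_iff {V : Y.Opens}
    (D : vectorFields k (L.puncturedCone k) (π ⁻¹ᵁ V)) :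
    D ∈ invariantFields (L.scale k) π V ↔ ∀ c, hπ.act c V D = D :=
  ⟨hπ.act_eq_of_mem, hπ.mem_of_act_eq⟩

lemma IsProjection.der_act (c : kˣ) {V : Y.Opens} (b : L.Chart k) (h : b.coneDom ≤ π ⁻¹ᵁ V)
    (D : vectorFields k (L.puncturedCone k) (π ⁻¹ᵁ V)) :
    b.der h (hπ.act c V D) = actDer c (b.der h D) := by
  refine (b.der_eq_iff h _ _).mpr fun f => ?_
  change b.coneFn (transportAp (L.scaleIso k c) D (h.trans (hπ.scale_preimage c V).ge) f) = _
  rw [transportAp_eq (L.scaleIso k c) D _ h (hπ.coneDom_le_scale c b) (hπ.coneDom_le_scale c⁻¹ b)]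
  refine (b.coneFn_scale c _ _).trans ?_
  rw [← b.der_coneFn, actDer_apply]
  congr 2
  exact b.coneFn_scale c⁻¹ _ _

variable [CharZero k] (hL : L.IsAmple k)

include hL

lemma IsProjection.mem_invariantFields_of_two {V : Y.Opens}
    {D : vectorFields k (L.puncturedCone k) (π ⁻¹ᵁ V)} (hD : hπ.act (two k) V D = D) :
    D ∈ invariantFields (L.scale k) π V := by
  refine (hπ.mem_invariantFields_iff D).mpr fun c => hπ.ext_charts hL fun b hb => ?_
  rw [hπ.der_act]
  refine actDer_eq_of_two ?_ c
  rw [← hπ.der_act, hD]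

lemma IsProjection.act_eq_of_sub {V : Y.Opens} {D : vectorFields k (L.puncturedCone k) (π ⁻¹ᵁ V)}
    (hD : hπ.act (two k) V (hπ.act (two k) V D - D) = hπ.act (two k) V D - D) :
    hπ.act (two k) V D = D := by
  refine hπ.ext_charts hL fun b hb => ?_
  rw [hπ.der_act]
  refine actDer_eq_of_sub ?_
  rw [← hπ.der_act, ← Chart.der_sub, ← hπ.der_act, hD]

omit hL in
lemma IsProjection.exists_decomposition (b : L.Chart k)
    (D : vectorFields k (L.puncturedCone k) (π ⁻¹ᵁ b.dom)) :
    ∃ D₀ D', hπ.act (two k) b.dom D₀ = D₀ ∧ D = D₀ + (hπ.act (two k) b.dom D' - D') := by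
  have h := (hπ.preimage_dom b).ge
  have h' := (hπ.preimage_dom b).le
  have hext : ∀ D D' : vectorFields k (L.puncturedCone k) (π ⁻¹ᵁ b.dom), b.der h D = b.der h D' →
      D = D' := fun D D' e => VF.ext fun V hV f => b.ap_eq_of_der_eq h e hV (hV.trans h') f
  obtain ⟨d₀, d', h₀, hd⟩ := LaurentDer.exists_decomposition (b.der h D)
  obtain ⟨D₀, rfl⟩ := b.exists_der_eq h h' d₀
  obtain ⟨D', rfl⟩ := b.exists_der_eq h h' d'
  refine ⟨D₀, D', hext _ _ ?_, hext _ _ ?_⟩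
  · rw [hπ.der_act, h₀]
  · rw [Chart.der_add, Chart.der_sub, hπ.der_act, hd]

end LineBundle

end AlgGeom

/-! ### Short exact sequences of sheaves from sections -/

namespace SheafCoh

variable {k : Type u} [Field k] {X : TopCat.{u}} {F G : TopCat.Sheaf (ModuleCat.{u} k) X}

lemma hom_ext_sapp {φ ψ : F ⟶ G} (h : ∀ W x, sapp φ W x = sapp ψ W x) : φ = ψ := by
  apply (sheafToPresheaf _ _).map_injective
  ext W x
  exact h W.unop x

lemma epi_of_locally_surjective (φ : F ⟶ G)
    (h : ∀ (W : Opens X) (q : G.obj.obj (op W)) (x : X), x ∈ W → ∃ (V : Opens X) (hV : V ≤ W)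
      (s : F.obj.obj (op V)), x ∈ V ∧ sapp φ V s = sres G hV q) : Epi φ := by
  refine (TopCat.Sheaf.isLocallySurjective_iff_epi φ).mp
    ((TopCat.Presheaf.isLocallySurjective_iff _).mpr fun W q x hx => ?_)
  obtain ⟨V, hV, s, hx', hs⟩ := h W q x hx
  exact ⟨V, hV, ⟨s, hs⟩, hx'⟩

lemma shortExact_of_sections {S : ShortComplex (TopCat.Sheaf (ModuleCat.{u} k) X)}
    (hf : ∀ W, Function.Injective (sapp S.f W))
    (hex : ∀ (W : Opens X) (s : S.X₂.obj.obj (op W)), sapp S.g W s = 0 → ∀ x ∈ W,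
      ∃ (V : Opens X) (hV : V ≤ W) (r : S.X₁.obj.obj (op V)), x ∈ V ∧ sapp S.f V r = sres S.X₂ hV s)
    (hg : ∀ (W : Opens X) (q : S.X₃.obj.obj (op W)) (x : X), x ∈ W → ∃ (V : Opens X) (hV : V ≤ W)
      (s : S.X₂.obj.obj (op V)), x ∈ V ∧ sapp S.g V s = sres S.X₃ hV q) : S.ShortExact where
  mono_f := mono_of_injective _ hf
  epi_g := epi_of_locally_surjective _ hg
  exact := by
    rw [ShortComplex.exact_iff_epi_kernel_lift]
    have hι : ∀ W, Function.Injective (sapp (kernel.ι S.g) W) := fun W =>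
      injective_of_mono (kernel.ι S.g) W
    refine epi_of_locally_surjective _ fun W q x hx => ?_
    obtain ⟨V, hV, r, hxV, hr⟩ := hex W (sapp (kernel.ι S.g) W q)
      (by rw [← sapp_comp, kernel.condition]; rfl) x hx
    refine ⟨V, hV, r, hxV, hι V ?_⟩
    rw [← sapp_comp, kernel.lift_ι, hr, sapp_sres]

end SheafCoh

/-! ### The Euler sequence -/

namespace LaurentDer

open LaurentPolynomial

variable {k A : Type*} [CommRing k] [CommRing A] [Algebra k A]

lemma actDer_smul (c : kˣ) (a : A) (D : Derivation k A[T;T⁻¹] A[T;T⁻¹]) :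
    actDer c ((C a : A[T;T⁻¹]) • D) = (C a : A[T;T⁻¹]) • actDer c D :=
  derivation_ext fun b j => by
    have h : ∀ μ : ℤ → k, ∀ y : A[T;T⁻¹], weight μ (C a * y) = C a * weight μ y := fun μ y => by
      have := weight_mul μ a 0 y
      simpa only [T_zero, mul_one, zero_add] using this
    rw [Derivation.smul_apply, actDer, actDer, weightDer_apply, weightDer_apply,
      Derivation.smul_apply, smul_eq_mul, smul_eq_mul, h]

lemma C_injective : Function.Injective (C : A →+* A[T;T⁻¹]) := fun a b h => by
  have := congrArg (fun x : A[T;T⁻¹] => x.coeff 0) h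
  simpa [C_apply] using this

lemma euler_C (a : A) : euler (k := k) (C a) = 0 := by
  have := euler_apply (k := k) a 0
  rwa [T_zero, mul_one, zero_smul] at this

lemma euler_T : euler (k := k) (T 1 : A[T;T⁻¹]) = T 1 := by
  have := euler_apply (k := k) (1 : A) 1
  rwa [map_one, one_mul, one_smul] at this

lemma horizontal_C (d : Derivation k A A) (a : A) : horizontal d (C a) = C (d a) := by
  have := horizontal_apply d a 0
  rwa [T_zero, mul_one, mul_one] at this

lemma scaleT_T (c : kˣ) (n : ℤ) : scaleT c (T n : A[T;T⁻¹]) = ((c ^ n : kˣ) : k) • T n := by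
  have := weight_C_mul_T (fun w => ((c ^ w : kˣ) : k)) (1 : A) n
  rwa [map_one, one_mul] at this

end LaurentDer

namespace LaurentDer

open LaurentPolynomial

variable {k A : Type*} [Field k] [CharZero k] [CommRing A] [Algebra k A]

/-- An invariant derivation that vanishes on the coefficients is a multiple of `T ∂/∂T`. -/
lemma exists_eq_smul_euler {D : Derivation k A[T;T⁻¹] A[T;T⁻¹]} (hD : actDer (two k) D = D)
    (h : ∀ a, D (C a) = 0) : ∃ a : A, D = (C a : A[T;T⁻¹]) • euler := by
  have h1 : scaleT (two k) (D (T 1)) = ((two k : kˣ) : k) • D (T 1) := by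
    have h2 := actDer_apply (two k) D (T 1)
    rw [hD, scaleT_T, zpow_one, Derivation.map_smul, map_smul] at h2
    rw [h2, smul_smul, Units.mul_inv, one_smul, ← h2]
  obtain ⟨a, ha⟩ : ∃ a, D (T 1) * T (-1) = C a := by
    refine exists_C_of_scaleT_eq (k := k) ?_
    rw [scaleT_mul, h1, scaleT_T, smul_mul_smul_comm, zpow_neg_one, Units.mul_inv, one_smul]
  refine ⟨a, derivation_ext_gen (fun b => ?_) ?_⟩
  · rw [h, Derivation.smul_apply, euler_C (k := k), smul_zero]
  · rw [Derivation.smul_apply, euler_T, smul_eq_mul, ← ha, mul_assoc, ← T_add, neg_add_cancel,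
      T_zero, mul_one]

end LaurentDer

namespace AlgGeom

namespace LineBundle

open LaurentPolynomial LaurentDer

variable {k : Type u} [Field k] {Y : Scheme.{u}} {L : LineBundle Y} [Y.Over (Spec (.of k))]
  [IsIntegral Y] [CompactSpace Y]

lemma Chart.derivation_ext_ev (b : L.Chart k)
    {d d' : Derivation k Γ(Y, b.dom)[T;T⁻¹] Γ(Y, b.dom)[T;T⁻¹]}
    (h : ∀ m s, d (b.ev (L.homog k m s)) = d' (b.ev (L.homog k m s))) : d = d' := by
  let := b.ev.toAlgebra
  have := b.isLocalization
  refine Derivation.ext fun x => ?_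
  refine derivation_localization_ext b.elt (RingHom.id _) d d' (fun r => ?_) x
  change d (b.ev r) = d' (b.ev r)
  rw [sum_homog r, map_sum, map_sum, map_sum]
  exact Finset.sum_congr rfl fun n _ => h _ _

variable (b : L.Chart k) {W : (L.puncturedCone k).Opens} (h : b.coneDom ≤ W)

lemma Chart.der_eq_euler_iff (D : vectorFields k (L.puncturedCone k) W) :
    b.der h D = euler ↔ ∀ m s, VF.ap D h (L.fn k b.coneDom (L.homog k m s)) =
      (m : Γ(L.puncturedCone k, b.coneDom)) * L.fn k b.coneDom (L.homog k m s) := by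
  have key : ∀ m s, euler (k := k) (b.ev (L.homog k m s)) =
      b.coneFn ((m : Γ(L.puncturedCone k, b.coneDom)) * L.fn k b.coneDom (L.homog k m s)) := by
    intro m s
    rw [map_mul, map_natCast, b.coneFn_fn, ev_homog, euler_apply, natCast_zsmul, nsmul_eq_mul]
  constructor
  · intro hD m s
    apply b.coneFn_bijective.1
    rw [← b.der_coneFn, hD, b.coneFn_fn, key]
  · intro hD
    refine b.derivation_ext_ev fun m s => ?_
    rw [key, ← b.coneFn_fn, b.der_coneFn, hD]

lemma Chart.der_smul (f : Γ(L.puncturedCone k, W)) (D : vectorFields k (L.puncturedCone k) W) :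
    b.der h (VF.smul f D) = b.coneFn (res h f) • b.der h D :=
  (b.der_eq_iff h _ _).mpr fun g => by
    rw [VF.ap_smul, map_mul, Derivation.smul_apply, b.der_coneFn, smul_eq_mul]

variable {π : L.puncturedCone k ⟶ Y} (hπ : L.IsProjection k π) (hL : L.IsAmple k)

include hπ in
lemma IsProjection.coneFn_pull {V : Y.Opens} (hb : b.dom ≤ V) (a : Γ(Y, V)) :
    b.coneFn (pull π V b.coneDom (hπ.coneDom_le b hb) a) = C (res hb a) := by
  rw [← hπ.hasCoords.coneFn_pull b (hπ.preimage_dom b).ge, pull_res]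

include hπ hL in
/-- The existence of the Euler vector field. -/
lemma IsProjection.exists_euler : ∃ E : vectorFields k (L.puncturedCone k) ⊤,
    ∀ (W : (L.puncturedCone k).Opens) (m : ℕ) (s : L.sections k m),
      VF.ap E (le_top : W ≤ ⊤) (L.fn k W (L.homog k m s)) =
        (m : Γ(L.puncturedCone k, W)) * L.fn k W (L.homog k m s) := by
  choose E hE using fun b : L.Chart k => b.exists_der_eq le_rfl le_rfl (euler (k := k))
  have hE' : ∀ (b : L.Chart k) (W : (L.puncturedCone k).Opens) (hW : W ≤ b.coneDom) (m : ℕ)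
      (s : L.sections k m), VF.ap (E b) hW (L.fn k W (L.homog k m s)) =
        (m : Γ(L.puncturedCone k, W)) * L.fn k W (L.homog k m s) := fun b W hW m s => by
    have h1 := (b.der_eq_euler_iff le_rfl (E b)).mp (hE b) m s
    rw [← res_fn hW, ← VF.ap_res (E b) le_rfl hW, h1, map_mul, map_natCast]
  have hcov : ∀ x : L.puncturedCone k, ∃ b : L.Chart k, x ∈ b.coneDom := fun x =>
    let ⟨b, hb, _⟩ := hπ.exists_chart hL (V := ⊤) (x := x) trivial
    ⟨b, hb⟩
  have hglue : ∀ (b b' : L.Chart k) (V : (L.puncturedCone k).Opens) (hb : V ≤ b.coneDom)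
      (hb' : V ≤ b'.coneDom) (f : Γ(L.puncturedCone k, V)),
      VF.ap (E b) hb f = VF.ap (E b') hb' f := by
    intro b b' V hb hb' f
    have : vectorFieldsRes k _ (inf_le_left : b.coneDom ⊓ b'.coneDom ≤ b.coneDom) (E b) =
        vectorFieldsRes k _ (inf_le_right : b.coneDom ⊓ b'.coneDom ≤ b'.coneDom) (E b') := by
      refine VF.ext_cover (ι := {c : L.Chart k // c.coneDom ≤ b.coneDom ⊓ b'.coneDom})
        (U := fun c => c.1.coneDom) (fun x hx => ?_) fun c V' hV' hVc f' => ?_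
      · have hx' : x ∈ π ⁻¹ᵁ (b.dom ⊓ b'.dom) :=
          ⟨(hπ.preimage_dom b).ge hx.1, (hπ.preimage_dom b').ge hx.2⟩
        obtain ⟨c, hc, hcb⟩ := hπ.exists_chart hL hx'
        refine ⟨⟨c, ?_⟩, hc⟩
        rw [← hπ.preimage_dom b, ← hπ.preimage_dom b', ← hπ.preimage_dom c]
        exact preimage_mono π hcb
      · refine c.1.ap_eq_of_der_eq c.2 (.trans (b := euler) ?_ (.symm ?_)) hV' hVc f'
        · exact (c.1.der_eq_euler_iff _ _).mpr fun m s => hE' b _ _ m s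
        · exact (c.1.der_eq_euler_iff _ _).mpr fun m s => hE' b' _ _ m s
    exact VF.ap_congr this (le_inf hb hb') f
  obtain ⟨D, hD, -⟩ := VF.existsUnique_glue E hglue
  have htop : (⊤ : (L.puncturedCone k).Opens) ≤ ⨆ b : L.Chart k, b.coneDom := fun x _ =>
    Opens.mem_iSup.mpr (hcov x)
  refine ⟨vectorFieldsRes k _ htop D, fun W m s => ?_⟩
  refine sections_ext (U := fun b : L.Chart k => W ⊓ b.coneDom) (fun x hx => ?_) fun b hb => ?_
  · obtain ⟨b, hb⟩ := hcov x
    exact ⟨b, ⟨hx, hb⟩, inf_le_left⟩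
  · rw [VF.ap_res, map_mul, map_natCast, res_fn]
    exact (VF.ap_congr (hD b) inf_le_right _).trans (hE' b _ _ m s)

/-- The Euler vector field. -/
def IsProjection.eulerField : vectorFields k (L.puncturedCone k) ⊤ := (hπ.exists_euler hL).choose

lemma IsProjection.eulerField_fn (W : (L.puncturedCone k).Opens) (m : ℕ) (s : L.sections k m) :
    VF.ap (hπ.eulerField hL) (le_top : W ≤ ⊤) (L.fn k W (L.homog k m s)) =
        (m : Γ(L.puncturedCone k, W)) * L.fn k W (L.homog k m s) :=
  (hπ.exists_euler hL).choose_spec W m s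

lemma IsProjection.der_eulerField : b.der le_top (hπ.eulerField hL) = euler :=
  (b.der_eq_euler_iff _ _).mpr fun m s => hπ.eulerField_fn hL _ m s

/-- The multiple `π^#(a) E` of the Euler vector field. -/
def IsProjection.eulerMul (V : Y.Opens) (a : Γ(Y, V)) :
    vectorFields k (L.puncturedCone k) (π ⁻¹ᵁ V) :=
  VF.smul (pull π V (π ⁻¹ᵁ V) le_rfl a) (vectorFieldsRes k _ le_top (hπ.eulerField hL))

lemma IsProjection.der_eulerMul {V : Y.Opens} (hb : b.dom ≤ V) (a : Γ(Y, V)) :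
    b.der (hπ.coneDom_le b hb) (hπ.eulerMul hL V a) =
      (C (res hb a) : Γ(Y, b.dom)[T;T⁻¹]) • euler := by
  rw [eulerMul, b.der_smul, res_pull, hπ.coneFn_pull b hb, b.der_res, hπ.der_eulerField]

lemma IsProjection.eulerMul_mem (V : Y.Opens) (a : Γ(Y, V)) :
    hπ.eulerMul hL V a ∈ invariantFields (k := k) (L.scale k) π V :=
  (hπ.mem_invariantFields_iff _).mpr fun c => hπ.ext_charts hL fun b hb => by
    rw [hπ.der_act, hπ.der_eulerMul b hL hb, actDer_smul, actDer_euler]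

omit [IsIntegral Y] [CompactSpace Y] in
include hπ in
lemma IsProjection.pull_smul (V : Y.Opens) (c : k) (a : Γ(Y, V)) :
    pull π V (π ⁻¹ᵁ V) le_rfl (c • a) = c • pull π V (π ⁻¹ᵁ V) le_rfl a :=
  have := hπ.isOver
  AlgGeom.pull_smul π V _ _ c a

/-- The linear map `a ↦ π^#(a) E` on sections. -/
def IsProjection.eulerLin (V : Y.Opens) :
    Γ(Y, V) →ₗ[k] invariantFields (k := k) (L.scale k) π V where
  toFun a := ⟨hπ.eulerMul hL V a, hπ.eulerMul_mem hL _ a⟩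
  map_add' a a' := Subtype.ext <| VF.ext fun W hW f => by
    change res hW (pull π _ _ _ (a + a')) * _ = res hW _ * _ + res hW _ * _
    rw [map_add, map_add, add_mul]
  map_smul' c a := Subtype.ext <| VF.ext fun W hW f => by
    change res hW (pull π _ _ _ (c • a)) * _ = c • (res hW _ * _)
    rw [hπ.pull_smul, res_smul, smul_mul_assoc]

lemma IsProjection.eulerMul_res {V V' : Y.Opens} (h : V' ≤ V) (a : Γ(Y, V)) :
    hπ.eulerMul hL V' (res h a) =
      vectorFieldsRes k _ (preimage_mono π h) (hπ.eulerMul hL V a) := by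
  rw [eulerMul, eulerMul, VF.smul_res, res_pull, pull_res]
  rfl

/-- The map `a ↦ π^#(a) E`. -/
def IsProjection.eulerHom : structureSheaf k Y ⟶ hπ.weightZero :=
  ObjectProperty.homMk
    { app V := ModuleCat.ofHom (hπ.eulerLin hL V.unop)
      naturality _ _ i := ModuleCat.hom_ext <| LinearMap.ext fun a =>
        Subtype.ext (hπ.eulerMul_res hL i.unop.le a) }

lemma IsProjection.isEulerMap_eulerHom : hπ.IsEulerMap (hπ.eulerHom hL) := by
  intro V a W hW m s
  change res hW (pull π V _ _ a) * VF.ap (hπ.eulerField hL) le_top _ = _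
  rw [hπ.eulerField_fn, res_pull]

end LineBundle

end AlgGeom

namespace AlgGeom

namespace LineBundle

open SheafCoh LaurentPolynomial LaurentDer

variable {k : Type u} [Field k] {Y : Scheme.{u}} {L : LineBundle Y} [Y.Over (Spec (.of k))]
  [IsIntegral Y] [CompactSpace Y] {π : L.puncturedCone k ⟶ Y} (hπ : L.IsProjection k π)
  (hL : L.IsAmple k)

include hL in
lemma exists_chart_le {V : Y.Opens} {y : Y} (hy : y ∈ V) :
    ∃ b : L.Chart k, y ∈ b.dom ∧ b.dom ≤ V := by
  obtain ⟨i, hi⟩ := L.exists_mem_V y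
  obtain ⟨b, -, hb, hbV⟩ := L.exists_chart hL (V := V ⊓ L.V i) inf_le_right ⟨hy, hi⟩
  exact ⟨b, hb, hbV.trans inf_le_left⟩

include hL in
lemma sections_ext_charts {V : Y.Opens} {a a' : Γ(Y, V)}
    (h : ∀ (b : L.Chart k) (hb : b.dom ≤ V), res hb a = res hb a') : a = a' := by
  refine sections_ext (U := fun b : {b : L.Chart k // b.dom ≤ V} => b.1.dom) (fun y hy => ?_)
    fun b hb => h b.1 hb
  obtain ⟨b, hyb, hb⟩ := exists_chart_le hL hy
  exact ⟨⟨b, hb⟩, hyb, hb⟩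

section

include hπ hL

lemma IsProjection.pull_injective (V : Y.Opens) :
    Function.Injective (pull π V (π ⁻¹ᵁ V) le_rfl) := by
  intro a a' h
  refine sections_ext_charts hL fun b hb => C_injective ?_
  have h1 := congrArg (fun f => b.coneFn (res (hπ.coneDom_le b hb) f)) h
  simp only [res_pull] at h1
  rwa [hπ.coneFn_pull b hb, hπ.coneFn_pull b hb] at h1

/-- The invariant functions on `π⁻¹ V` are the functions on `V`. -/
lemma IsProjection.exists_pull_eq [CharZero k] {V : Y.Opens} {f : Γ(L.puncturedCone k, π ⁻¹ᵁ V)}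
    (hf : pull (L.scale k (two k)) _ _ (hπ.scale_preimage (two k) V).ge f = f) :
    ∃ a, pull π V (π ⁻¹ᵁ V) le_rfl a = f := by
  have hloc : ∀ b : {b : L.Chart k // b.dom ≤ V}, ∃ a : Γ(Y, b.1.dom),
      pull π b.1.dom b.1.coneDom (hπ.preimage_dom b.1).ge a = res (hπ.coneDom_le b.1 b.2) f := by
    rintro ⟨b, hb⟩
    obtain ⟨a, ha⟩ : ∃ a, b.coneFn (res (hπ.coneDom_le b hb) f) = C a := by
      refine exists_C_of_scaleT_eq (k := k) ?_
      rw [← b.coneFn_scale _ (hπ.coneDom_le_scale _ b), pull_res]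
      conv_rhs => rw [← hf, res_pull]
    refine ⟨a, b.coneFn_bijective.1 ?_⟩
    rw [hπ.coneFn_pull b le_rfl, res_self, ha]
  choose a ha using hloc
  obtain ⟨a', ha'⟩ := sections_glue (U := fun b : {b : L.Chart k // b.dom ≤ V} => b.1.dom)
    (fun b => b.2) (fun y hy => by
      obtain ⟨b, hyb, hb⟩ := exists_chart_le hL hy
      exact ⟨⟨b, hb⟩, hyb⟩) a (fun b b' => by
      apply hπ.pull_injective hL
      have h1 : π ⁻¹ᵁ (b.1.dom ⊓ b'.1.dom) ≤ b.1.coneDom :=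
        (preimage_mono π inf_le_left).trans (hπ.preimage_dom b.1).le
      have h2 : π ⁻¹ᵁ (b.1.dom ⊓ b'.1.dom) ≤ b'.1.coneDom :=
        (preimage_mono π inf_le_right).trans (hπ.preimage_dom b'.1).le
      rw [pull_res, pull_res, ← res_pull π _ _ _ (hπ.preimage_dom b.1).ge h1,
        ← res_pull π _ _ _ (hπ.preimage_dom b'.1).ge h2, ha, ha, res_res, res_res])
  refine ⟨a', sections_ext (U := fun b : {b : L.Chart k // b.dom ≤ V} => b.1.coneDom)
    (fun x hx => ?_) fun b hb => ?_⟩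
  · obtain ⟨b, hb, hbV⟩ := hπ.exists_chart hL hx
    exact ⟨⟨b, hbV⟩, hb, hπ.coneDom_le b hbV⟩
  · rw [res_pull, ← ha, ← ha' b, pull_res]

lemma IsProjection.eulerField_pull {V : Y.Opens} (a : Γ(Y, V)) :
    VF.ap (hπ.eulerField hL) (le_top : π ⁻¹ᵁ V ≤ ⊤) (pull π V (π ⁻¹ᵁ V) le_rfl a) = 0 := by
  refine sections_ext (U := fun b : {b : L.Chart k // b.dom ≤ V} => b.1.coneDom)
    (fun x hx => ?_) fun b hb => b.1.coneFn_bijective.1 ?_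
  · obtain ⟨b, hb, hbV⟩ := hπ.exists_chart hL hx
    exact ⟨⟨b, hbV⟩, hb, hπ.coneDom_le b hbV⟩
  · rw [VF.ap_res, res_pull, ← b.1.der_coneFn, hπ.der_eulerField, hπ.coneFn_pull b.1 b.2, euler_C,
      map_zero, map_zero]

lemma IsProjection.eulerMul_injective (V : Y.Opens) : Function.Injective (hπ.eulerMul hL V) := by
  intro a a' h
  refine sections_ext_charts hL fun b hb => C_injective ?_
  have h1 := congrArg (fun D => b.der (hπ.coneDom_le b hb) D (T 1)) h
  simp only [hπ.der_eulerMul b hL hb, Derivation.smul_apply, euler_T, smul_eq_mul] at h1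
  exact (isUnit_T 1).mul_right_cancel h1

end

section

variable [CharZero k]

include hπ hL in
lemma IsProjection.existsUnique_differential {V : Y.Opens}
    (D : invariantFields (k := k) (L.scale k) π V) {V' : Y.Opens} (hV : V' ≤ V) (a : Γ(Y, V')) :
    ∃! a' : Γ(Y, V'), pull π V' (π ⁻¹ᵁ V') le_rfl a' =
      VF.ap D.1 (preimage_mono π hV) (pull π V' (π ⁻¹ᵁ V') le_rfl a) := by
  refine existsUnique_of_exists_of_unique (hπ.exists_pull_eq hL ?_)
    fun a₁ a₂ h₁ h₂ => hπ.pull_injective hL _ (h₁.trans h₂.symm)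
  refine (D.2 (two k) _ _ (preimage_mono π hV) (preimage_mono π hV) _ _).trans ?_
  congr 1
  rw [pull_pull]
  exact pull_congr (hπ.scale_comp _) _ _ _ _ _

/-- The value of the differential of `π` at an invariant vector field, evaluated on a function. -/
def IsProjection.differentialAp {V : Y.Opens} (D : invariantFields (k := k) (L.scale k) π V)
    {V' : Y.Opens} (hV : V' ≤ V) (a : Γ(Y, V')) : Γ(Y, V') :=
  (hπ.existsUnique_differential hL D hV a).choose

lemma IsProjection.pull_differentialAp {V : Y.Opens} (D : invariantFields (k := k) (L.scale k) π V)
    {V' : Y.Opens} (hV : V' ≤ V) (a : Γ(Y, V')) :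
    pull π V' (π ⁻¹ᵁ V') le_rfl (hπ.differentialAp hL D hV a) =
      VF.ap D.1 (preimage_mono π hV) (pull π V' (π ⁻¹ᵁ V') le_rfl a) :=
  (hπ.existsUnique_differential hL D hV a).choose_spec.1

section

variable {V V' : Y.Opens} (D D' : invariantFields (k := k) (L.scale k) π V) (hV : V' ≤ V)

lemma IsProjection.differentialAp_add (a a' : Γ(Y, V')) : hπ.differentialAp hL D hV (a + a') =
    hπ.differentialAp hL D hV a + hπ.differentialAp hL D hV a' :=
  hπ.pull_injective hL _ <| by
    rw [map_add, hπ.pull_differentialAp, hπ.pull_differentialAp, hπ.pull_differentialAp,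
      map_add, VF.ap_add]

lemma IsProjection.differentialAp_smul (c : k) (a : Γ(Y, V')) :
    hπ.differentialAp hL D hV (c • a) = c • hπ.differentialAp hL D hV a :=
  hπ.pull_injective hL _ <| by
    rw [hπ.pull_smul, hπ.pull_differentialAp, hπ.pull_differentialAp, hπ.pull_smul]
    exact Derivation.map_smul _ _ _

lemma IsProjection.differentialAp_mul (a a' : Γ(Y, V')) : hπ.differentialAp hL D hV (a * a') =
    a * hπ.differentialAp hL D hV a' + a' * hπ.differentialAp hL D hV a :=
  hπ.pull_injective hL _ <| by
    rw [map_add, map_mul, map_mul, hπ.pull_differentialAp, hπ.pull_differentialAp,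
      hπ.pull_differentialAp, map_mul, VF.ap_mul]

lemma IsProjection.differentialAp_res {V'' : Y.Opens} (h : V'' ≤ V') (a : Γ(Y, V')) :
    res h (hπ.differentialAp hL D hV a) = hπ.differentialAp hL D (h.trans hV) (res h a) := by
  apply hπ.pull_injective hL
  have h1 := congrArg (res (preimage_mono π h)) (hπ.pull_differentialAp hL D hV a)
  rw [VF.ap_res, res_pull, res_pull] at h1
  rw [hπ.pull_differentialAp, pull_res, pull_res]
  exact h1

lemma IsProjection.add_differentialAp (a : Γ(Y, V')) : hπ.differentialAp hL (D + D') hV a =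
    hπ.differentialAp hL D hV a + hπ.differentialAp hL D' hV a :=
  hπ.pull_injective hL _ <| by
    rw [map_add, hπ.pull_differentialAp, hπ.pull_differentialAp, hπ.pull_differentialAp]
    rfl

lemma IsProjection.smul_differentialAp (c : k) (a : Γ(Y, V')) :
    hπ.differentialAp hL (c • D) hV a = c • hπ.differentialAp hL D hV a :=
  hπ.pull_injective hL _ <| by
    rw [hπ.pull_smul, hπ.pull_differentialAp, hπ.pull_differentialAp]
    rfl

end

/-- The image of an invariant vector field under the differential of `π`. -/
def IsProjection.differentialField {V : Y.Opens} (D : invariantFields (k := k) (L.scale k) π V) :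
    vectorFields k Y V :=
  ⟨fun V' => Derivation.mk'
      { toFun := hπ.differentialAp hL D V'.2
        map_add' := hπ.differentialAp_add hL D V'.2
        map_smul' := hπ.differentialAp_smul hL D V'.2 }
      (hπ.differentialAp_mul hL D V'.2),
    fun V' _ h a => hπ.differentialAp_res hL D V'.2 h a⟩

lemma IsProjection.differentialField_add {V : Y.Opens}
    (E E' : invariantFields (k := k) (L.scale k) π V) : hπ.differentialField hL (E + E') =
      hπ.differentialField hL E + hπ.differentialField hL E' :=
  VF.ext fun _ hV a => hπ.add_differentialAp hL E E' hV a

lemma IsProjection.differentialField_smul {V : Y.Opens} (c : k)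
    (E : invariantFields (k := k) (L.scale k) π V) : hπ.differentialField hL (c • E) =
      c • hπ.differentialField hL E :=
  VF.ext fun _ hV a => hπ.smul_differentialAp hL E hV c a

lemma IsProjection.differentialField_eulerLin {V : Y.Opens} (a : Γ(Y, V)) :
    hπ.differentialField hL (hπ.eulerLin hL V a) = 0 :=
  VF.ext fun V' hV' a' => hπ.pull_injective hL _ <| by
    refine (hπ.pull_differentialAp hL _ hV' a').trans ?_
    change res _ (pull π V _ _ a) * VF.ap (hπ.eulerField hL) _ _ = pull π _ _ _ 0
    rw [hπ.eulerField_pull hL, mul_zero, map_zero]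

/-- The differential of `π` on sections. -/
def IsProjection.differentialLin (V : Y.Opens) :
    invariantFields (k := k) (L.scale k) π V →ₗ[k] vectorFields k Y V where
  toFun D := hπ.differentialField hL D
  map_add' := hπ.differentialField_add hL
  map_smul' := hπ.differentialField_smul hL

/-- The differential of `π`. -/
def IsProjection.differential : hπ.weightZero ⟶ tangentSheaf k Y :=
  ObjectProperty.homMk
    { app V := ModuleCat.ofHom (hπ.differentialLin hL V.unop)
      naturality _ _ _ := rfl }

lemma IsProjection.isDifferential_differential : hπ.IsDifferential (hπ.differential hL) :=
  fun _ D _ hV' b => hπ.pull_differentialAp hL D hV' b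

lemma IsProjection.eulerHom_differential : hπ.eulerHom hL ≫ hπ.differential hL = 0 :=
  hom_ext_sapp fun _ a => hπ.differentialField_eulerLin hL a

/-- The Euler sequence is exact: a derivation of a Laurent polynomial ring that is invariant and
vanishes on the coefficients is a multiple of `T ∂/∂T`, and derivations of the coefficients extend
to Laurent polynomials. -/
lemma IsProjection.shortExact : (ShortComplex.mk (hπ.eulerHom hL) (hπ.differential hL)
    (hπ.eulerHom_differential hL)).ShortExact := by
  refine shortExact_of_sections (fun V a a' h => ?_) (fun V D hD y hy => ?_)
    fun V D y hy => ?_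
  · exact hπ.eulerMul_injective hL V (congrArg Subtype.val h)
  · obtain ⟨b, hyb, hb⟩ := exists_chart_le hL hy
    change invariantFields (k := k) (L.scale k) π V at D
    -- in a chart `D` is an invariant derivation which vanishes on the coefficients
    obtain ⟨a, ha⟩ := exists_eq_smul_euler (D := b.der (hπ.coneDom_le b hb) D.1)
      (by rw [← hπ.der_act, (hπ.mem_invariantFields_iff D.1).mp D.2]) (fun a => by
        rw [← hπ.hasCoords.coneFn_pull b (hπ.preimage_dom b).ge, b.der_coneFn]
        have h1 := hπ.pull_differentialAp hL D hb a
        have h2 : hπ.differentialAp hL D hb a = 0 :=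
          VF.ap_congr (show hπ.differentialLin hL V D = 0 from hD) hb a
        rw [h2, map_zero] at h1
        have h3 := congrArg (res (hπ.preimage_dom b).ge) h1
        rw [VF.ap_res, res_pull, map_zero] at h3
        rw [← h3, map_zero])
    refine ⟨b.dom, hb, a, hyb, Subtype.ext ?_⟩
    refine VF.ext fun W hW f => b.ap_eq_of_der_eq (hπ.preimage_dom b).ge ?_ hW
      (hW.trans (hπ.preimage_dom b).le) f
    refine (hπ.der_eulerMul b hL le_rfl a).trans ?_
    rw [res_self, ← ha]
    rfl
  · obtain ⟨b, hyb, hb⟩ := exists_chart_le hL hy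
    change vectorFields k Y V at D
    have h1 := (hπ.preimage_dom b).ge
    -- `D'` acts on the coefficients of the Laurent polynomials by `D`, and maps `T` to `0`
    obtain ⟨D', hD'⟩ := b.exists_der_eq h1 (hπ.preimage_dom b).le (horizontal (D.1 ⟨b.dom, hb⟩))
    have hinv : D' ∈ invariantFields (L.scale k) π b.dom :=
      hπ.mem_invariantFields_of_two hL <| VF.ext fun W hW f =>
        b.ap_eq_of_der_eq h1 (by rw [hπ.der_act, hD', actDer_horizontal]) hW
          (hW.trans (hπ.preimage_dom b).le) f
    refine ⟨b.dom, hb, (⟨D', hinv⟩ : invariantFields (L.scale k) π b.dom), hyb, ?_⟩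
    refine VF.ext_affine b.isAffineOpen fun a => ?_
    apply hπ.pull_injective hL
    refine (hπ.pull_differentialAp hL ⟨D', hinv⟩ le_rfl a).trans ?_
    refine sections_ext (U := fun _ : Unit => b.coneDom) (fun x hx =>
      ⟨(), (hπ.preimage_dom b).le hx, h1⟩) fun _ _ => b.coneFn_bijective.1 ?_
    rw [VF.ap_res, res_pull, res_pull, ← b.der_coneFn, hD', hπ.coneFn_pull b le_rfl, horizontal_C,
      hπ.coneFn_pull b le_rfl, res_self, res_self]
    rfl

end

end LineBundle

end AlgGeom

/-! ### First cohomology of invariant sections -/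

namespace SheafCoh

variable {k : Type u} [Field k] {X Y : TopCat.{u}}

section action

variable {F G : TopCat.Sheaf (ModuleCat.{u} k) X} {σ : X ⟶ X}
  (τ : F ⟶ (TopCat.Sheaf.pushforward (ModuleCat.{u} k) σ).obj F)
  (τ' : G ⟶ (TopCat.Sheaf.pushforward (ModuleCat.{u} k) σ).obj G)

/-- The endomorphism of the sections of `F` over an open subset `O` with `σ⁻¹ O = O` given by a map
`F ⟶ σ_* F`. -/
def sact {O : Opens X} (h : O ≤ (Opens.map σ).obj O) : F.obj.obj (op O) →ₗ[k] F.obj.obj (op O) :=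
  sres F h ∘ₗ sapp τ O

lemma sact_sres {O O' : Opens X} (h : O ≤ (Opens.map σ).obj O) (h' : O' ≤ (Opens.map σ).obj O')
    (hO : O' ≤ O) (x : F.obj.obj (op O)) :
    sact τ h' (sres F hO x) = sres F hO (sact τ h x) := by
  have h1 : sapp τ O' (sres F hO x) =
      sres F (show (Opens.map σ).obj O' ≤ (Opens.map σ).obj O from fun _ hx => hO hx)
        (sapp τ O x) :=
    sapp_sres τ hO x
  refine (congrArg (sres F h') h1).trans ?_
  exact (sres_sres F _ h' _).trans (sres_sres F h hO _).symm

variable {τ τ'} in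
lemma sapp_sact {m : F ⟶ G}
    (hm : τ ≫ (TopCat.Sheaf.pushforward (ModuleCat.{u} k) σ).map m = m ≫ τ') {O : Opens X}
    (h : O ≤ (Opens.map σ).obj O) (x : F.obj.obj (op O)) :
    sapp m O (sact τ h x) = sact τ' h (sapp m O x) := by
  have h1 : sapp m ((Opens.map σ).obj O) (sapp τ O x) = sapp τ' O (sapp m O x) :=
    congrArg (fun φ => sapp φ O x) hm
  exact (sapp_sres m h _).trans (congrArg (sres G h) h1)

end action

instance injective_pushforward (f : X ⟶ Y) (I : TopCat.Sheaf (ModuleCat.{u} k) X) [Injective I] :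
    Injective ((TopCat.Sheaf.pushforward (ModuleCat.{u} k) f).obj I) :=
  Injective.injective_of_adjoint
    (TopCat.Sheaf.pullbackPushforwardAdjunction (ModuleCat.{u} k) f) I

section

variable {S : ShortComplex (TopCat.Sheaf (ModuleCat.{u} k) X)} (hS : S.ShortExact)

lemma bd_eq_iff (q q' : S.X₃.obj.obj (op ⊤)) :
    bd hS q = bd hS q' ↔ ∃ z : S.X₂.obj.obj (op ⊤), sapp S.g ⊤ z = q - q' := by
  rw [← bd_eq_zero_iff hS, bd_sub, sub_eq_zero]

variable [Injective S.X₂]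

include hS in
/-- A map `S.X₁ ⟶ σ_* S.X₁` extends to a short exact sequence whose middle term is injective. -/
lemma exists_extension_map {σ : X ⟶ X}
    (τ : S.X₁ ⟶ (TopCat.Sheaf.pushforward (ModuleCat.{u} k) σ).obj S.X₁) :
    ∃ (τ₂ : S.X₂ ⟶ (TopCat.Sheaf.pushforward (ModuleCat.{u} k) σ).obj S.X₂)
      (τ₃ : S.X₃ ⟶ (TopCat.Sheaf.pushforward (ModuleCat.{u} k) σ).obj S.X₃),
      τ ≫ (TopCat.Sheaf.pushforward (ModuleCat.{u} k) σ).map S.f = S.f ≫ τ₂ ∧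
      τ₂ ≫ (TopCat.Sheaf.pushforward (ModuleCat.{u} k) σ).map S.g = S.g ≫ τ₃ := by
  have := hS.mono_f
  have := hS.epi_g
  have h2 := Injective.comp_factorThru
    (τ ≫ (TopCat.Sheaf.pushforward (ModuleCat.{u} k) σ).map S.f) S.f
  set τ₂ := Injective.factorThru
    (τ ≫ (TopCat.Sheaf.pushforward (ModuleCat.{u} k) σ).map S.f) S.f
  have h3 : S.f ≫ τ₂ ≫ (TopCat.Sheaf.pushforward (ModuleCat.{u} k) σ).map S.g = 0 := by
    rw [← Category.assoc, h2, Category.assoc, ← Functor.map_comp, S.zero]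
    exact hom_ext_sapp fun _ _ => rfl
  exact ⟨τ₂, hS.exact.desc _ h3, h2.symm, (hS.exact.g_desc _ h3).symm⟩

omit [Injective S.X₂] in
/-- The connecting map is equivariant. -/
lemma pullback_bd_self {σ : X ⟶ X}
    {τ : S.X₁ ⟶ (TopCat.Sheaf.pushforward (ModuleCat.{u} k) σ).obj S.X₁}
    {τ₂ : S.X₂ ⟶ (TopCat.Sheaf.pushforward (ModuleCat.{u} k) σ).obj S.X₂}
    {τ₃ : S.X₃ ⟶ (TopCat.Sheaf.pushforward (ModuleCat.{u} k) σ).obj S.X₃}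
    (h₁ : τ ≫ (TopCat.Sheaf.pushforward (ModuleCat.{u} k) σ).map S.f = S.f ≫ τ₂)
    (h₂ : τ₂ ≫ (TopCat.Sheaf.pushforward (ModuleCat.{u} k) σ).map S.g = S.g ≫ τ₃)
    (q : S.X₃.obj.obj (op ⊤)) :
    H.pullback σ τ 1 (bd hS q) = bd hS (sact τ₃ (O := ⊤) le_rfl q) := by
  have h : sact τ₃ (O := ⊤) le_rfl q = sapp τ₃ ⊤ q := sres_self S.X₃ _ _
  rw [h]
  exact pullback_bd σ hS hS τ τ₂ τ₃ h₁ h₂ q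

end

lemma map_mono (p : X ⟶ Y) {V V' : Opens Y} (h : V' ≤ V) :
    (Opens.map p).obj V' ≤ (Opens.map p).obj V := fun _ hx => h hx

lemma top_le_iSup_map (p : X ⟶ Y) {κ : Type*} {B : κ → Opens Y} (hB : ∀ y, ∃ i, y ∈ B i) :
    (⊤ : Opens X) ≤ ⨆ i, (Opens.map p).obj (B i) := fun x _ =>
  Opens.mem_iSup.mpr (hB (p x))

lemma section_ext_of_le (F : TopCat.Sheaf (ModuleCat.{u} k) X) {κ : Type*} {U : κ → Opens X}
    {O : Opens X} (hU : ∀ i, U i ≤ O) (hO : O ≤ iSup U) {x y : F.obj.obj (op O)}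
    (h : ∀ i, sres F (hU i) x = sres F (hU i) y) : x = y :=
  section_ext F hO fun i V hV hVi => by
    rw [← sres_sres F (hU i) hVi, h, sres_sres]

/-- The map on sections of a morphism `F ⟶ p_* G`. -/
def toPush {p : X ⟶ Y} {F : TopCat.Sheaf (ModuleCat.{u} k) Y} {G : TopCat.Sheaf (ModuleCat.{u} k) X}
    (m : F ⟶ (TopCat.Sheaf.pushforward (ModuleCat.{u} k) p).obj G) (V : Opens Y) :
    F.obj.obj (op V) →ₗ[k] G.obj.obj (op ((Opens.map p).obj V)) := sapp m V

/-- The map on sections of a morphism `p_* G ⟶ F`. -/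
def ofPush {p : X ⟶ Y} {F : TopCat.Sheaf (ModuleCat.{u} k) Y} {G : TopCat.Sheaf (ModuleCat.{u} k) X}
    (m : (TopCat.Sheaf.pushforward (ModuleCat.{u} k) p).obj G ⟶ F) (V : Opens Y) :
    G.obj.obj (op ((Opens.map p).obj V)) →ₗ[k] F.obj.obj (op V) := sapp m V

lemma ofPush_sres {p : X ⟶ Y} {F : TopCat.Sheaf (ModuleCat.{u} k) Y}
    {G : TopCat.Sheaf (ModuleCat.{u} k) X}
    (m : (TopCat.Sheaf.pushforward (ModuleCat.{u} k) p).obj G ⟶ F) {V V' : Opens Y} (h : V' ≤ V)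
    (x : G.obj.obj (op ((Opens.map p).obj V))) :
    ofPush m V' (sres G (map_mono p h) x) = sres F h (ofPush m V x) := sapp_sres m h x

section

variable {S : ShortComplex (TopCat.Sheaf (ModuleCat.{u} k) X)} (hS : S.ShortExact) (p : X ⟶ Y)
  {W : TopCat.Sheaf (ModuleCat.{u} k) Y}
  (ι : W ⟶ (TopCat.Sheaf.pushforward (ModuleCat.{u} k) p).obj S.X₁)
  (hι : ∀ V, Function.Injective (toPush ι V))

/-- The map `W ⟶ p_* S.X₂`. -/
abbrev toInj : W ⟶ (TopCat.Sheaf.pushforward (ModuleCat.{u} k) p).obj S.X₂ :=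
  ι ≫ (TopCat.Sheaf.pushforward (ModuleCat.{u} k) p).map S.f

/-- The cokernel of `W ⟶ p_* S.X₂`. -/
def coker : TopCat.Sheaf (ModuleCat.{u} k) Y := cokernel (toInj p ι)

/-- The projection `p_* S.X₂ ⟶ coker` on sections. -/
def cokerPi (V : Opens Y) :
    S.X₂.obj.obj (op ((Opens.map p).obj V)) →ₗ[k] (coker p ι).obj.obj (op V) :=
  ofPush (cokernel.π (toInj p ι)) V

lemma cokerPi_sres {V V' : Opens Y} (h : V' ≤ V) (x : S.X₂.obj.obj (op ((Opens.map p).obj V))) :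
    cokerPi p ι V' (sres S.X₂ (map_mono p h) x) = sres (coker p ι) h (cokerPi p ι V x) :=
  ofPush_sres _ h x

/-- The map `coker ⟶ p_* S.X₃`. -/
def cokerMap : cokernel (toInj p ι) ⟶ (TopCat.Sheaf.pushforward (ModuleCat.{u} k) p).obj S.X₃ :=
  cokernel.desc _ ((TopCat.Sheaf.pushforward (ModuleCat.{u} k) p).map S.g) <| by
    rw [Category.assoc, ← Functor.map_comp, S.zero]
    exact hom_ext_sapp fun _ _ => rfl

/-- The global section of `S.X₃` given by a global section of `coker`. -/
def cokerTop (q : (coker p ι).obj.obj (op ⊤)) : S.X₃.obj.obj (op ⊤) := sapp (cokerMap p ι) ⊤ q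

lemma g_eq_of_cokerPi_eq {q : (coker p ι).obj.obj (op ⊤)} {V : Opens Y}
    {s : S.X₂.obj.obj (op ((Opens.map p).obj V))}
    (h : cokerPi p ι V s = sres (coker p ι) le_top q) :
    sapp S.g _ s = sres S.X₃ le_top (cokerTop p ι q) := by
  have h1 : cokernel.π (toInj p ι) ≫ cokerMap p ι = _ := cokernel.π_desc _ _ _
  have h2 : sapp (cokerMap p ι) V (cokerPi p ι V s) = sapp S.g _ s :=
    congrArg (fun φ => sapp φ V s) h1
  exact h2.symm.trans ((congrArg _ h).trans (sapp_sres (cokerMap p ι) le_top q))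

lemma cokerPi_f (V : Opens Y) (w : W.obj.obj (op V)) :
    cokerPi p ι V (sapp S.f _ (toPush ι V w)) = 0 :=
  congrArg (fun φ => sapp φ V w) (cokernel.condition (toInj p ι))

include hS hι in
lemma mono_toInj : Mono (toInj p ι) :=
  mono_of_injective _ fun V => (sections_injective hS _).comp (hι V)

include hS hι in
lemma exists_of_cokerPi_eq {V : Opens Y} {s s' : S.X₂.obj.obj (op ((Opens.map p).obj V))}
    (h : cokerPi p ι V s = cokerPi p ι V s') : ∃ w, sapp S.f _ (toPush ι V w) = s - s' := by
  have := mono_toInj hS p ι hι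
  exact sections_exact (shortExact_cokernel (toInj p ι)) V (s - s')
    ((map_sub (cokerPi p ι V) s s').trans (sub_eq_zero.mpr h))

/-- The connecting map of `0 ⟶ W ⟶ p_* S.X₂ ⟶ coker ⟶ 0`. -/
def cokerBd [Mono (toInj p ι)] (q : (coker p ι).obj.obj (op ⊤)) : H W 1 :=
  bd (shortExact_cokernel (toInj p ι)) q

lemma exists_cokerBd_eq [Injective S.X₂] [Mono (toInj p ι)] (v : H W 1) :
    ∃ q, cokerBd p ι q = v :=
  exists_bd_eq (shortExact_cokernel (toInj p ι)) v

lemma cokerBd_eq_zero [Mono (toInj p ι)] {q : (coker p ι).obj.obj (op ⊤)}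
    {y : S.X₂.obj.obj (op ⊤)} {κ : Type*} {B : κ → Opens Y} (hB : ∀ y, ∃ i, y ∈ B i)
    (h : ∀ i, cokerPi p ι (B i) (sres S.X₂ le_top y) = sres (coker p ι) le_top q) :
    cokerBd p ι q = 0 := by
  refine (bd_eq_zero_iff (shortExact_cokernel (toInj p ι)) q).mpr ⟨y, ?_⟩
  refine section_ext_of_le (coker p ι) (U := B) (fun _ => le_top)
    (fun y _ => Opens.mem_iSup.mpr (hB y)) fun i => ?_
  exact (sapp_sres (cokernel.π (toInj p ι)) (le_top : B i ≤ ⊤) y).symm.trans (h i)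

lemma pullback_cokerBd [Mono (toInj p ι)] (q : (coker p ι).obj.obj (op ⊤)) :
    H.pullback p ι 1 (cokerBd p ι q) = bd hS (cokerTop p ι q) :=
  pullback_bd p (shortExact_cokernel (toInj p ι)) hS ι (𝟙 _) (cokerMap p ι)
    (Category.comp_id _).symm
    ((Category.id_comp _).trans (cokernel.π_desc _ _ _).symm) q

variable {κ : Type u} {B : κ → Opens Y} (hB : ∀ V : Opens Y, ∀ y ∈ V, ∃ i, y ∈ B i ∧ B i ≤ V)

include hS hι hB in
/-- A global section of the cokernel of `W ⟶ p_* S.X₂` is given by local sections of `p_* S.X₂`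
whose differences come from `W`. -/
lemma exists_local_lifts (q : (coker p ι).obj.obj (op ⊤)) :
    ∃ (J : Type u) (b : J → κ)
      (s : ∀ j, S.X₂.obj.obj (op ((Opens.map p).obj (B (b j))))), (∀ y, ∃ j, y ∈ B (b j)) ∧
      (∀ j, cokerPi p ι (B (b j)) (s j) = sres (coker p ι) le_top q) ∧
      ∀ i j, ∃ w : W.obj.obj (op (B (b i) ⊓ B (b j))), sapp S.f _ (toPush ι _ w) =
        sres S.X₂ (map_mono p inf_le_left) (s i) - sres S.X₂ (map_mono p inf_le_right) (s j) := by
  have := mono_toInj hS p ι hι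
  let J := {b : κ // ∃ s : S.X₂.obj.obj (op ((Opens.map p).obj (B b))),
    cokerPi p ι (B b) s = sres (coker p ι) le_top q}
  choose s hs using fun j : J => j.2
  refine ⟨J, fun j => j.1, s, fun y => ?_, hs, fun i j => exists_of_cokerPi_eq hS p ι hι ?_⟩
  · obtain ⟨V, hV, s, hy, hs⟩ :=
      sections_locally_surjective (shortExact_cokernel (toInj p ι)) ⊤ q y trivial
    obtain ⟨b, hyb, hbV⟩ := hB V y hy
    refine ⟨⟨b, sres S.X₂ (map_mono p hbV) s, ?_⟩, hyb⟩
    refine (cokerPi_sres p ι hbV s).trans ?_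
    exact (congrArg (sres (coker p ι) hbV) hs).trans (sres_sres (coker p ι) _ _ _)
  · rw [cokerPi_sres p ι (inf_le_left : B i.1 ⊓ B j.1 ≤ _),
      cokerPi_sres p ι (inf_le_right : B i.1 ⊓ B j.1 ≤ _), hs, hs, sres_sres, sres_sres]

end

section

variable {S : ShortComplex (TopCat.Sheaf (ModuleCat.{u} k) X)} (hS : S.ShortExact)
  [Injective S.X₂] (p : X ⟶ Y) {σ : X ⟶ X}
  (τ : S.X₁ ⟶ (TopCat.Sheaf.pushforward (ModuleCat.{u} k) σ).obj S.X₁)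
  (hσ : ∀ (V : Opens Y), (Opens.map p).obj V ≤ (Opens.map σ).obj ((Opens.map p).obj V))
  {W : TopCat.Sheaf (ModuleCat.{u} k) Y}
  (ι : W ⟶ (TopCat.Sheaf.pushforward (ModuleCat.{u} k) p).obj S.X₁)
  (hι : ∀ V, Function.Injective (toPush ι V))
  {κ : Type u} {B : κ → Opens Y} (hB : ∀ V : Opens Y, ∀ y ∈ V, ∃ i, y ∈ B i ∧ B i ≤ V)
  (hfix' : ∀ V w, sact τ (hσ V) (toPush ι V w) = toPush ι V w)

include hS hι hB hfix' in
/-- Classes that come from `W` are fixed by an automorphism that fixes the sections of `W`. -/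
theorem pullback_fixed (v : H W 1) :
    H.pullback σ τ 1 (H.pullback p ι 1 v) = H.pullback p ι 1 v := by
  have := mono_toInj hS p ι hι
  obtain ⟨q, rfl⟩ := exists_cokerBd_eq p ι v
  -- write `g` for the action of `σ`; it suffices to lift `g q - q` to a global section of `S.X₂`:
  -- if `s j` are local lifts of `q`, then the sections `g (s j) - s j` glue
  obtain ⟨τ₂, τ₃, h₁, h₂⟩ := exists_extension_map hS τ
  rw [pullback_cokerBd hS, pullback_bd_self hS h₁ h₂, bd_eq_iff]
  obtain ⟨J, b, s, hcov, hs, hw⟩ := exists_local_lifts hS p ι hι hB q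
  obtain ⟨z, hz⟩ := section_glue S.X₂ (U := fun j => (Opens.map p).obj (B (b j))) (W := ⊤)
    (fun _ => le_top) (top_le_iSup_map p hcov)
    (fun j => sact τ₂ (hσ (B (b j))) (s j) - s j) (fun i j => by
      obtain ⟨w, hw⟩ := hw i j
      have h3 := sapp_sact h₁ (hσ (B (b i) ⊓ B (b j))) (toPush ι _ w)
      rw [hfix', hw, map_sub, sact_sres τ₂ (hσ _) (hσ _), sact_sres τ₂ (hσ _) (hσ _)] at h3
      rw [map_sub, map_sub, sub_eq_sub_iff_sub_eq_sub]
      exact h3.symm)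
  refine ⟨z, section_ext_of_le S.X₃ (fun _ => le_top) (top_le_iSup_map p hcov) fun j => ?_⟩
  rw [← sapp_sres, hz, map_sub, sapp_sact h₂, g_eq_of_cokerPi_eq p ι (hs j), map_sub,
    sact_sres τ₃ (O := ⊤) le_rfl]

variable (hfix : ∀ V x, sact τ (hσ V) x = x → ∃ w, toPush ι V w = x)
  (hsq : ∀ V x, sact τ (hσ V) (sact τ (hσ V) x - x) = sact τ (hσ V) x - x → sact τ (hσ V) x = x)
  (hdec : ∀ i (x : S.X₁.obj.obj (op ((Opens.map p).obj (B i)))), ∃ x₀ x',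
    sact τ (hσ _) x₀ = x₀ ∧ x = x₀ + (sact τ (hσ _) x' - x'))

set_option maxHeartbeats 400000 in
include hS hι hB hfix hfix' hsq hdec in
/-- Let `g` be the action of `σ` on the sections of `S.X₁` over the sets `p⁻¹ V`. If the sections
fixed by `g` are those of `W`, if `(g - 1)² x = 0` implies `(g - 1) x = 0`, and if over a basis of
open subsets every section is the sum of a fixed section and one in the image of `g - 1`, then the
first cohomology of `W` embeds in that of `S.X₁`. -/
theorem pullback_injective_of_decomposition : Function.Injective (H.pullback p ι 1) := by
  rw [injective_iff_map_eq_zero]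
  intro v hv
  have := mono_toInj hS p ι hι
  obtain ⟨q, rfl⟩ := exists_cokerBd_eq p ι v
  rw [pullback_cokerBd hS, bd_eq_zero_iff] at hv
  obtain ⟨y, hy⟩ := hv
  obtain ⟨J, b, s, hcov, hs, hw⟩ := exists_local_lifts hS p ι hι hB q
  -- the local lifts differ from the global lift `y` by sections `r j = D j + (g - 1) (D' j)`
  have hr : ∀ j, ∃ r, sapp S.f _ r = s j - sres S.X₂ le_top y := fun j => by
    refine sections_exact hS _ _ ?_
    rw [map_sub, sapp_sres, hy, g_eq_of_cokerPi_eq p ι (hs j), sub_self]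
  choose r hr using hr
  choose D D' hD hrD using fun j => hdec (b j) (r j)
  -- on overlaps `(g - 1) (D' i - D' j)` is fixed by `g`, hence it vanishes, and the sections
  -- `(g - 1) (D' j)` glue to a global section `E`; then `y + E` is a lift of `q`
  obtain ⟨E, hE⟩ := section_glue S.X₁ (U := fun j => (Opens.map p).obj (B (b j))) (W := ⊤)
    (fun _ => le_top) (top_le_iSup_map p hcov)
    (fun j => sact τ (hσ (B (b j))) (D' j) - D' j) (fun i j => by
      obtain ⟨w, hw⟩ := hw i j
      have h1 : toPush ι _ w = sres S.X₁ (map_mono p inf_le_left) (r i) -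
          sres S.X₁ (map_mono p inf_le_right) (r j) := by
        apply sections_injective hS
        rw [hw, map_sub, sapp_sres, sapp_sres, hr, hr, map_sub, map_sub, sres_sres, sres_sres]
        abel
      have h3 : sact τ (hσ _) (sres S.X₁ (map_mono p inf_le_left) (D' i) -
            sres S.X₁ (map_mono p inf_le_right) (D' j)) -
            (sres S.X₁ (map_mono p inf_le_left) (D' i) -
              sres S.X₁ (map_mono p inf_le_right) (D' j)) = toPush ι _ w -
            (sres S.X₁ (map_mono p inf_le_left) (D i) -
              sres S.X₁ (map_mono p inf_le_right) (D j)) := by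
        rw [h1, hrD, hrD, map_sub, sact_sres τ (hσ _) (hσ _), sact_sres τ (hσ _) (hσ _)]
        simp only [map_add, map_sub]
        abel
      have h2 := hsq _ _ (by
        rw [h3, map_sub, map_sub, hfix', sact_sres τ (hσ _) (hσ _), sact_sres τ (hσ _) (hσ _),
          hD, hD])
      rw [map_sub, sact_sres τ (hσ _) (hσ _), sact_sres τ (hσ _) (hσ _)] at h2
      rw [map_sub, map_sub, sub_eq_sub_iff_sub_eq_sub]
      exact h2)
  refine cokerBd_eq_zero p ι (y := y + sapp S.f ⊤ E) hcov fun j => ?_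
  obtain ⟨w, hw⟩ := hfix _ _ (hD j)
  have h1 : sres S.X₂ le_top (y + sapp S.f ⊤ E) = s j - sapp S.f _ (toPush ι _ w) := by
    rw [hw, map_add, ← sapp_sres, hE, eq_sub_iff_add_eq, add_assoc, ← map_add, add_comm _ (D j),
      ← hrD, hr]
    abel
  rw [h1, map_sub, cokerPi_f, sub_zero, hs]

variable (hlift : ∀ i (q : S.X₃.obj.obj (op ((Opens.map p).obj (B i)))), ∃ s, sapp S.g _ s = q)

set_option maxHeartbeats 1000000 in
include hS hι hB hfix hsq hdec hlift in
/-- In the situation of `pullback_injective_of_decomposition`, if moreover sections of `S.X₃` lift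
over a basis of open subsets, then the classes fixed by `g` come from `W`. -/
theorem exists_pullback_eq_of_decomposition {v : H S.X₁ 1}
    (hv : H.pullback σ τ 1 v = v) : ∃ w, H.pullback p ι 1 w = v := by
  have := mono_toInj hS p ι hι
  obtain ⟨q, rfl⟩ := exists_bd_eq hS v
  obtain ⟨τ₂, τ₃, h₁, h₂⟩ := exists_extension_map hS τ
  rw [pullback_bd_self hS h₁ h₂, bd_eq_iff] at hv
  obtain ⟨z, hz⟩ := hv
  -- over `B i` choose a lift `s i` of `q`, and write `g (s i) - s i - z = r i + (g - 1) (d i)` with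
  -- `r i` fixed by `g`
  choose s hs using fun i => hlift i (sres S.X₃ le_top q)
  have hβ : ∀ i, ∃ β, sapp S.f _ β = sact τ₂ (hσ _) (s i) - s i - sres S.X₂ le_top z :=
    fun i => by
      refine sections_exact hS _ _ ?_
      rw [map_sub, map_sub, sapp_sres, hz, sapp_sact h₂, hs, map_sub,
        sact_sres τ₃ (O := ⊤) le_rfl, sub_self]
  choose β hβ using hβ
  choose r d hr hrd using fun i => hdec i (β i)
  have hcov : ∀ y, ∃ i, y ∈ B i := fun y =>
    let ⟨i, hi, _⟩ := hB ⊤ y trivial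
    ⟨i, hi⟩
  -- the differences `e` of the modified lifts `s i - d i` satisfy `(g - 1) e = r i - r j`, so that
  -- `(g - 1)² e = 0`, and they come from `W`
  have hs' : ∀ i j, ∃ w, sapp S.f _ (toPush ι (B i ⊓ B j) w) =
      sres S.X₂ (map_mono p inf_le_left) (s i - sapp S.f _ (d i)) -
        sres S.X₂ (map_mono p inf_le_right) (s j - sapp S.f _ (d j)) := by
    intro i j
    have hO := hσ (B i ⊓ B j)
    obtain ⟨c, hc⟩ := sections_exact hS _ (sres S.X₂ (map_mono p inf_le_left) (s i) -
        sres S.X₂ (map_mono p (inf_le_right : B i ⊓ B j ≤ _)) (s j)) (by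
      rw [map_sub, sapp_sres, sapp_sres, hs, hs, sres_sres, sres_sres, sub_self])
    have h3 : sact τ hO c - c = sres S.X₁ (map_mono p inf_le_left) (β i) -
        sres S.X₁ (map_mono p inf_le_right) (β j) := by
      apply sections_injective hS
      rw [map_sub, map_sub, sapp_sact h₁, hc, sapp_sres, sapp_sres, hβ, hβ, map_sub,
        sact_sres τ₂ (hσ _) (hσ _), sact_sres τ₂ (hσ _) (hσ _)]
      simp only [map_sub, sres_sres]
      abel
    obtain ⟨e, he⟩ : ∃ e, e = c - (sres S.X₁ (map_mono p inf_le_left) (d i) -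
        sres S.X₁ (map_mono p inf_le_right) (d j)) := ⟨_, rfl⟩
    have h4 : sact τ hO e - e = sres S.X₁ (map_mono p inf_le_left) (r i) -
        sres S.X₁ (map_mono p inf_le_right) (r j) := by
      rw [hrd, hrd] at h3
      rw [he, map_sub, map_sub, sact_sres τ (hσ _) (hσ _), sact_sres τ (hσ _) (hσ _)]
      rw [sub_sub_sub_comm, h3]
      simp only [map_add, map_sub]
      abel
    have h5 : sact τ hO (sact τ hO e - e) = sact τ hO e - e := by
      rw [h4, map_sub, sact_sres τ (hσ _) (hσ _), sact_sres τ (hσ _) (hσ _), hr, hr]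
    obtain ⟨w, hw⟩ := hfix _ e (hsq _ e h5)
    refine ⟨w, ?_⟩
    rw [hw, he, map_sub, hc, map_sub, sapp_sres, sapp_sres, map_sub, map_sub]
    abel
  obtain ⟨q', hq'⟩ := section_glue (coker p ι) (U := B) (W := ⊤) (fun _ => le_top)
    (fun y _ => Opens.mem_iSup.mpr (hcov y))
    (fun i => cokerPi p ι (B i) (s i - sapp S.f _ (d i))) (fun i j => by
      obtain ⟨w, hw⟩ := hs' i j
      have h6 := cokerPi_f p ι _ w
      rw [hw, map_sub, sub_eq_zero] at h6
      exact (cokerPi_sres p ι inf_le_left _).symm.trans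
        (h6.trans (cokerPi_sres p ι inf_le_right _)))
  refine ⟨cokerBd p ι q', ?_⟩
  rw [pullback_cokerBd hS]
  congr 1
  refine section_ext_of_le S.X₃ (U := fun i => (Opens.map p).obj (B i)) (fun _ => le_top)
    (top_le_iSup_map p hcov) fun i => ?_
  have h7 : sapp S.g _ (sapp S.f ((Opens.map p).obj (B i)) (d i)) = 0 :=
    congrArg (fun φ => sapp φ _ (d i)) S.zero
  rw [← g_eq_of_cokerPi_eq p ι (hq' i).symm, map_sub, h7, sub_zero, hs]

end

end SheafCoh

/-! ### The weight-zero part of the first cohomology of the tangent sheaf of the cone -/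

namespace AlgGeom

lemma finiteType_sections {k : Type u} [Field k] {Y : Scheme.{u}} [Y.Over (Spec (.of k))]
    [LocallyOfFiniteType (Y ↘ Spec (.of k))] {W : Y.Opens} (hW : IsAffineOpen W) :
    Algebra.FiniteType k Γ(Y, W) := by
  have h := (Y ↘ Spec (.of k)).finiteType_appLE (isAffineOpen_top _) hW le_top
  rw [← RingHom.finiteType_algebraMap]
  exact h.comp (RingHom.FiniteType.of_surjective _
    (ConcreteCategory.bijective_of_isIso (Scheme.ΓSpecIso (.of k)).inv).2)

namespace LineBundle

open SheafCoh LaurentPolynomial LaurentDer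

variable {k : Type u} [Field k] {Y : Scheme.{u}} {L : LineBundle Y} [Y.Over (Spec (.of k))]
  [IsIntegral Y] [CompactSpace Y] {π : L.puncturedCone k ⟶ Y} (hπ : L.IsProjection k π)
  (hL : L.IsAmple k)

lemma Chart.finiteType_coneDom [LocallyOfFiniteType (Y ↘ Spec (.of k))] (b : L.Chart k) :
    Algebra.FiniteType k Γ(L.puncturedCone k, b.coneDom) := by
  have := finiteType_sections (k := k) b.isAffineOpen
  have h2 : Algebra.FiniteType Γ(Y, b.dom) Γ(Y, b.dom)[T;T⁻¹] :=
    inferInstanceAs (Algebra.FiniteType _ (AddMonoidAlgebra _ _))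
  have : Algebra.FiniteType k Γ(Y, b.dom)[T;T⁻¹] := Algebra.FiniteType.trans this h2
  exact Algebra.FiniteType.equiv this b.coneEquiv.symm

variable (L k) in
/-- An embedding of the tangent sheaf of the cone into an injective sheaf, and its cokernel. -/
def tangentSequence :
    ShortComplex (TopCat.Sheaf (ModuleCat.{u} k) (L.puncturedCone k).toTopCat) :=
  ShortComplex.mk (Injective.ι (tangentSheaf k (L.puncturedCone k))) (cokernel.π _)
    (cokernel.condition _)

variable (L k) in
omit [IsIntegral Y] [CompactSpace Y] in
lemma tangentSequence_shortExact : (L.tangentSequence k).ShortExact := shortExact_cokernel _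

instance : Injective (L.tangentSequence k).X₂ := inferInstanceAs (Injective (Injective.under _))

/-- The inclusion of the invariant vector fields. -/
abbrev IsProjection.incl : hπ.weightZero ⟶
    (TopCat.Sheaf.pushforward (ModuleCat.{u} k) π.base).obj (L.tangentSequence k).X₁ :=
  invariantIncl k (L.scale k) π hπ.scale_comp

omit [IsIntegral Y] [CompactSpace Y] in
lemma IsProjection.incl_injective (V : Y.Opens) :
    Function.Injective (toPush (p := π.base) hπ.incl V) := Subtype.val_injective

/-- The isomorphism of the tangent sheaf of the cone with its direct image given by the action of
`c`. -/
abbrev scaleMap (c : kˣ) : (L.tangentSequence k).X₁ ⟶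
    (TopCat.Sheaf.pushforward (ModuleCat.{u} k) (L.scaleIso k c).hom.base).obj
      (L.tangentSequence k).X₁ :=
  transportHom (L.scaleIso k c)

include hL in
lemma chart_basis (V : Opens Y.toTopCat) (y : Y.toTopCat) (hy : y ∈ V) :
    ∃ b : L.Chart k, y ∈ b.dom ∧ b.dom ≤ V := exists_chart_le hL hy

include hπ in
omit [IsIntegral Y] [CompactSpace Y] in
lemma IsProjection.le_scale_preimage (c : kˣ) (V : Opens Y.toTopCat) : (Opens.map π.base).obj V ≤
    (Opens.map (L.scaleIso k c).hom.base).obj ((Opens.map π.base).obj V) :=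
  (hπ.scale_preimage c V).ge

include hL in
lemma IsProjection.toPuncturedCone_mem (v : H hπ.weightZero 1) :
    hπ.toPuncturedCone 1 v ∈ L.weightZeroCohomology k 1 := fun c =>
  pullback_fixed (L.tangentSequence_shortExact k) π.base (scaleMap c)
    (hπ.le_scale_preimage c) hπ.incl hπ.incl_injective (B := fun b : L.Chart k => b.dom)
    (chart_basis hL) (fun _ w => (hπ.mem_invariantFields_iff w.1).mp w.2 c) v

variable [CharZero k]

include hL in
lemma IsProjection.toPuncturedCone_injective : Function.Injective (hπ.toPuncturedCone 1) :=
  pullback_injective_of_decomposition (L.tangentSequence_shortExact k) π.base (scaleMap (two k))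
    (hπ.le_scale_preimage _) hπ.incl hπ.incl_injective (B := fun b : L.Chart k => b.dom)
    (chart_basis hL) (fun _ w => (hπ.mem_invariantFields_iff w.1).mp w.2 (two k))
    (fun _ x hx => ⟨⟨x, hπ.mem_invariantFields_of_two hL hx⟩, rfl⟩)
    (fun _ _ hx => hπ.act_eq_of_sub hL hx)
    (fun b x => hπ.exists_decomposition b x)

include hL in
lemma IsProjection.exists_toPuncturedCone_eq [LocallyOfFiniteType (Y ↘ Spec (.of k))]
    {v : H (tangentSheaf k (L.puncturedCone k)) 1} (hv : v ∈ L.weightZeroCohomology k 1) :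
    ∃ w, hπ.toPuncturedCone 1 w = v :=
  exists_pullback_eq_of_decomposition (L.tangentSequence_shortExact k) π.base (scaleMap (two k))
    (hπ.le_scale_preimage _) hπ.incl hπ.incl_injective (B := fun b : L.Chart k => b.dom)
    (chart_basis hL)
    (fun _ x hx => ⟨⟨x, hπ.mem_invariantFields_of_two hL hx⟩, rfl⟩)
    (fun _ _ hx => hπ.act_eq_of_sub hL hx)
    (fun b x => hπ.exists_decomposition b x)
    (fun b q => by
      have := b.isIntegral_puncturedCone
      have hW : IsAffineOpen (π ⁻¹ᵁ b.dom) := by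
        rw [hπ.preimage_dom b]
        exact b.isAffineOpen_coneDom
      have : Algebra.FiniteType k Γ(L.puncturedCone k, π ⁻¹ᵁ b.dom) := by
        rw [hπ.preimage_dom b]
        exact b.finiteType_coneDom
      exact exists_lift_of_isAffineOpen (L.tangentSequence_shortExact k) hW q)
    (hv (two k))

/-- The isomorphism `H¹(U, T_U)_{(0)} ≅ H¹(Y, (π_* T_U)_{(0)})`. -/
def IsProjection.weightZeroEquiv [LocallyOfFiniteType (Y ↘ Spec (.of k))] :
    L.weightZeroCohomology k 1 ≃ₗ[k] H hπ.weightZero 1 :=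
  (LinearEquiv.ofBijective ((hπ.toPuncturedCone 1).codRestrict _ (hπ.toPuncturedCone_mem hL))
    ⟨fun _ _ h => hπ.toPuncturedCone_injective hL (congrArg Subtype.val h), fun v =>
      (hπ.exists_toPuncturedCone_eq hL v.2).imp fun _ h => Subtype.ext h⟩).symm

lemma IsProjection.toPuncturedCone_weightZeroEquiv [LocallyOfFiniteType (Y ↘ Spec (.of k))]
    (v : L.weightZeroCohomology k 1) : hπ.toPuncturedCone 1 (hπ.weightZeroEquiv hL v) = v :=
  congrArg Subtype.val (LinearEquiv.apply_symm_apply (LinearEquiv.ofBijective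
    ((hπ.toPuncturedCone 1).codRestrict _ (hπ.toPuncturedCone_mem hL)) _) v)

end LineBundle

end AlgGeom

/-! ### Contraction of differentials with vector fields -/

lemma exists_toSheafify_eq {X : TopCat.{u}}
    (P : TopCat.Presheaf AddCommGrpCat.{u} X) {V : Opens X}
    (ω : ((presheafToSheaf (Opens.grothendieckTopology X) AddCommGrpCat.{u}).obj P).obj.obj (op V))
    {x : X} (hx : x ∈ V) :
    ∃ (W : Opens X) (hW : W ≤ V) (η : P.obj (op W)), x ∈ W ∧
      ((toSheafify (Opens.grothendieckTopology X) P).app (op W)).hom η =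
        (((presheafToSheaf (Opens.grothendieckTopology X) AddCommGrpCat.{u}).obj P).obj.map
          (homOfLE hW).op).hom ω := by
  have : Presheaf.IsLocallySurjective (Opens.grothendieckTopology X)
    (toSheafify (Opens.grothendieckTopology X) P) := inferInstance
  obtain ⟨W, f, ⟨η, hη⟩, hxW⟩ := Presheaf.imageSieve_mem (Opens.grothendieckTopology X)
    (toSheafify (Opens.grothendieckTopology X) P) ω x hx
  exact ⟨W, f.le, η, hxW, hη⟩

lemma exists_map_eq_of_toSheafify_eq {X : TopCat.{u}}
    (P : TopCat.Presheaf AddCommGrpCat.{u} X) {W : Opens X} {η η' : P.obj (op W)}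
    (h : ((toSheafify (Opens.grothendieckTopology X) P).app (op W)).hom η =
      ((toSheafify (Opens.grothendieckTopology X) P).app (op W)).hom η') {x : X} (hx : x ∈ W) :
    ∃ (W' : Opens X) (hW : W' ≤ W), x ∈ W' ∧
      (P.map (homOfLE hW).op).hom η = (P.map (homOfLE hW).op).hom η' := by
  have : Presheaf.IsLocallyInjective (Opens.grothendieckTopology X)
    (toSheafify (Opens.grothendieckTopology X) P) := inferInstance
  obtain ⟨W', f, hf, hxW⟩ := Presheaf.equalizerSieve_mem (Opens.grothendieckTopology X)
    (toSheafify (Opens.grothendieckTopology X) P) η η' h x hx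
  exact ⟨W', f.le, hxW, hf⟩

namespace AlgGeom

variable {k : Type u} [Field k] {X : Scheme.{u}} [X.Over (Spec (.of k))]

/-- The presheaf of abelian groups of Kähler differentials. -/
abbrev diffPre (k : Type u) [Field k] (X : Scheme.{u}) [X.Over (Spec (.of k))] :
    TopCat.Presheaf AddCommGrpCat.{u} X.toTopCat :=
  (differentialsPresheaf k X).presheaf

/-- Kähler differentials of the ring of functions on `W`. -/
abbrev Diff (k : Type u) [Field k] {X : Scheme.{u}} [X.Over (Spec (.of k))] (W : X.Opens) :
    ModuleCat.{u} Γ(X, W) :=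
  CommRingCat.KaehlerDifferential (CommRingCat.ofHom (algebraMap k Γ(X, W)))

/-- The differential of a function. -/
abbrev dif (k : Type u) [Field k] {X : Scheme.{u}} [X.Over (Spec (.of k))] {W : X.Opens}
    (f : Γ(X, W)) : Diff k W :=
  CommRingCat.KaehlerDifferential.d (f := CommRingCat.ofHom (algebraMap k Γ(X, W))) f

/-- Restriction of Kähler differentials. -/
def difRes {W W' : X.Opens} (h : W' ≤ W) : Diff k W →+ Diff k W' :=
  ((diffPre k X).map (homOfLE h).op).hom

lemma difRes_smul {W W' : X.Opens} (h : W' ≤ W) (a : Γ(X, W)) (η : Diff k W) :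
    difRes h (a • η) = res h a • difRes h η :=
  LinearMap.map_smul ((differentialsPresheaf k X).map (homOfLE h).op).hom a η

lemma difRes_dif {W W' : X.Opens} (h : W' ≤ W) (a : Γ(X, W)) :
    difRes h (dif k a) = dif k (res h a) := by
  have h1 := PresheafOfModules.DifferentialsConstruction.relativeDifferentials'_map_d
    (S' := (Functor.const _).obj (CommRingCat.of k)) (R := X.presheaf)
    { app := fun W => CommRingCat.ofHom (algebraMap k Γ(X, W.unop))
      naturality := fun W V i => by
        ext c
        exact (res_algebraMap k X i.unop.le c).symm } (homOfLE h).op a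
  exact h1

lemma dif_induction {W : X.Opens} {p : Diff k W → Prop} (h₀ : p 0)
    (hadd : ∀ η η', p η → p η' → p (η + η')) (hsmul : ∀ (a : Γ(X, W)) η, p η → p (a • η))
    (hd : ∀ a : Γ(X, W), p (dif k a)) (η : Diff k W) : p η := by
  let _ := (CommRingCat.ofHom (algebraMap k Γ(X, W))).hom.toAlgebra
  have h : η ∈ Submodule.span Γ(X, W) (Set.range (KaehlerDifferential.D k Γ(X, W))) := by
    rw [KaehlerDifferential.span_range_derivation]
    trivial
  induction h using Submodule.span_induction with
  | mem x hx =>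
    obtain ⟨a, rfl⟩ := hx
    exact hd a
  | zero => exact h₀
  | add x y _ _ hx hy => exact hadd x y hx hy
  | smul a x _ hx => exact hsmul a x hx

/-- The contraction of Kähler differentials with a vector field. -/
def preContr {W V : X.Opens} (D : vectorFields k X V) (hW : W ≤ V) : Diff k W →ₗ[Γ(X, W)] Γ(X, W) :=
  (ModuleCat.Derivation.desc (M := ModuleCat.of Γ(X, W) Γ(X, W))
    (ModuleCat.Derivation.mk (fun f => VF.ap D hW f) (fun f g => VF.ap_add D hW f g)
      (fun f g => VF.ap_mul D hW f g) (fun c => VF.ap_algebraMap D hW c))).hom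

lemma preContr_dif {W V : X.Opens} (D : vectorFields k X V) (hW : W ≤ V) (f : Γ(X, W)) :
    preContr D hW (dif k f) = VF.ap D hW f :=
  ModuleCat.Derivation.desc_d _ _

lemma preContr_difRes {W W' V : X.Opens} (D : vectorFields k X V) (hW : W ≤ V) (h : W' ≤ W)
    (η : Diff k W) : preContr D (h.trans hW) (difRes h η) = res h (preContr D hW η) := by
  induction η using dif_induction with
  | h₀ => simp only [map_zero]
  | hadd η η' h₁ h₂ => rw [map_add, map_add, map_add, map_add, h₁, h₂]
  | hsmul a η h₁ => rw [difRes_smul, map_smul, map_smul, smul_eq_mul, smul_eq_mul, map_mul, h₁]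
  | hd a => rw [difRes_dif, preContr_dif, preContr_dif, VF.ap_res]

lemma preContr_vectorFieldsRes {W V V' : X.Opens} (D : vectorFields k X V) (hV : V' ≤ V)
    (hW : W ≤ V') : preContr (vectorFieldsRes k X hV D) hW = preContr D (hW.trans hV) := rfl

lemma preContr_add {W V : X.Opens} (D D' : vectorFields k X V) (hW : W ≤ V) (η : Diff k W) :
    preContr (D + D') hW η = preContr D hW η + preContr D' hW η := by
  induction η using dif_induction with
  | h₀ => simp only [map_zero, add_zero]
  | hadd η η' h₁ h₂ => rw [map_add, map_add, map_add, h₁, h₂]; abel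
  | hsmul a η h₁ => rw [map_smul, map_smul, map_smul, h₁, smul_add]
  | hd a => rw [preContr_dif, preContr_dif, preContr_dif]; rfl

lemma preContr_smul {W V : X.Opens} (c : k) (D : vectorFields k X V) (hW : W ≤ V) (η : Diff k W) :
    preContr (c • D) hW η = c • preContr D hW η := by
  induction η using dif_induction with
  | h₀ => simp only [map_zero, smul_zero]
  | hadd η η' h₁ h₂ => rw [map_add, map_add, h₁, h₂, smul_add]
  | hsmul a η h₁ => rw [map_smul, map_smul, h₁, smul_eq_mul, smul_eq_mul, mul_smul_comm]
  | hd a => rw [preContr_dif, preContr_dif]; rfl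

/-- Restriction of sections of the cotangent sheaf. -/
abbrev omRes {V V' : X.Opens} (h : V' ≤ V) :
    (cotangentSheaf k X).obj.obj (op V) →+ (cotangentSheaf k X).obj.obj (op V') :=
  ((cotangentSheaf k X).obj.map (homOfLE h).op).hom

/-- The section of the cotangent sheaf given by a Kähler differential. -/
def toOm {W : X.Opens} : Diff k W →+ (cotangentSheaf k X).obj.obj (op W) :=
  ((toSheafify (Opens.grothendieckTopology X) (diffPre k X)).app (op W)).hom

lemma omRes_omRes {V V' V'' : X.Opens} (h : V' ≤ V) (h' : V'' ≤ V')
    (ω : (cotangentSheaf k X).obj.obj (op V)) : omRes h' (omRes h ω) = omRes (h'.trans h) ω := by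
  simp only [omRes, ← AddMonoidHom.comp_apply, ← AddCommGrpCat.hom_comp, ← Functor.map_comp]
  rfl

lemma toOm_difRes {W W' : X.Opens} (h : W' ≤ W) (η : Diff k W) :
    toOm (difRes h η) = omRes h (toOm η) :=
  congrArg (fun φ => φ.hom η)
    ((toSheafify (Opens.grothendieckTopology X) (diffPre k X)).naturality (homOfLE h).op)

lemma preContr_eq_of_toOm_eq {W V : X.Opens} (D : vectorFields k X V) (hW : W ≤ V) {η η' : Diff k W}
    (h : toOm η = toOm η') : preContr D hW η = preContr D hW η' := by
  refine sections_ext (ι := {W' : X.Opens // ∃ hW' : W' ≤ W, difRes hW' η = difRes hW' η'})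
    (U := Subtype.val) (fun x hx => ?_) fun W' _ => ?_
  · obtain ⟨W', hW', hx', h'⟩ := exists_map_eq_of_toSheafify_eq (diffPre k X) h hx
    exact ⟨⟨W', hW', h'⟩, hx', hW'⟩
  · obtain ⟨hW', h'⟩ := W'.2
    rw [← preContr_difRes, ← preContr_difRes, h']

lemma preContr_eq_on_inf {V W W' : X.Opens} (D : vectorFields k X V)
    {ω : (cotangentSheaf k X).obj.obj (op V)} (hW : W ≤ V) (hW' : W' ≤ V) {η : Diff k W}
    {η' : Diff k W'} (h : toOm η = omRes hW ω) (h' : toOm η' = omRes hW' ω) :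
    res (inf_le_left : W ⊓ W' ≤ W) (preContr D hW η) =
      res (inf_le_right : W ⊓ W' ≤ W') (preContr D hW' η') := by
  rw [← preContr_difRes, ← preContr_difRes]
  refine preContr_eq_of_toOm_eq D _ ?_
  have h1 := (toOm_difRes (inf_le_left : W ⊓ W' ≤ W) η).trans
    ((congrArg (omRes inf_le_left) h).trans (omRes_omRes _ _ _))
  have h2 := (toOm_difRes (inf_le_right : W ⊓ W' ≤ W') η').trans
    ((congrArg (omRes inf_le_right) h').trans (omRes_omRes _ _ _))
  exact h1.trans h2.symm

lemma existsUnique_contr {V : X.Opens} (D : vectorFields k X V)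
    (ω : (cotangentSheaf k X).obj.obj (op V)) : ∃! c : Γ(X, V), ∀ (W : X.Opens) (hW : W ≤ V)
      (η : Diff k W), toOm η = omRes hW ω → res hW c = preContr D hW η := by
  let J := {W : X.Opens // ∃ (hW : W ≤ V) (η : Diff k W), toOm η = omRes hW ω}
  have hcov : ∀ x ∈ V, ∃ W : J, x ∈ W.1 := fun x hx => by
    obtain ⟨W, hW, η, hxW, h⟩ := exists_toSheafify_eq (diffPre k X) ω hx
    exact ⟨⟨W, hW, η, h⟩, hxW⟩
  choose hW η hη using fun W : J => W.2
  obtain ⟨c, hc⟩ := sections_glue (U := fun W : J => W.1) hW hcov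
    (fun W => preContr D (hW W) (η W)) (fun W W' => preContr_eq_on_inf D _ _ (hη W) (hη W'))
  refine ⟨c, fun W' hW' η' h' => ?_, fun c' hc' => ?_⟩
  · refine sections_ext (U := fun W : J => W.1 ⊓ W') (fun x hx => ?_) fun W h => ?_
    · obtain ⟨W, hxW⟩ := hcov x (hW' hx)
      exact ⟨W, ⟨hxW, hx⟩, inf_le_right⟩
    · refine Eq.trans ?_ (preContr_eq_on_inf D _ _ (hη W) h')
      rw [← hc, res_res, res_res]
  · refine sections_ext (U := fun W : J => W.1) (fun x hx => ?_) fun W h => ?_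
    · obtain ⟨W, hxW⟩ := hcov x hx
      exact ⟨W, hxW, hW W⟩
    · rw [hc' W.1 h (η W) (hη W), hc]

/-- The contraction of a section of the cotangent sheaf with a vector field. -/
def contr {V : X.Opens} (D : vectorFields k X V) (ω : (cotangentSheaf k X).obj.obj (op V)) :
    Γ(X, V) :=
  (existsUnique_contr D ω).choose

lemma res_contr {W V : X.Opens} (D : vectorFields k X V) (hW : W ≤ V)
    {ω : (cotangentSheaf k X).obj.obj (op V)} {η : Diff k W} (h : toOm η = omRes hW ω) :
    res hW (contr D ω) = preContr D hW η :=
  (existsUnique_contr D ω).choose_spec.1 W hW η h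

lemma contr_eq_of_local {V : X.Opens} (D : vectorFields k X V)
    (ω : (cotangentSheaf k X).obj.obj (op V)) {c : Γ(X, V)}
    (h : ∀ (W : X.Opens) (hW : W ≤ V) (η : Diff k W), toOm η = omRes hW ω →
      res hW c = preContr D hW η) : c = contr D ω :=
  (existsUnique_contr D ω).choose_spec.2 c h

lemma contr_res {V V' : X.Opens} (h : V' ≤ V) (D : vectorFields k X V)
    (ω : (cotangentSheaf k X).obj.obj (op V)) :
    res h (contr D ω) = contr (vectorFieldsRes k X h D) (omRes h ω) :=
  contr_eq_of_local _ _ fun W hW η hη => by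
    rw [res_res, res_contr D (hW.trans h) (hη.trans (omRes_omRes _ _ _)), preContr_vectorFieldsRes]

lemma contr_add {V : X.Opens} (D D' : vectorFields k X V)
    (ω : (cotangentSheaf k X).obj.obj (op V)) : contr (D + D') ω = contr D ω + contr D' ω :=
  (contr_eq_of_local _ _ fun W hW η hη => by
    rw [map_add, res_contr D hW hη, res_contr D' hW hη, preContr_add]).symm

lemma contr_smul {V : X.Opens} (c : k) (D : vectorFields k X V)
    (ω : (cotangentSheaf k X).obj.obj (op V)) : contr (c • D) ω = c • contr D ω :=
  (contr_eq_of_local _ _ fun W hW η hη => by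
    rw [res_smul, res_contr D hW hη, preContr_smul]).symm

lemma contr_sub {V : X.Opens} (D : vectorFields k X V)
    (ω ω' : (cotangentSheaf k X).obj.obj (op V)) :
    contr D (ω - ω') = contr D ω - contr D ω' := by
  refine sections_ext (ι := {W : X.Opens // ∃ (hW : W ≤ V) (η η' : Diff k W), toOm η = omRes hW ω ∧
    toOm η' = omRes hW ω'}) (U := Subtype.val) (fun x hx => ?_) fun W _ => ?_
  · obtain ⟨W, hW, η, hxW, h⟩ := exists_toSheafify_eq (diffPre k X) ω hx
    obtain ⟨W', hW', η', hxW', h'⟩ := exists_toSheafify_eq (diffPre k X) ω' hx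
    refine ⟨⟨W ⊓ W', inf_le_left.trans hW, difRes inf_le_left η, difRes inf_le_right η', ?_, ?_⟩,
      ⟨hxW, hxW'⟩, inf_le_left.trans hW⟩
    · exact (toOm_difRes _ _).trans ((congrArg _ h).trans (omRes_omRes _ _ _))
    · exact (toOm_difRes _ _).trans ((congrArg _ h').trans (omRes_omRes _ _ _))
  · obtain ⟨hW, η, η', h, h'⟩ := W.2
    rw [map_sub, res_contr D hW h, res_contr D hW h', ← map_sub]
    exact res_contr D hW (by rw [map_sub, map_sub, h, h'])

lemma contr_dlog {V : X.Opens} (D : vectorFields k X V) (g : Γ(X, V)ˣ) :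
    contr D (dlog k g) = ((g⁻¹ : Γ(X, V)ˣ) : Γ(X, V)) * VF.ap D le_rfl (g : Γ(X, V)) := by
  have h : toOm (dlogPre k g) = omRes le_rfl (dlog k g) := by
    have := (cotangentSheaf k X).obj.map_id (op V)
    exact (congrArg (fun φ => φ.hom (dlog k g)) this).symm
  have h1 := res_contr D le_rfl h
  rw [res_self] at h1
  rw [h1, dlogPre, map_smul, smul_eq_mul]
  congr 1
  exact preContr_dif D le_rfl _

end AlgGeom

/-! ### The Euler sequence of a line bundle with vanishing Atiyah class -/

namespace AlgGeom

namespace LineBundle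

open SheafCoh LaurentPolynomial LaurentDer

variable {k : Type u} [Field k] {Y : Scheme.{u}} {L : LineBundle Y} [Y.Over (Spec (.of k))]

/-- If the Atiyah class vanishes, the cocycle `d log (g i j)` is a coboundary: `L` has a connection
with local connection forms `ω i`. -/
lemma exists_connection (h : L.atiyahClass k = 0) :
    ∃ ω : ∀ i, (cotangentSheaf k Y).obj.obj (op (L.V i)), ∀ i j,
      omRes (inf_le_right : L.V i ⊓ L.V j ≤ L.V j) (ω j) -
        omRes (inf_le_left : L.V i ⊓ L.V j ≤ L.V i) (ω i) = dlog k (L.g i j) := by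
  obtain ⟨ω, hω⟩ := (QuotientAddGroup.eq_zero_iff _).mp h
  exact ⟨ω, fun i j => congrFun (congrFun hω i) j⟩

section

variable (ω : ∀ i, (cotangentSheaf k Y).obj.obj (op (L.V i))) {V : Y.Opens}

/-- The contraction of a vector field with the local connection form `ω i`. -/
def connectionTerm (D : vectorFields k Y V) (i : L.ι) : Γ(Y, V ⊓ L.V i) :=
  contr (vectorFieldsRes k Y inf_le_left D) (omRes inf_le_right (ω i))

lemma connectionTerm_add (D D' : vectorFields k Y V) (i : L.ι) :
    connectionTerm ω (D + D') i = connectionTerm ω D i + connectionTerm ω D' i := by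
  rw [connectionTerm, map_add, contr_add, connectionTerm, connectionTerm]

lemma connectionTerm_smul (c : k) (D : vectorFields k Y V) (i : L.ι) :
    connectionTerm ω (c • D) i = c • connectionTerm ω D i := by
  rw [connectionTerm, map_smul, contr_smul, connectionTerm]

lemma connectionTerm_zero (i : L.ι) : connectionTerm ω (0 : vectorFields k Y V) i = 0 := by
  have := connectionTerm_smul ω (0 : k) (0 : vectorFields k Y V) i
  rwa [zero_smul, zero_smul] at this

lemma res_connectionTerm (D : vectorFields k Y V) (i : L.ι) {Z : Y.Opens} (hZ : Z ≤ V)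
    (hi : Z ≤ L.V i) : res (le_inf hZ hi) (connectionTerm ω D i) =
      contr (vectorFieldsRes k Y hZ D) (omRes hi (ω i)) :=
  (contr_res (le_inf hZ hi) _ _).trans (congrArg _ (omRes_omRes _ _ _))

lemma connectionTerm_res {V' : Y.Opens} (h : V' ≤ V) (D : vectorFields k Y V) (i : L.ι) :
    connectionTerm ω (vectorFieldsRes k Y h D) i =
      res (inf_le_inf_right _ h) (connectionTerm ω D i) :=
  (res_connectionTerm ω D i (inf_le_left.trans h) inf_le_right).symm

variable {ω}

/-- The local connection terms differ by logarithmic derivatives of the transition functions. -/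
lemma connectionTerm_sub (hω : ∀ i j, omRes (inf_le_right : L.V i ⊓ L.V j ≤ L.V j) (ω j) -
    omRes (inf_le_left : L.V i ⊓ L.V j ≤ L.V i) (ω i) = dlog k (L.g i j))
    (D : vectorFields k Y V) {i j : L.ι} {Z : Y.Opens} (hZ : Z ≤ V) (hij : Z ≤ L.V i ⊓ L.V j) :
    res hij (L.g i j : Γ(Y, L.V i ⊓ L.V j)) *
      (res (le_inf hZ (hij.trans inf_le_right)) (connectionTerm ω D j) -
        res (le_inf hZ (hij.trans inf_le_left)) (connectionTerm ω D i)) =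
      VF.ap D hZ (res hij (L.g i j : Γ(Y, L.V i ⊓ L.V j))) := by
  have h1 := congrArg (omRes hij) (hω i j)
  rw [map_sub] at h1
  have h2 : omRes (hij.trans inf_le_right) (ω j) - omRes (hij.trans inf_le_left) (ω i) =
      dlog k (Units.map (res hij : Γ(Y, L.V i ⊓ L.V j) →* Γ(Y, Z)) (L.g i j)) :=
    (congrArg₂ (· - ·) (omRes_omRes _ _ _).symm (omRes_omRes _ _ _).symm).trans
      (h1.trans (dlog_res hij _))
  have h3 := contr_dlog (vectorFieldsRes k Y hZ D)
    (Units.map (res hij : Γ(Y, L.V i ⊓ L.V j) →* Γ(Y, Z)) (L.g i j))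
  rw [← h2, contr_sub, ← res_connectionTerm ω D j hZ, ← res_connectionTerm ω D i hZ] at h3
  rw [h3, ← mul_assoc]
  exact (congrArg (· * _) (Units.mul_inv
    (Units.map (res hij : Γ(Y, L.V i ⊓ L.V j) →* Γ(Y, Z)) (L.g i j)))).trans
    (one_mul _)

end

variable [IsIntegral Y] [CompactSpace Y] {π : L.puncturedCone k ⟶ Y}

/-- The fibre coordinates are the coordinates `T` in charts. -/
lemma IsCoord.coneFn_eq {b : L.Chart k} (hπ : HasCoords π) (hb : b.coneDom ≤ π ⁻¹ᵁ (L.V b.i))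
    {t : Γ(L.puncturedCone k, b.coneDom)} (ht : IsCoord π b.i hb t) (hu : IsUnit t) :
    b.coneFn t = T 1 := by
  have hdom := (hπ.preimage_dom b).ge
  obtain ⟨τ, hτ⟩ := b.coneFn_bijective.2 (T 1)
  have h : IsCoord π b.i hb τ := fun m s => b.coneFn_bijective.1 <| by
    rw [b.coneFn_fn, ev_homog, map_mul, map_pow, hτ, ← hπ.coneFn_pull b hdom, pull_res, T_pow,
      mul_one]
  rw [ht.eq b hdom h hu, hτ]

variable (hπ : L.IsProjection k π) (hL : L.IsAmple k)

include hπ hL in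
lemma IsProjection.functions_ext {i : L.ι} {V : Y.Opens} (hV : V ≤ L.V i)
    {f f' : Γ(L.puncturedCone k, π ⁻¹ᵁ V)} (h : ∀ (b : L.Chart k) (_ : b.i = i) (hb : b.dom ≤ V),
      res (hπ.coneDom_le b hb) f = res (hπ.coneDom_le b hb) f') : f = f' := by
  refine sections_ext (U := fun b : {b : L.Chart k // b.i = i ∧ b.dom ≤ V} => b.1.coneDom)
    (fun x hx => ?_) fun b hb => h b.1 b.2.1 b.2.2
  obtain ⟨b, hbi, hb, hbV⟩ := L.exists_chart hL hV hx
  exact ⟨⟨b, hbi, hbV⟩, (hπ.preimage_dom b).le hb, hπ.coneDom_le b hbV⟩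

section

variable {t : ∀ i, Γ(L.puncturedCone k, π ⁻¹ᵁ (L.V i))ˣ}
  (ht : ∀ i, IsCoord π i le_rfl (t i : Γ(L.puncturedCone k, π ⁻¹ᵁ (L.V i))))

include hπ hL ht

/-- The fibre coordinates transform with the transition functions of `L`. -/
lemma IsProjection.coord_transition (i j : L.ι) :
    res (preimage_mono π inf_le_right) (t j : Γ(L.puncturedCone k, π ⁻¹ᵁ (L.V j))) =
      pull π (L.V i ⊓ L.V j) (π ⁻¹ᵁ (L.V i ⊓ L.V j)) le_rfl (L.g i j) *
        res (preimage_mono π inf_le_left) (t i : Γ(L.puncturedCone k, π ⁻¹ᵁ (L.V i))) := by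
  refine hπ.functions_ext hL (inf_le_right : _ ≤ L.V j) fun b hb hbV => ?_
  subst hb
  have h1 := hπ.coneDom_le b hbV
  rw [map_mul, res_res, res_res, res_pull]
  refine ((ht b.i).res (h1.trans (preimage_mono π inf_le_right))).eq b (hπ.preimage_dom b).ge
    (fun m s => ?_) ((t b.i).isUnit.map _)
  have h2 := congrArg (pull π (L.V i ⊓ L.V b.i) b.coneDom h1) (s.2 i b.i)
  rw [map_mul, map_pow, pull_res, pull_res] at h2
  rw [(ht i).res (h1.trans (preimage_mono π inf_le_left)) m s, h2, mul_pow]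
  ring

/-- The fibre coordinates have weight `1`. -/
lemma IsProjection.pull_scale_coord (c : kˣ) (i : L.ι) :
    pull (L.scale k c) _ _ (hπ.scale_preimage c (L.V i)).ge
      (t i : Γ(L.puncturedCone k, π ⁻¹ᵁ (L.V i))) =
      (c : k) • (t i : Γ(L.puncturedCone k, π ⁻¹ᵁ (L.V i))) := by
  refine hπ.functions_ext hL le_rfl fun b hb hbV => b.coneFn_bijective.1 ?_
  subst hb
  have h1 := hπ.coneDom_le b hbV
  have h2 : b.coneFn (res h1 (t b.i : Γ(L.puncturedCone k, π ⁻¹ᵁ (L.V b.i)))) = T 1 :=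
    ((ht b.i).res h1).coneFn_eq hπ.hasCoords _ ((t b.i).isUnit.map _)
  have h3 := b.coneFn_scale c (hπ.coneDom_le_scale c b)
    (res h1 (t b.i : Γ(L.puncturedCone k, π ⁻¹ᵁ (L.V b.i))))
  rw [pull_res, h2, scaleT_T, zpow_one] at h3
  rw [res_pull, res_smul, h3, ← h2]
  exact (map_smul b.coneEquiv (c : k) _).symm

lemma IsProjection.eulerField_coord (i : L.ι) :
    VF.ap (hπ.eulerField hL) le_top (t i : Γ(L.puncturedCone k, π ⁻¹ᵁ (L.V i))) = t i := by
  refine hπ.functions_ext hL le_rfl fun b hb hbV => b.coneFn_bijective.1 ?_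
  subst hb
  have h1 := hπ.coneDom_le b hbV
  have h2 : b.coneFn (res h1 (t b.i : Γ(L.puncturedCone k, π ⁻¹ᵁ (L.V b.i)))) = T 1 :=
    ((ht b.i).res h1).coneFn_eq hπ.hasCoords _ ((t b.i).isUnit.map _)
  rw [VF.ap_res, ← b.der_coneFn, hπ.der_eulerField, h2, euler_T]

end

section

variable (π) (t : ∀ i, Γ(L.puncturedCone k, π ⁻¹ᵁ (L.V i))ˣ)
  (ω : ∀ i, (cotangentSheaf k Y).obj.obj (op (L.V i))) {V : Y.Opens}

/-- The function `f` measures the difference between the vector field `E` on `π⁻¹ V` and the lift by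
the connection `ω` of the vector field `D` on `V`: `E (t i) / t i = f + ⟨D, ω i⟩`. -/
def IsVerticalPart (E : vectorFields k (L.puncturedCone k) (π ⁻¹ᵁ V)) (D : vectorFields k Y V)
    (f : Γ(L.puncturedCone k, π ⁻¹ᵁ V)) : Prop :=
  ∀ i, VF.ap E (preimage_mono π inf_le_left) (res (preimage_mono π (inf_le_right : V ⊓ L.V i ≤ _))
      (t i : Γ(L.puncturedCone k, π ⁻¹ᵁ (L.V i)))) =
    (res (preimage_mono π inf_le_left) f +
      pull π (V ⊓ L.V i) _ le_rfl (connectionTerm ω D i)) *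
      res (preimage_mono π inf_le_right) (t i : Γ(L.puncturedCone k, π ⁻¹ᵁ (L.V i)))

variable {π t ω} {E E' : vectorFields k (L.puncturedCone k) (π ⁻¹ᵁ V)} {D D' : vectorFields k Y V}
  {f f' : Γ(L.puncturedCone k, π ⁻¹ᵁ V)}

omit [IsIntegral Y] [CompactSpace Y]

lemma functions_ext_V (h : ∀ i, res (preimage_mono π (inf_le_left : V ⊓ L.V i ≤ V)) f =
    res (preimage_mono π (inf_le_left : V ⊓ L.V i ≤ V)) f') : f = f' := by
  refine sections_ext (U := fun i => π ⁻¹ᵁ (V ⊓ L.V i)) (fun x hx => ?_) fun i hi => h i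
  obtain ⟨i, hi⟩ := L.exists_mem_V (π x)
  exact ⟨i, ⟨hx, hi⟩, preimage_mono π inf_le_left⟩

lemma IsVerticalPart.eq (h : IsVerticalPart π t ω E D f) (h' : IsVerticalPart π t ω E D f') :
    f = f' :=
  functions_ext_V fun i => add_right_cancel <|
    ((t i).isUnit.map (res (preimage_mono π inf_le_right))).mul_right_cancel
      ((h i).symm.trans (h' i))

lemma IsVerticalPart.add (h : IsVerticalPart π t ω E D f) (h' : IsVerticalPart π t ω E' D' f') :
    IsVerticalPart π t ω (E + E') (D + D') (f + f') := fun i => by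
  rw [connectionTerm_add, RingHom.map_add, RingHom.map_add, VF.add_ap, h i, h' i]
  ring

lemma IsVerticalPart.smul [π.IsOver (Spec (.of k))] (h : IsVerticalPart π t ω E D f) (c : k) :
    IsVerticalPart π t ω (c • E) (c • D) (c • f) := fun i => by
  rw [connectionTerm_smul, res_smul, AlgGeom.pull_smul, ← smul_add, smul_mul_assoc, ← h i]
  rfl

lemma IsVerticalPart.restrict (h : IsVerticalPart π t ω E D f) {V' : Y.Opens} (hV : V' ≤ V) :
    IsVerticalPart π t ω (vectorFieldsRes k _ (preimage_mono π hV) E) (vectorFieldsRes k Y hV D)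
      (res (preimage_mono π hV) f) := fun i => by
  have h2 := congrArg (res (preimage_mono π (inf_le_inf_right (L.V i) hV))) (h i)
  rw [VF.ap_res, RingHom.map_mul, RingHom.map_add, res_res, res_res, res_pull] at h2
  rw [connectionTerm_res, res_res, pull_res]
  exact h2

lemma IsVerticalPart.restrict_pull {a : Γ(Y, V)}
    (h : IsVerticalPart π t ω E D (pull π V _ le_rfl a)) {V' : Y.Opens} (hV : V' ≤ V) :
    IsVerticalPart π t ω (vectorFieldsRes k _ (preimage_mono π hV) E) (vectorFieldsRes k Y hV D)
      (pull π V' _ le_rfl (res hV a)) := by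
  have h1 := h.restrict hV
  rw [res_pull] at h1
  rw [pull_res]
  exact h1

variable [IsIntegral Y] [CompactSpace Y]
  (ht : ∀ i, IsCoord π i le_rfl (t i : Γ(L.puncturedCone k, π ⁻¹ᵁ (L.V i))))

include hπ hL ht

lemma IsProjection.isVerticalPart_eulerMul (a : Γ(Y, V)) :
    IsVerticalPart π t ω (hπ.eulerMul hL V a) 0 (pull π V _ le_rfl a) := fun i => by
  rw [connectionTerm_zero, RingHom.map_zero, add_zero]
  change res _ (pull π V _ le_rfl a) * VF.ap (hπ.eulerField hL) le_top _ = _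
  rw [← VF.ap_res (hπ.eulerField hL) le_top, hπ.eulerField_coord hL ht]

/-- The functions `E (t i) / t i - ⟨D, ω i⟩` glue, as both terms change by the logarithmic
derivative of the transition function. -/
lemma IsProjection.exists_isVerticalPart
    (hω : ∀ i j, omRes (inf_le_right : L.V i ⊓ L.V j ≤ L.V j) (ω j) -
      omRes (inf_le_left : L.V i ⊓ L.V j ≤ L.V i) (ω i) = dlog k (L.g i j))
    (hED : ∀ (Z : Y.Opens) (hZ : Z ≤ V) (W : (L.puncturedCone k).Opens) (hW : W ≤ π ⁻¹ᵁ Z) (a),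
      VF.ap E (hW.trans (preimage_mono π hZ)) (pull π Z W hW a) = pull π Z W hW (VF.ap D hZ a)) :
    ∃ f, IsVerticalPart π t ω E D f := by
  have hu : ∀ i, IsUnit (res (preimage_mono π (inf_le_right : V ⊓ L.V i ≤ _))
    (t i : Γ(L.puncturedCone k, π ⁻¹ᵁ (L.V i)))) := fun i => (t i).isUnit.map _
  have hex : ∀ i, ∃ f : Γ(L.puncturedCone k, π ⁻¹ᵁ (V ⊓ L.V i)),
      VF.ap E (preimage_mono π inf_le_left) (res (preimage_mono π inf_le_right)
        (t i : Γ(L.puncturedCone k, π ⁻¹ᵁ (L.V i)))) =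
      (f + pull π (V ⊓ L.V i) _ le_rfl (connectionTerm ω D i)) *
        res (preimage_mono π inf_le_right)
          (t i : Γ(L.puncturedCone k, π ⁻¹ᵁ (L.V i))) := fun i => by
    obtain ⟨v, hv⟩ := (hu i).exists_left_inv
    refine ⟨VF.ap E (preimage_mono π inf_le_left) (res (preimage_mono π inf_le_right)
      (t i : Γ(L.puncturedCone k, π ⁻¹ᵁ (L.V i)))) * v -
      pull π (V ⊓ L.V i) _ le_rfl (connectionTerm ω D i), ?_⟩
    rw [sub_add_cancel, mul_assoc, hv, mul_one]
  choose f hf using hex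
  obtain ⟨f', hf'⟩ := sections_glue (U := fun i => π ⁻¹ᵁ (V ⊓ L.V i))
    (fun i => preimage_mono π inf_le_left) (fun x hx => by
      obtain ⟨i, hi⟩ := L.exists_mem_V (π x)
      exact ⟨i, hx, hi⟩) f (fun i j => by
    let Z : Y.Opens := V ⊓ (L.V i ⊓ L.V j)
    let W : (L.puncturedCone k).Opens := π ⁻¹ᵁ (V ⊓ L.V i) ⊓ π ⁻¹ᵁ (V ⊓ L.V j)
    have hW : W ≤ π ⁻¹ᵁ Z := fun x hx => ⟨hx.1.1, hx.1.2, hx.2.2⟩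
    have hWV : W ≤ π ⁻¹ᵁ V := fun x hx => hx.1.1
    have hWi : W ≤ π ⁻¹ᵁ (L.V i) := fun x hx => hx.1.2
    have hWj : W ≤ π ⁻¹ᵁ (L.V j) := fun x hx => hx.2.2
    have hWij : W ≤ π ⁻¹ᵁ (L.V i ⊓ L.V j) := fun x hx => ⟨hx.1.2, hx.2.2⟩
    have hi := congrArg (res (inf_le_left : W ≤ π ⁻¹ᵁ (V ⊓ L.V i))) (hf i)
    have hj := congrArg (res (inf_le_right : W ≤ π ⁻¹ᵁ (V ⊓ L.V j))) (hf j)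
    rw [VF.ap_res, RingHom.map_mul, RingHom.map_add, res_res, res_pull] at hi hj
    have hg := congrArg (res hWij) (hπ.coord_transition hL ht i j)
    rw [RingHom.map_mul, res_res, res_res, res_pull] at hg
    have hc := congrArg (pull π Z W hW) (connectionTerm_sub hω D (inf_le_left : Z ≤ V) inf_le_right)
    rw [← hED Z inf_le_left W hW, RingHom.map_mul, RingHom.map_sub, pull_res, pull_res,
      pull_res] at hc
    rw [hg, VF.ap_mul, hi, ← hc] at hj
    have h1 : IsUnit (pull π (L.V i ⊓ L.V j) W hWij (L.g i j) *
        res hWi (t i : Γ(L.puncturedCone k, π ⁻¹ᵁ (L.V i)))) :=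
      ((L.g i j).isUnit.map _).mul ((t i).isUnit.map _)
    refine h1.mul_right_cancel ?_
    linear_combination hj)
  refine ⟨f', fun i => ?_⟩
  rw [hf' i]
  exact hf i

/-- The vertical part of an invariant vector field is invariant. -/
lemma IsProjection.exists_pull_eq_of_isVerticalPart [CharZero k]
    (hE : E ∈ invariantFields (L.scale k) π V) (h : IsVerticalPart π t ω E D f) :
    ∃ a, pull π V _ le_rfl a = f := by
  refine hπ.exists_pull_eq hL (functions_ext_V fun i => ?_)
  let W := π ⁻¹ᵁ (V ⊓ L.V i)
  have hW : W ≤ L.scale k (two k) ⁻¹ᵁ W := (hπ.scale_preimage (two k) (V ⊓ L.V i)).ge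
  have hWV : W ≤ π ⁻¹ᵁ V := preimage_mono π inf_le_left
  have hWi : W ≤ π ⁻¹ᵁ (L.V i) := preimage_mono π inf_le_right
  have h1 := congrArg (pull (L.scale k (two k)) W W hW) (h i)
  have h2 := congrArg (res hWi) (hπ.pull_scale_coord hL ht (two k) i)
  rw [res_pull, res_smul] at h2
  have h3 : ∀ a : Γ(Y, V ⊓ L.V i), pull (L.scale k (two k)) W W hW (pull π _ W le_rfl a) =
      pull π _ W le_rfl a := fun a =>
    (pull_pull _ _ _ _ _ _ _ _).trans (pull_congr (hπ.scale_comp _) _ _ _ _ _)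
  rw [hE (two k) W W hWV hWV hW, RingHom.map_mul, RingHom.map_add, h3, pull_res, pull_res, h2] at h1
  have h4 : VF.ap E hWV (((two k : kˣ) : k) • res hWi
      (t i : Γ(L.puncturedCone k, π ⁻¹ᵁ (L.V i)))) = ((two k : kˣ) : k) • VF.ap E hWV (res hWi
      (t i : Γ(L.puncturedCone k, π ⁻¹ᵁ (L.V i)))) := Derivation.map_smul _ _ _
  have h5 := h1.symm.trans (h4.trans (congrArg _ (h i)))
  rw [mul_smul_comm] at h5
  have h6 := (two k).isUnit.smul_left_cancel.mp h5
  rw [res_pull]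
  exact add_right_cancel (((t i).isUnit.map (res hWi)).mul_right_cancel h6)

end

section

variable [CharZero k]

lemma IsProjection.ap_pull {V Z : Y.Opens} (E : invariantFields (k := k) (L.scale k) π V)
    (hZ : Z ≤ V) {W : (L.puncturedCone k).Opens} (hW : W ≤ π ⁻¹ᵁ Z) (a : Γ(Y, Z)) :
    VF.ap E.1 (hW.trans (preimage_mono π hZ)) (pull π Z W hW a) =
      pull π Z W hW (VF.ap (hπ.differentialField hL E) hZ a) := by
  have h := congrArg (res hW) (hπ.pull_differentialAp hL E hZ a)
  rw [res_pull, VF.ap_res, res_pull] at h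
  exact h.symm

variable {t : ∀ i, Γ(L.puncturedCone k, π ⁻¹ᵁ (L.V i))ˣ}
  {ω : ∀ i, (cotangentSheaf k Y).obj.obj (op (L.V i))}
  (ht : ∀ i, IsCoord π i le_rfl (t i : Γ(L.puncturedCone k, π ⁻¹ᵁ (L.V i))))
  (hω : ∀ i j, omRes (inf_le_right : L.V i ⊓ L.V j ≤ L.V j) (ω j) -
      omRes (inf_le_left : L.V i ⊓ L.V j ≤ L.V i) (ω i) = dlog k (L.g i j))

include ht hω in
lemma IsProjection.exists_verticalPart {V : Y.Opens}
    (E : invariantFields (k := k) (L.scale k) π V) :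
    ∃ a, IsVerticalPart π t ω E.1 (hπ.differentialField hL E) (pull π V _ le_rfl a) := by
  obtain ⟨f, hf⟩ := hπ.exists_isVerticalPart hL ht hω
    fun Z hZ W hW a => hπ.ap_pull hL E hZ hW a
  obtain ⟨a, rfl⟩ := hπ.exists_pull_eq_of_isVerticalPart hL ht E.2 hf
  exact ⟨a, hf⟩

/-- The function `a` on `V` such that `a E₀`, with `E₀` the Euler vector field, is the difference
between an invariant vector field and the lift of its image in `T_Y` by the connection. -/
def IsProjection.verticalPart {V : Y.Opens} (E : invariantFields (k := k) (L.scale k) π V) :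
    Γ(Y, V) := (hπ.exists_verticalPart hL ht hω E).choose

lemma IsProjection.isVerticalPart {V : Y.Opens} (E : invariantFields (k := k) (L.scale k) π V) :
    IsVerticalPart π t ω E.1 (hπ.differentialField hL E)
      (pull π V _ le_rfl (hπ.verticalPart hL ht hω E)) :=
  (hπ.exists_verticalPart hL ht hω E).choose_spec

lemma IsProjection.verticalPart_eq {V : Y.Opens} {E : invariantFields (k := k) (L.scale k) π V}
    {a : Γ(Y, V)}
    (h : IsVerticalPart π t ω E.1 (hπ.differentialField hL E) (pull π V _ le_rfl a)) :
    hπ.verticalPart hL ht hω E = a :=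
  hπ.pull_injective hL _ ((hπ.isVerticalPart hL ht hω E).eq h)

lemma IsProjection.verticalPart_add {V : Y.Opens}
    (E E' : invariantFields (k := k) (L.scale k) π V) : hπ.verticalPart hL ht hω (E + E') =
      hπ.verticalPart hL ht hω E + hπ.verticalPart hL ht hω E' := by
  have h := (hπ.isVerticalPart hL ht hω E).add (hπ.isVerticalPart hL ht hω E')
  rw [← hπ.differentialField_add, ← RingHom.map_add] at h
  exact hπ.verticalPart_eq hL ht hω h

lemma IsProjection.verticalPart_smul {V : Y.Opens} (c : k)
    (E : invariantFields (k := k) (L.scale k) π V) :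
    hπ.verticalPart hL ht hω (c • E) = c • hπ.verticalPart hL ht hω E := by
  have := hπ.isOver
  have h := (hπ.isVerticalPart hL ht hω E).smul c
  rw [← hπ.differentialField_smul, ← hπ.pull_smul] at h
  exact hπ.verticalPart_eq hL ht hω h

lemma IsProjection.verticalPart_res {V V' : Y.Opens} (h : V' ≤ V)
    (E : invariantFields (k := k) (L.scale k) π V) :
    hπ.verticalPart hL ht hω (invariantRes (k := k) (L.scale k) π h E) =
      res h (hπ.verticalPart hL ht hω E) :=
  hπ.verticalPart_eq hL ht hω ((hπ.isVerticalPart hL ht hω E).restrict_pull h)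

/-- The vertical part as a linear map. -/
def IsProjection.verticalLin (V : Y.Opens) :
    invariantFields (k := k) (L.scale k) π V →ₗ[k] Γ(Y, V) where
  toFun E := hπ.verticalPart hL ht hω E
  map_add' := hπ.verticalPart_add hL ht hω
  map_smul' := hπ.verticalPart_smul hL ht hω

lemma IsProjection.verticalPart_eulerLin {V : Y.Opens} (a : Γ(Y, V)) :
    hπ.verticalPart hL ht hω (hπ.eulerLin hL V a) = a := by
  refine hπ.verticalPart_eq hL ht hω ?_
  rw [hπ.differentialField_eulerLin]
  exact hπ.isVerticalPart_eulerMul hL ht a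

/-- The retraction of the Euler sequence defined by a connection on `L`. -/
def IsProjection.retraction : hπ.weightZero ⟶ structureSheaf k Y :=
  ObjectProperty.homMk
    { app V := ModuleCat.ofHom (hπ.verticalLin hL ht hω V.unop)
      naturality _ _ i := ModuleCat.hom_ext <| LinearMap.ext fun E =>
        hπ.verticalPart_res hL ht hω i.unop.le E }

lemma IsProjection.eulerHom_retraction : hπ.eulerHom hL ≫ hπ.retraction hL ht hω = 𝟙 _ :=
  hom_ext_sapp fun _ a => hπ.verticalPart_eulerLin hL ht hω a

end

end LineBundle

end AlgGeom

/-! ### The long exact sequence -/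

namespace SheafCoh

variable {k : Type u} [Field k] {X : TopCat.{u}}

section

variable {S : ShortComplex (TopCat.Sheaf (ModuleCat.{u} k) X)} (hS : S.ShortExact) (n : ℕ)

include hS in
lemma H.range_map_eq_ker_map : LinearMap.range (H.map S.f n) = LinearMap.ker (H.map S.g n) := by
  refine le_antisymm ?_ fun x hx => Abelian.Ext.covariant_sequence_exact₂ _ hS x hx
  rintro _ ⟨x, rfl⟩
  change (Abelian.Ext.comp x (.mk₀ S.f) (add_zero n)).comp (.mk₀ S.g) (add_zero n) = 0
  rw [Abelian.Ext.comp_assoc_of_third_deg_zero, Abelian.Ext.mk₀_comp_mk₀, S.zero,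
    Abelian.Ext.mk₀_zero, Abelian.Ext.comp_zero]

lemma H.range_map_eq_ker_connecting :
    LinearMap.range (H.map S.g n) = LinearMap.ker (H.connecting hS n) := by
  refine le_antisymm ?_ fun x hx => Abelian.Ext.covariant_sequence_exact₃ _ hS x rfl hx
  rintro _ ⟨x, rfl⟩
  change (Abelian.Ext.comp x (.mk₀ S.g) (add_zero n)).comp hS.extClass rfl = 0
  rw [Abelian.Ext.comp_assoc_of_second_deg_zero, hS.comp_extClass, Abelian.Ext.comp_zero]

/-- The connecting map of a split extension vanishes, as it is the composition with the class of the
extension. -/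
lemma H.connecting_eq_zero_of_retraction {r : S.X₂ ⟶ S.X₁} (hr : S.f ≫ r = 𝟙 _) :
    H.connecting hS n = 0 := by
  have h : hS.extClass = 0 := by
    have h1 := congrArg (fun x => x.comp (.mk₀ r) (add_zero 1)) hS.extClass_comp
    simpa only [Abelian.Ext.comp_assoc_of_third_deg_zero, Abelian.Ext.mk₀_comp_mk₀, hr,
      Abelian.Ext.comp_mk₀_id, Abelian.Ext.zero_comp] using h1
  refine LinearMap.ext fun x => ?_
  change Abelian.Ext.comp x hS.extClass rfl = 0
  rw [h, Abelian.Ext.comp_zero]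

end

end SheafCoh

section

variable {R A B C D M : Type*} [Ring R] [AddCommGroup A] [Module R A] [AddCommGroup B] [Module R B]
  [AddCommGroup C] [Module R C] [AddCommGroup D] [Module R D] [AddCommGroup M] [Module R M]
  {α : A →ₗ[R] B} {β : B →ₗ[R] C} {δ : C →ₗ[R] D}
  (h₁ : LinearMap.range α = LinearMap.ker β) (h₂ : LinearMap.range β = LinearMap.ker δ)
  (Φ : M ≃ₗ[R] B)

include h₁ h₂

/-- If `A ⟶ B ⟶ C ⟶ D` is exact and `M ≅ B`, then the quotient of `M` by the image
of `A` is isomorphic to the kernel of `C ⟶ D`. -/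
lemma LinearEquiv.exists_quotient_equiv_ker :
    ∃ Ψ : (M ⧸ LinearMap.range (Φ.symm.toLinearMap ∘ₗ α)) ≃ₗ[R] LinearMap.ker δ,
      ∀ v, (Ψ (Submodule.Quotient.mk v) : C) = β (Φ v) := by
  have h : LinearMap.range (Φ.symm.toLinearMap ∘ₗ α) =
      LinearMap.ker (β ∘ₗ Φ.toLinearMap) := by
    rw [LinearMap.range_comp, LinearMap.ker_comp, h₁]
    exact Submodule.map_equiv_eq_comap_symm _ _
  have h' : LinearMap.range (β ∘ₗ Φ.toLinearMap) = LinearMap.ker δ := by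
    rw [LinearMap.range_comp_of_range_eq_top _ Φ.range, h₂]
  exact ⟨(Submodule.quotEquivOfEq _ _ h).trans
    ((LinearMap.quotKerEquivRange _).trans (LinearEquiv.ofEq _ _ h')), fun v => rfl⟩

lemma LinearEquiv.exists_equiv_of_exact [Subsingleton A] (hδ : δ = 0) :
    ∃ Θ : M ≃ₗ[R] C, ∀ v, Θ v = β (Φ v) := by
  have hβ : LinearMap.ker β = ⊥ := by
    rw [← h₁, LinearMap.range_eq_bot]
    exact Subsingleton.elim _ _
  have hβ' : LinearMap.range β = ⊤ := by rw [h₂, hδ, LinearMap.ker_zero]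
  exact ⟨Φ.trans (LinearEquiv.ofBijective β ⟨LinearMap.ker_eq_bot.mp hβ,
    LinearMap.range_eq_top.mp hβ'⟩), fun _ => rfl⟩

end

end

theorem mainTheorem4 {k : Type u} [Field k] [IsAlgClosed k] [CharZero k]
    (Y : Scheme.{u}) [Y.Over (Spec (.of k))] [IsProper (Y ↘ Spec (.of k))] [IsIntegral Y]
    (L : AlgGeom.LineBundle Y) (hL : L.IsAmple k) :
    (∃! π : L.puncturedCone k ⟶ Y, L.IsProjection k π) ∧
    ∀ (π : L.puncturedCone k ⟶ Y) (hπ : L.IsProjection k π),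
      ∃ (e : AlgGeom.structureSheaf k Y ⟶ hπ.weightZero)
        (p : hπ.weightZero ⟶ AlgGeom.tangentSheaf k Y)
        (w : e ≫ p = 0) (hS : (ShortComplex.mk e p w).ShortExact),
        hπ.IsEulerMap e ∧ hπ.IsDifferential p ∧
        letI α : SheafCoh.H (AlgGeom.structureSheaf k Y) 1 →ₗ[k] SheafCoh.H hπ.weightZero 1 :=
          SheafCoh.H.map e 1
        letI β : SheafCoh.H hπ.weightZero 1 →ₗ[k] SheafCoh.H (AlgGeom.tangentSheaf k Y) 1 :=
          SheafCoh.H.map p 1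
        letI δ : SheafCoh.H (AlgGeom.tangentSheaf k Y) 1 →ₗ[k]
            SheafCoh.H (AlgGeom.structureSheaf k Y) 2 :=
          SheafCoh.H.connecting hS 1
        LinearMap.range α = LinearMap.ker β ∧
        LinearMap.range β = LinearMap.ker δ ∧
        ∃ Φ : L.weightZeroCohomology k 1 ≃ₗ[k] SheafCoh.H hπ.weightZero 1,
          (∀ v, hπ.toPuncturedCone 1 (Φ v) = v) ∧
          (∃ Ψ : (L.weightZeroCohomology k 1 ⧸ LinearMap.range (Φ.symm.toLinearMap ∘ₗ α)) ≃ₗ[k]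
              LinearMap.ker δ,
            ∀ v, (Ψ (Submodule.Quotient.mk v) : SheafCoh.H (AlgGeom.tangentSheaf k Y) 1) =
              β (Φ v)) ∧
          (Subsingleton (SheafCoh.H (AlgGeom.structureSheaf k Y) 1) →
            Subsingleton (SheafCoh.H (AlgGeom.structureSheaf k Y) 2) →
            ∃ Θ : L.weightZeroCohomology k 1 ≃ₗ[k] SheafCoh.H (AlgGeom.tangentSheaf k Y) 1,
              ∀ v, Θ v = β (Φ v)) ∧
          (Subsingleton (SheafCoh.H (AlgGeom.structureSheaf k Y) 1) → δ = 0 →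
            ∃ Θ : L.weightZeroCohomology k 1 ≃ₗ[k] SheafCoh.H (AlgGeom.tangentSheaf k Y) 1,
              ∀ v, Θ v = β (Φ v)) ∧
          (L.atiyahClass k = 0 → δ = 0) := by
  have : CompactSpace Y := QuasiCompact.compactSpace_of_compactSpace (Y ↘ Spec (.of k))
  refine ⟨AlgGeom.LineBundle.existsUnique_isProjection hL, fun π hπ => ?_⟩
  have h₁ := SheafCoh.H.range_map_eq_ker_map (hπ.shortExact hL) 1
  have h₂ := SheafCoh.H.range_map_eq_ker_connecting (hπ.shortExact hL) 1
  refine ⟨hπ.eulerHom hL, hπ.differential hL, hπ.eulerHom_differential hL, hπ.shortExact hL,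
    hπ.isEulerMap_eulerHom hL, hπ.isDifferential_differential hL, h₁, h₂, hπ.weightZeroEquiv hL,
    hπ.toPuncturedCone_weightZeroEquiv hL, LinearEquiv.exists_quotient_equiv_ker h₁ h₂ _,
    fun _ _ => LinearEquiv.exists_equiv_of_exact h₁ h₂ _
      (LinearMap.ext fun _ => Subsingleton.elim _ _),
    fun _ hδ => LinearEquiv.exists_equiv_of_exact h₁ h₂ _ hδ, fun hA => ?_⟩
  obtain ⟨ω, hω⟩ := AlgGeom.LineBundle.exists_connection hA
  obtain ⟨t, ht⟩ := hπ.hasCoords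
  exact SheafCoh.H.connecting_eq_zero_of_retraction (hπ.shortExact hL) 1
    (hπ.eulerHom_retraction hL ht hω)
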